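/- Fix $0<q<1$. Let $\mathcal U_q=\mathcal U_q(\mathfrak{su}(1,1))$ be the unital complex algebra generated by $K,K^{-1},E,F$ with relations $KK^{-1}=K^{-1}K=1$, $KE=qEK$, $KF=q^{-1}FK$, $EF-FE=\frac{K^2-K^{-2}}{q-q^{-1}}$, with $*$-structure $K^*=K$, $E^*=-F$ and comultiplication $\Delta(K^{\pm1})=K^{\pm1}\otimes K^{\pm1}$, $\Delta(E)=K\otimes E+E\otimes K^{-1}$, $\Delta(F)=K\otimes F+F\otimes K^{-1}$. Consider the following $*$-representations by unbounded operators, whose domain consists of the finite linear combinations of the standard orthonormal basis vectors $e_n$ of $\ell^2(\mathbb N)$ (for $\pi^\pm_k$, $k>0$) or of $\ell^2(\mathbb Z)$ (for $\pi^{\mathrm S}_{\sigma,\varepsilon}$, $\sigma,\varepsilon\in\mathbb R$): * positive discrete series: $\pi^+_k(K)e_n=q^{k+n}e_n$, $(q^{-1}-q)\pi^+_k(E)e_n=q^{-\frac12-k-n}\sqrt{(1-q^{2n+2})(1-q^{4k+2n})}\,e_{n+1}$, $(q^{-1}-q)\pi^+_k(F)e_n=-q^{\frac12-k-n}\sqrt{(1-q^{2n})(1-q^{4k+2n-2})}\,e_{n-1}$;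 * negative discrete series: $\pi^-_k(K)e_n=q^{-(k+n)}e_n$, $\pi^-_k(E)=\pi^+_k(F)$ and $\pi^-_k(F)=\pi^+_k(E)$; * strange series: $\pi^{\mathrm S}_{\sigma,\varepsilon}(K)e_n=q^{n+\varepsilon}e_n$, $(q^{-1}-q)\pi^{\mathrm S}_{\sigma,\varepsilon}(E)e_n=q^{-\frac12-n-\varepsilon}\sqrt{(1+q^{2n+2\varepsilon+2\sigma+1})(1+q^{2n+2\varepsilon-2\sigma+1})}\,e_{n+1}$, $(q^{-1}-q)\pi^{\mathrm S}_{\sigma,\varepsilon}(F)e_n=-q^{\frac12-n-\varepsilon}\sqrt{(1+q^{2n+2\varepsilon+2\sigma-1})(1+q^{2n+2\varepsilon-2\sigma-1})}\,e_{n-1}$. For $k_1,k_2>0$ and $\varepsilon\in\frac12\mathbb Z$ let $$\mathcal T'_{k_1,k_2,\varepsilon}=\Big(\big(\pi^-_{k_1}\otimes\pi^{\mathrm S}_{k_2-\frac12,\varepsilon+k_2}\big)\oplus\big(\pi^{\mathrm S}_{k_1-\frac12,-\varepsilon-k_1}\otimes\pi^+_{k_2}\big)\Big)\Delta$$ on $\big(\ell^2(\mathbb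 N)\otimes\ell^2(\mathbb Z)\big)\oplus\big(\ell^2(\mathbb Z)\otimes\ell^2(\mathbb N)\big)$, with domain the finite linear combinations of the vectors $e_i\otimes e_j$ of the two summands. For $p\in\mathbb Z$, $n\in\mathbb N$ put $$f^-_{p,n}=e_n\otimes e_{n+p}\in\ell^2(\mathbb N)\otimes\ell^2(\mathbb Z),\qquad f^+_{p,n}=e_{2\varepsilon-n+p}\otimes e_n\in\ell^2(\mathbb Z)\otimes\ell^2(\mathbb N).$$ Let $(x;q)_m=\prod_{i=0}^{m-1}(1-xq^i)$ for $m\in\mathbb N\cup\{\infty\}$, $(x_1,\dots,x_s;q)_m=\prod_j(x_j;q)_m$, $\theta(x;q)=(x,q/x;q)_\infty$, and let $$P_m(x;a,b,c;q)={}_3\varphi_2\!\left[\begin{matrix}q^{-m},\,abq^{m+1},\,x\\ aq,\,cq\end{matrix};q,q\right]=\sum_{k=0}^{m}\frac{(q^{-m},abq^{m+1},x;q)_k}{(q,aq,cq;q)_k}\,q^k$$ be the big $q$-Jacobi polynomials. Put $$u(x;a,b,c;q)=\frac{(x/a,x/c;q)_\infty}{(x,bx/c;q)_\infty},$$ $$v(m;a,b,c;q)=\frac{1-abq^{2m+1}}{aq(1-abq)}\,\frac{(aq,bq,cq,abq/c;q)_\infty}{(q,abq^2;q)_\infty\,\theta(c/a;q)}\,\frac{(aq,abq,cq;q)_m}{(q,bq,abq/c;q)_m}\,(-acq^2)^{-m}q^{-\frac12m(m-1)}$$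 (with the factor $1-abq$ cancelled, i.e. understood as a limit, when $abq=1$), and $$r_x(m;a,b,c;q)=\sqrt{|x|\,u(x;a,b,c;q)\,v(m;a,b,c;q)}\;P_m(x;a,b,c;q).$$ For $m\in\mathbb N$ define $$(\Theta f^-_{p,n})(m)=r_{q^{2n+4k_1}}\big(m;q^{4k_1-2},q^{4k_2-2},-q^{4k_1-2p-2\varepsilon-2};q^2\big),$$ $$(\Theta f^+_{p,n})(m)=(-1)^n\,r_{-q^{2n+4k_1-2p-2\varepsilon}}\big(m;q^{4k_1-2},q^{4k_2-2},-q^{4k_1-2p-2\varepsilon-2};q^2\big).$$ **Theorem.** The representation $\mathcal T'_{k_1,k_2,\varepsilon}$ is unitarily equivalent to $$\bigoplus_{m=0}^\infty\pi^{\mathrm S}_{k_1+k_2-\frac12+m,\ \varepsilon-k_1+k_2},$$ and the unitary intertwiner is given by normalized big $q$-Jacobi polynomials. Precisely: there is a unitary operator $$U:\big(\ell^2(\mathbb N)\otimes\ell^2(\mathbb Z)\big)\oplus\big(\ell^2(\mathbb Z)\otimes\ell^2(\mathbb N)\big)\to\bigoplus_{m=0}^\infty\ell^2(\mathbb Z)$$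 such that $$Uf^\sigma_{p,n}=\sum_{m=0}^\infty(\Theta f^\sigma_{p,n})(m)\,e^{(m)}_p,\qquad p\in\mathbb Z,\ n\in\mathbb N,\ \sigma\in\{-,+\},$$ where $e_p^{(m)}$ is the basis vector $e_p$ of the $m$-th copy of $\ell^2(\mathbb Z)$, and such that for every $v$ in the domain of $\mathcal T'$ the vector $Uv$ is in the domain of the direct sum and $$\Big(\bigoplus_{m}\pi^{\mathrm S}_{k_1+k_2-\frac12+m,\ \varepsilon-k_1+k_2}\Big)(X)\,Uv=U\,\mathcal T'(X)v\qquad\text{for all }X\in\mathcal U_q.$$ Here the domain of the direct sum consists of all $(\varphi_m)_m$ in the Hilbert space sum such that every $\varphi_m$ is in the domain of the $m$-th representation $\pi_m$ and $\sum_m\|\pi_m(X)\varphi_m\|^2<\infty$ for all $X\in\mathcal U_q$; the action is componentwise. -/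

import Mathlib

open scoped TensorProduct lp

noncomputable section

set_option linter.unusedSimpArgs false

namespace SU11

/-! ### The quantized universal enveloping algebra -/

inductive Gen
  | K | Kinv | E | F

/-- The defining relations of `U_q(su(1,1))`. -/
inductive Rel (q : ℝ) : FreeAlgebra ℂ Gen → FreeAlgebra ℂ Gen → Prop
  | K_Kinv : Rel q (FreeAlgebra.ι ℂ Gen.K * FreeAlgebra.ι ℂ Gen.Kinv) 1
  | Kinv_K : Rel q (FreeAlgebra.ι ℂ Gen.Kinv * FreeAlgebra.ι ℂ Gen.K) 1
  | K_E : Rel q (FreeAlgebra.ι ℂ Gen.K * FreeAlgebra.ι ℂ Gen.E)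
      ((q : ℂ) • (FreeAlgebra.ι ℂ Gen.E * FreeAlgebra.ι ℂ Gen.K))
  | K_F : Rel q (FreeAlgebra.ι ℂ Gen.K * FreeAlgebra.ι ℂ Gen.F)
      ((q : ℂ)⁻¹ • (FreeAlgebra.ι ℂ Gen.F * FreeAlgebra.ι ℂ Gen.K))
  | E_F : Rel q (FreeAlgebra.ι ℂ Gen.E * FreeAlgebra.ι ℂ Gen.F
        - FreeAlgebra.ι ℂ Gen.F * FreeAlgebra.ι ℂ Gen.E)
      (((q : ℂ) - (q : ℂ)⁻¹)⁻¹ •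
        (FreeAlgebra.ι ℂ Gen.K ^ 2 - FreeAlgebra.ι ℂ Gen.Kinv ^ 2))

/-- The algebra `U_q = U_q(su(1,1))`. -/
abbrev Uq (q : ℝ) : Type := RingQuot (Rel q)

/-- The generators, as elements of `U_q`. -/
def gen (q : ℝ) (g : Gen) : Uq q := RingQuot.mkAlgHom ℂ (Rel q) (FreeAlgebra.ι ℂ g)

section
variable {q : ℝ}

theorem K_mul_Kinv : gen q .K * gen q .Kinv = 1 := by
  simpa [gen, -Complex.coe_smul] using RingQuot.mkAlgHom_rel ℂ (Rel.K_Kinv (q := q))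

theorem Kinv_mul_K : gen q .Kinv * gen q .K = 1 := by
  simpa [gen, -Complex.coe_smul] using RingQuot.mkAlgHom_rel ℂ (Rel.Kinv_K (q := q))

theorem K_mul_E : gen q .K * gen q .E = (q : ℂ) • (gen q .E * gen q .K) := by
  simpa [gen, -Complex.coe_smul] using RingQuot.mkAlgHom_rel ℂ (Rel.K_E (q := q))

theorem K_mul_F : gen q .K * gen q .F = (q : ℂ)⁻¹ • (gen q .F * gen q .K) := by
  simpa [gen, -Complex.coe_smul] using RingQuot.mkAlgHom_rel ℂ (Rel.K_F (q := q))

theorem E_mul_F_sub : gen q .E * gen q .F - gen q .F * gen q .E =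
    ((q : ℂ) - (q : ℂ)⁻¹)⁻¹ • (gen q .K ^ 2 - gen q .Kinv ^ 2) := by
  simpa [gen, -Complex.coe_smul] using RingQuot.mkAlgHom_rel ℂ (Rel.E_F (q := q))

/-- `E K⁻¹ = q K⁻¹ E`. -/
theorem E_mul_Kinv : gen q .E * gen q .Kinv = (q : ℂ) • (gen q .Kinv * gen q .E) := by
  calc gen q .E * gen q .Kinv
      = gen q .Kinv * (gen q .K * gen q .E) * gen q .Kinv := by
        rw [← mul_assoc, Kinv_mul_K, one_mul]
    _ = (q : ℂ) • (gen q .Kinv * gen q .E * (gen q .K * gen q .Kinv)) := by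
        rw [K_mul_E]; simp only [mul_smul_comm, smul_mul_assoc, mul_assoc]
    _ = _ := by rw [K_mul_Kinv, mul_one]

/-- `F K⁻¹ = q⁻¹ K⁻¹ F`. -/
theorem F_mul_Kinv : gen q .F * gen q .Kinv = (q : ℂ)⁻¹ • (gen q .Kinv * gen q .F) := by
  calc gen q .F * gen q .Kinv
      = gen q .Kinv * (gen q .K * gen q .F) * gen q .Kinv := by
        rw [← mul_assoc, Kinv_mul_K, one_mul]
    _ = (q : ℂ)⁻¹ • (gen q .Kinv * gen q .F * (gen q .K * gen q .Kinv)) := by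
        rw [K_mul_F]; simp only [mul_smul_comm, smul_mul_assoc, mul_assoc]
    _ = _ := by rw [K_mul_Kinv, mul_one]

/-- The universal property of `U_q`: four elements satisfying the relations give a
homomorphism. -/
def lift {A : Type*} [Ring A] [Algebra ℂ A] (q : ℝ) (k k' e f : A)
    (h1 : k * k' = 1) (h2 : k' * k = 1) (h3 : k * e = (q : ℂ) • (e * k))
    (h4 : k * f = (q : ℂ)⁻¹ • (f * k))
    (h5 : e * f - f * e = ((q : ℂ) - (q : ℂ)⁻¹)⁻¹ • (k ^ 2 - k' ^ 2)) : Uq q →ₐ[ℂ] A :=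
  RingQuot.liftAlgHom ℂ ⟨FreeAlgebra.lift ℂ (fun g => match g with
      | .K => k
      | .Kinv => k'
      | .E => e
      | .F => f), by
    intro x y h
    cases h <;> simp [h1, h2, h3, h4, h5, -Complex.coe_smul]⟩

end

/-- The comultiplication: `Δ(K) = K ⊗ K`, `Δ(K⁻¹) = K⁻¹ ⊗ K⁻¹`, `Δ(E) = K ⊗ E + E ⊗ K⁻¹`,
`Δ(F) = K ⊗ F + F ⊗ K⁻¹`. -/
def comul (q : ℝ) (hq : q ≠ 0) : Uq q →ₐ[ℂ] Uq q ⊗[ℂ] Uq q :=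
  lift q (gen q .K ⊗ₜ[ℂ] gen q .K) (gen q .Kinv ⊗ₜ[ℂ] gen q .Kinv)
    (gen q .K ⊗ₜ[ℂ] gen q .E + gen q .E ⊗ₜ[ℂ] gen q .Kinv)
    (gen q .K ⊗ₜ[ℂ] gen q .F + gen q .F ⊗ₜ[ℂ] gen q .Kinv)
    (by simp [K_mul_Kinv, Algebra.TensorProduct.one_def])
    (by simp [Kinv_mul_K, Algebra.TensorProduct.one_def])
    (by
      simp only [mul_add, add_mul, Algebra.TensorProduct.tmul_mul_tmul, K_mul_E, K_mul_Kinv,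
        Kinv_mul_K, smul_add, TensorProduct.tmul_smul, TensorProduct.smul_tmul'])
    (by
      simp only [mul_add, add_mul, Algebra.TensorProduct.tmul_mul_tmul, K_mul_F, K_mul_Kinv,
        Kinv_mul_K, smul_add, TensorProduct.tmul_smul, TensorProduct.smul_tmul'])
    (by
      have hq' : (q : ℂ) ≠ 0 := by exact_mod_cast hq
      have e1 : gen q .E * gen q .F = gen q .F * gen q .E +
          ((q : ℂ) - (q : ℂ)⁻¹)⁻¹ • (gen q .K ^ 2 - gen q .Kinv ^ 2) := by
        rw [← E_mul_F_sub]; abel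
      simp only [mul_add, add_mul, Algebra.TensorProduct.tmul_mul_tmul, K_mul_F, K_mul_E,
        E_mul_Kinv, F_mul_Kinv, e1, TensorProduct.tmul_add, TensorProduct.add_tmul,
        TensorProduct.tmul_smul, ← TensorProduct.smul_tmul', TensorProduct.tmul_sub,
        TensorProduct.sub_tmul, pow_two, smul_smul, smul_sub, mul_inv_cancel₀ hq',
        inv_mul_cancel₀ hq', one_smul]
      abel)

/-! ### Unbounded `*`-representations -/

/-- A (densely defined, unbounded) `*`-representation of `U_q(su(1,1))` on `H`: an action of the
algebra on a common dense invariant domain, compatible with the `*`-structure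
`K* = K`, `E* = -F` (which is determined by these values, as is `(K⁻¹)* = K⁻¹`, `F* = -E`). -/
structure StarRep (q : ℝ) (H : Type*) [NormedAddCommGroup H] [InnerProductSpace ℂ H] where
  domain : Submodule ℂ H
  dense : Dense (domain : Set H)
  action : Uq q →ₐ[ℂ] Module.End ℂ domain
  star_K : ∀ v w : domain,
    inner ℂ (action (gen q .K) v : H) (w : H) = inner ℂ (v : H) (action (gen q .K) w : H)
  star_E : ∀ v w : domain,
    inner ℂ (action (gen q .E) v : H) (w : H) = -inner ℂ (v : H) (action (gen q .F) w : H)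

/-- The unitary operator `U` intertwines `π` with `π'`: it maps the domain of `π` into that of
`π'`, and `π'(X) U v = U π(X) v` for all `X ∈ U_q` and all `v` in the domain of `π`. -/
def StarRep.Intertwines {q : ℝ} {H H' : Type*} [NormedAddCommGroup H] [InnerProductSpace ℂ H]
    [NormedAddCommGroup H'] [InnerProductSpace ℂ H'] (π : StarRep q H) (π' : StarRep q H')
    (U : H ≃ₗᵢ[ℂ] H') : Prop :=
  ∀ v : π.domain, ∃ h : U v ∈ π'.domain,
    ∀ X : Uq q, (π'.action X ⟨U v, h⟩ : H') = U (π.action X v : H)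

/-- A `U_q`-module `V` embedded in `H` as a dense subspace, seen as a representation on `H`. -/
def StarRep.ofCore {q : ℝ} {V H : Type*} [AddCommMonoid V] [Module ℂ V]
    [NormedAddCommGroup H] [InnerProductSpace ℂ H] (π : Uq q →ₐ[ℂ] Module.End ℂ V)
    (j : V →ₗ[ℂ] H) (hj : Function.Injective j) (hd : DenseRange j)
    (hK : ∀ v w, inner ℂ (j (π (gen q .K) v)) (j w) = inner ℂ (j v) (j (π (gen q .K) w)))
    (hE : ∀ v w, inner ℂ (j (π (gen q .E) v)) (j w) = -inner ℂ (j v) (j (π (gen q .F) w))) :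
    StarRep q H where
  domain := LinearMap.range j
  dense := by simpa [DenseRange, LinearMap.coe_range] using hd
  action := ((LinearEquiv.ofInjective j hj).conjAlgEquiv ℂ).toAlgHom.comp π
  star_K := by
    intro v w
    obtain ⟨v, rfl⟩ := (LinearEquiv.ofInjective j hj).surjective v
    obtain ⟨w, rfl⟩ := (LinearEquiv.ofInjective j hj).surjective w
    simpa [LinearEquiv.conjAlgEquiv] using hK v w
  star_E := by
    intro v w
    obtain ⟨v, rfl⟩ := (LinearEquiv.ofInjective j hj).surjective v
    obtain ⟨w, rfl⟩ := (LinearEquiv.ofInjective j hj).surjective w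
    simpa [LinearEquiv.conjAlgEquiv] using hE v w

/-! ### Sequence spaces and finite linear combinations of basis vectors -/

/-- The inclusion of the finite linear combinations of the standard orthonormal basis vectors
`e_i` (represented by `Finsupp.single i 1`) into `ℓ²(ι)`. -/
def embed (ι : Type*) : (ι →₀ ℂ) →ₗ[ℂ] ℓ²(ι, ℂ) where
  toFun f := ⟨⇑f, (memℓp_zero (f.hasFiniteSupport)).of_exponent_ge zero_le⟩
  map_add' _ _ := rfl
  map_smul' _ _ := rfl

theorem embed_apply {ι : Type*} (f : ι →₀ ℂ) (i : ι) : embed ι f i = f i := rfl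

theorem embed_injective (ι : Type*) : Function.Injective (embed ι) := by
  intro f g h
  ext i
  rw [← embed_apply, h, embed_apply]

theorem embed_denseRange (ι : Type*) : DenseRange (embed ι) := by
  classical
  intro f
  refine mem_closure_of_tendsto (lp.hasSum_single (by norm_num) f)
    (Filter.Eventually.of_forall fun s => ⟨∑ i ∈ s, Finsupp.single i (f i), ?_⟩)
  rw [map_sum]
  refine Finset.sum_congr rfl fun i _ => ?_
  ext j
  simp [embed_apply, Finsupp.single_apply, Pi.single_apply, eq_comm]

theorem inner_embed_single {ι : Type*} [DecidableEq ι] (i j : ι) (a b : ℂ) :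
    inner ℂ (embed ι (Finsupp.single i a)) (embed ι (Finsupp.single j b)) =
      if i = j then inner ℂ a b else 0 := by
  have h : embed ι (Finsupp.single i a) = lp.single 2 i a := by
    ext j
    simp [embed_apply, Finsupp.single_apply, Pi.single_apply, eq_comm]
  rw [h, lp.inner_single_left, embed_apply, Finsupp.single_apply]
  by_cases h : j = i
  · simp [h]
  · simp [h, Ne.symm h]

/-- `A* = s B` formally, for the inner product that `V` inherits from `H`. -/
def IsAdj {V H : Type*} [AddCommMonoid V] [Module ℂ V] [NormedAddCommGroup H]
    [InnerProductSpace ℂ H] (j : V →ₗ[ℂ] H) (s : ℂ) (A B : Module.End ℂ V) : Prop :=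
  ∀ v w, inner ℂ (j (A v)) (j w) = s * inner ℂ (j v) (j (B w))

theorem IsAdj.of_single {ι : Type*} {s : ℂ} {A B : Module.End ℂ (ι →₀ ℂ)}
    (h : ∀ i j, inner ℂ (embed ι (A (Finsupp.single i 1))) (embed ι (Finsupp.single j 1)) =
      s * inner ℂ (embed ι (Finsupp.single i 1)) (embed ι (B (Finsupp.single j 1)))) :
    IsAdj (embed ι) s A B := by
  intro v w
  induction v using Finsupp.induction_linear with
  | zero => simp
  | add f g hf hg => simp only [map_add, inner_add_left, hf, hg, mul_add]
  | single i a =>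
    induction w using Finsupp.induction_linear with
    | zero => simp
    | add f g hf hg => simp only [map_add, inner_add_right, hf, hg, mul_add]
    | single j b =>
      have e1 : (Finsupp.single i a : ι →₀ ℂ) = a • Finsupp.single i 1 := by simp
      have e2 : (Finsupp.single j b : ι →₀ ℂ) = b • Finsupp.single j 1 := by simp
      rw [e1, e2]
      simp only [map_smul, inner_smul_left, inner_smul_right, h]
      ring

/-! ### Weight modules -/

/-- The operator `e_i ↦ c_i e_{s(i)}`. -/
def shift {ι : Type*} (s : ι → ι) (c : ι → ℝ) : Module.End ℂ (ι →₀ ℂ) :=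
  Finsupp.linearCombination ℂ fun i => Finsupp.single (s i) (c i : ℂ)

theorem shift_single {ι : Type*} (s : ι → ι) (c : ι → ℝ) (i : ι) (a : ℂ) :
    shift s c (Finsupp.single i a) = Finsupp.single (s i) (a * c i) := by
  simp [shift, -Complex.coe_smul]

/-- Data for an action of `U_q` of the form `K e_i = κ_i e_i`, `E e_i = c_i e_{up(i)}`,
`F e_i = d_i e_{dn(i)}`, and the conditions under which this is a `*`-representation. -/
structure WeightData (q : ℝ) (ι : Type*) where
  up : ι → ι
  dn : ι → ι
  κ : ι → ℝ
  c : ι → ℝ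
  d : ι → ℝ
  κ_ne : ∀ i, κ i ≠ 0
  c_up : ∀ i, c i = 0 ∨ (dn (up i) = i ∧ κ (up i) = q * κ i ∧ d (up i) = -c i)
  d_dn : ∀ i, d i = 0 ∨ (up (dn i) = i ∧ κ (dn i) = q⁻¹ * κ i ∧ c (dn i) = -d i)
  sq_sub : ∀ i, c i ^ 2 - d i ^ 2 = (q - q⁻¹)⁻¹ * (κ i ^ 2 - ((κ i)⁻¹) ^ 2)

/-- The `U_q`-module on the finite linear combinations of the `e_i` given by weight data. -/
def WeightData.rep {q : ℝ} {ι : Type*} (D : WeightData q ι) :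
    Uq q →ₐ[ℂ] Module.End ℂ (ι →₀ ℂ) :=
  lift q (shift id D.κ) (shift id fun i => (D.κ i)⁻¹) (shift D.up D.c) (shift D.dn D.d)
    (by
      refine Finsupp.lhom_ext fun i a => ?_
      have := D.κ_ne i
      simp [shift_single, mul_assoc, this, -Finsupp.single_mul])
    (by
      refine Finsupp.lhom_ext fun i a => ?_
      have := D.κ_ne i
      simp [shift_single, mul_assoc, this, -Finsupp.single_mul])
    (by
      refine Finsupp.lhom_ext fun i a => ?_
      rcases D.c_up i with h | ⟨-, h, -⟩
      · simp [shift_single, h, -Complex.coe_smul, -Finsupp.single_mul]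
      · simp only [Module.End.mul_apply, shift_single, LinearMap.smul_apply, Finsupp.smul_single,
          id, h, smul_eq_mul]
        congr 1; push_cast; ring)
    (by
      refine Finsupp.lhom_ext fun i a => ?_
      rcases D.d_dn i with h | ⟨-, h, -⟩
      · simp [shift_single, h, -Complex.coe_smul, -Finsupp.single_mul]
      · simp only [Module.End.mul_apply, shift_single, LinearMap.smul_apply, Finsupp.smul_single,
          id, h, smul_eq_mul]
        congr 1; push_cast; ring)
    (by
      refine Finsupp.lhom_ext fun i a => ?_
      have e1 : shift D.up D.c (shift D.dn D.d (Finsupp.single i a)) =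
          Finsupp.single i (-(a * (D.d i) ^ 2)) := by
        rcases D.d_dn i with h | ⟨h1, -, h2⟩
        · simp [shift_single, h]
        · rw [shift_single, shift_single, h1, h2]; congr 1; push_cast; ring
      have e2 : shift D.dn D.d (shift D.up D.c (Finsupp.single i a)) =
          Finsupp.single i (-(a * (D.c i) ^ 2)) := by
        rcases D.c_up i with h | ⟨h1, -, h2⟩
        · simp [shift_single, h]
        · rw [shift_single, shift_single, h1, h2]; congr 1; push_cast; ring
      have e3 := congrArg (fun x : ℝ => (x : ℂ)) (D.sq_sub i)
      push_cast at e3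
      simp only [LinearMap.sub_apply, Module.End.mul_apply, LinearMap.smul_apply, pow_two,
        id]
      rw [e1, e2]
      simp only [shift_single, id]
      rw [← Finsupp.single_sub, ← Finsupp.single_sub, Finsupp.smul_single, smul_eq_mul]
      refine congrArg (Finsupp.single i) ?_
      push_cast
      linear_combination a * e3)

theorem lift_gen {A : Type*} [Ring A] [Algebra ℂ A] (q : ℝ) (k k' e f : A)
    (h1 : k * k' = 1) (h2 : k' * k = 1) (h3 : k * e = (q : ℂ) • (e * k))
    (h4 : k * f = (q : ℂ)⁻¹ • (f * k))
    (h5 : e * f - f * e = ((q : ℂ) - (q : ℂ)⁻¹)⁻¹ • (k ^ 2 - k' ^ 2)) :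
    lift q k k' e f h1 h2 h3 h4 h5 (gen q .K) = k ∧
    lift q k k' e f h1 h2 h3 h4 h5 (gen q .Kinv) = k' ∧
    lift q k k' e f h1 h2 h3 h4 h5 (gen q .E) = e ∧
    lift q k k' e f h1 h2 h3 h4 h5 (gen q .F) = f := by
  simp [lift, gen]

section
variable {q : ℝ} {ι : Type*} (D : WeightData q ι)

theorem WeightData.rep_K : D.rep (gen q .K) = shift id D.κ := (lift_gen ..).1
theorem WeightData.rep_Kinv : D.rep (gen q .Kinv) = shift id fun i => (D.κ i)⁻¹ :=
  (lift_gen ..).2.1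
theorem WeightData.rep_E : D.rep (gen q .E) = shift D.up D.c := (lift_gen ..).2.2.1
theorem WeightData.rep_F : D.rep (gen q .F) = shift D.dn D.d := (lift_gen ..).2.2.2

theorem isAdj_shift_id (c : ι → ℝ) : IsAdj (embed ι) 1 (shift id c) (shift id c) := by
  classical
  refine IsAdj.of_single fun i j => ?_
  simp only [shift_single, inner_embed_single, id]
  by_cases h : i = j
  · subst h; simp
  · simp [h]

theorem WeightData.adj_K : IsAdj (embed ι) 1 (D.rep (gen q .K)) (D.rep (gen q .K)) := by
  rw [rep_K]; exact isAdj_shift_id _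

theorem WeightData.adj_Kinv : IsAdj (embed ι) 1 (D.rep (gen q .Kinv))
    (D.rep (gen q .Kinv)) := by
  rw [rep_Kinv]; exact isAdj_shift_id _

theorem WeightData.adj_E : IsAdj (embed ι) (-1) (D.rep (gen q .E)) (D.rep (gen q .F)) := by
  classical
  rw [rep_E, rep_F]
  refine IsAdj.of_single fun i j => ?_
  simp only [shift_single, inner_embed_single]
  by_cases h1 : D.up i = j
  · subst h1
    rcases D.c_up i with h | ⟨h1, -, h2⟩
    · rcases D.d_dn (D.up i) with h' | ⟨h3, -, h4⟩
      · simp [h, h']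
      · by_cases h5 : i = D.dn (D.up i)
        · rw [← h5] at h4
          have : D.d (D.up i) = 0 := by linarith
          simp [h, this]
        · simp [h, h5]
    · simp [h1, h2]
  · rcases D.d_dn j with h' | ⟨h3, -, h4⟩
    · simp [h', h1]
    · by_cases h5 : i = D.dn j
      · subst h5; exact absurd h3 h1
      · simp [h1, h5]

/-- The `*`-representation on `ℓ²(ι)` given by weight data. -/
def WeightData.starRep : StarRep q ℓ²(ι, ℂ) :=
  StarRep.ofCore D.rep (embed ι) (embed_injective ι) (embed_denseRange ι)
    (fun v w => by simpa using D.adj_K v w) (fun v w => by simpa using D.adj_E v w)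

end

/-! ### Discrete series and strange series -/

theorem discrete_c_sq {q k : ℝ} (hq : q ∈ Set.Ioo (0 : ℝ) 1) (hk : 0 < k) (n : ℕ) :
    ((q⁻¹ - q)⁻¹ * (q ^ (-1 / 2 - k - n) *
      √((1 - q ^ (2 * (n : ℝ) + 2)) * (1 - q ^ (4 * k + 2 * n))))) ^ 2 -
    (-((q⁻¹ - q)⁻¹ * (q ^ (1 / 2 - k - n) *
      √((1 - q ^ (2 * (n : ℝ))) * (1 - q ^ (4 * k + 2 * n - 2)))))) ^ 2 =
    (q - q⁻¹)⁻¹ * ((q ^ (k + n)) ^ 2 - ((q ^ (k + n))⁻¹) ^ 2) := by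
  obtain ⟨h0, h1⟩ := hq
  have le1 : ∀ x : ℝ, 0 ≤ x → 0 ≤ 1 - q ^ x := fun x hx =>
    sub_nonneg.2 (Real.rpow_le_one h0.le h1.le hx)
  have hn : (0 : ℝ) ≤ n := n.cast_nonneg
  have p1 : 0 ≤ (1 - q ^ (2 * (n : ℝ) + 2)) * (1 - q ^ (4 * k + 2 * n)) :=
    mul_nonneg (le1 _ (by positivity)) (le1 _ (by positivity))
  have p2 : 0 ≤ (1 - q ^ (2 * (n : ℝ))) * (1 - q ^ (4 * k + 2 * n - 2)) := by
    rcases Nat.eq_zero_or_pos n with rfl | h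
    · simp
    · have : (1 : ℝ) ≤ n := by exact_mod_cast h
      exact mul_nonneg (le1 _ (by positivity)) (le1 _ (by linarith))
  have hY : (0 : ℝ) < q ^ (k + n) := Real.rpow_pos_of_pos h0 _
  have hX : (0 : ℝ) < q ^ (n : ℝ) := Real.rpow_pos_of_pos h0 _
  have hZ : (0 : ℝ) < q ^ k := Real.rpow_pos_of_pos h0 _
  have hYX : q ^ (k + n) = q ^ k * q ^ (n : ℝ) := Real.rpow_add h0 _ _
  have sq : ∀ x : ℝ, (q ^ x) ^ 2 = q ^ (2 * x) := fun x => by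
    rw [mul_comm, Real.rpow_mul h0.le, Real.rpow_two]
  have a1 : (q ^ (-1 / 2 - k - n)) ^ 2 = q⁻¹ * ((q ^ k * q ^ (n : ℝ)) ^ 2)⁻¹ := by
    rw [← hYX, sq, sq, ← Real.rpow_neg h0.le, ← Real.rpow_neg_one, ← Real.rpow_add h0]
    congr 1; ring
  have a2 : (q ^ (1 / 2 - k - n)) ^ 2 = q * ((q ^ k * q ^ (n : ℝ)) ^ 2)⁻¹ := by
    rw [← hYX, sq, sq, ← Real.rpow_neg h0.le]
    nth_rewrite 2 [← Real.rpow_one q]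
    rw [← Real.rpow_add h0]
    congr 1; ring
  have a3 : q ^ (2 * (n : ℝ)) = (q ^ (n : ℝ)) ^ 2 := (sq _).symm
  have a4 : q ^ (2 * (n : ℝ) + 2) = (q ^ (n : ℝ)) ^ 2 * q ^ 2 := by
    rw [Real.rpow_add h0, a3, Real.rpow_two]
  have a5 : q ^ (4 * k + 2 * n) = (q ^ k) ^ 4 * (q ^ (n : ℝ)) ^ 2 := by
    rw [Real.rpow_add h0, a3, mul_comm 4 k, Real.rpow_mul h0.le]; norm_cast
  have a6 : q ^ (4 * k + 2 * n - 2) = (q ^ k) ^ 4 * (q ^ (n : ℝ)) ^ 2 / q ^ 2 := by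
    rw [Real.rpow_sub h0, a5, Real.rpow_two]
  rw [neg_sq]
  simp only [mul_pow, Real.sq_sqrt p1, Real.sq_sqrt p2]
  rw [a1, a2, a3, a4, a5, a6, hYX]
  have hq1 : q⁻¹ - q ≠ 0 := by
    have : 1 < q⁻¹ := (one_lt_inv₀ h0).2 h1
    linarith
  have e : (q - q⁻¹)⁻¹ = -(q⁻¹ - q)⁻¹ := by rw [← inv_neg, neg_sub]
  rw [e]
  generalize hw : (q⁻¹ - q)⁻¹ = w
  have hw' : w * (q⁻¹ - q) = 1 := by rw [← hw]; exact inv_mul_cancel₀ hq1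
  generalize q ^ k = z at *
  generalize q ^ (n : ℝ) = x at *
  have key : q⁻¹ * ((z * x) ^ 2)⁻¹ * ((1 - x ^ 2 * q ^ 2) * (1 - z ^ 4 * x ^ 2)) -
      q * ((z * x) ^ 2)⁻¹ * ((1 - x ^ 2) * (1 - z ^ 4 * x ^ 2 / q ^ 2)) =
      -(q⁻¹ - q) * ((z * x) ^ 2 - ((z * x)⁻¹) ^ 2) := by
    field_simp
    ring
  linear_combination w ^ 2 * key - w * ((z * x) ^ 2 - ((z * x)⁻¹) ^ 2) * hw'

theorem strange_c_sq {q : ℝ} (hq : q ∈ Set.Ioo (0 : ℝ) 1) (σ ε : ℝ) (n : ℤ) :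
    ((q⁻¹ - q)⁻¹ * (q ^ (-1 / 2 - n - ε) *
      √((1 + q ^ (2 * n + 2 * ε + 2 * σ + 1)) * (1 + q ^ (2 * n + 2 * ε - 2 * σ + 1))))) ^ 2 -
    (-((q⁻¹ - q)⁻¹ * (q ^ (1 / 2 - n - ε) *
      √((1 + q ^ (2 * n + 2 * ε + 2 * σ - 1)) * (1 + q ^ (2 * n + 2 * ε - 2 * σ - 1)))))) ^ 2 =
    (q - q⁻¹)⁻¹ * ((q ^ (n + ε)) ^ 2 - ((q ^ (n + ε))⁻¹) ^ 2) := by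
  obtain ⟨h0, h1⟩ := hq
  have ps : ∀ x : ℝ, 0 < 1 + q ^ x := fun x => by
    have := Real.rpow_pos_of_pos h0 x
    linarith
  have p : ∀ x y : ℝ, 0 ≤ (1 + q ^ x) * (1 + q ^ y) := fun x y => (mul_pos (ps x) (ps y)).le
  have hX : (0 : ℝ) < q ^ (n + ε) := Real.rpow_pos_of_pos h0 _
  have hZ : (0 : ℝ) < q ^ (2 * σ) := Real.rpow_pos_of_pos h0 _
  have sq : ∀ x : ℝ, (q ^ x) ^ 2 = q ^ (2 * x) := fun x => by
    rw [mul_comm, Real.rpow_mul h0.le, Real.rpow_two]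
  have a1 : (q ^ (-1 / 2 - n - ε)) ^ 2 = q⁻¹ * ((q ^ (n + ε)) ^ 2)⁻¹ := by
    rw [sq, sq, ← Real.rpow_neg h0.le, ← Real.rpow_neg_one, ← Real.rpow_add h0]
    congr 1; ring
  have a2 : (q ^ (1 / 2 - n - ε)) ^ 2 = q * ((q ^ (n + ε)) ^ 2)⁻¹ := by
    rw [sq, sq, ← Real.rpow_neg h0.le]
    nth_rewrite 2 [← Real.rpow_one q]
    rw [← Real.rpow_add h0]
    congr 1; ring
  have b1 : q ^ (2 * n + 2 * ε + 2 * σ + 1) = (q ^ (n + ε)) ^ 2 * q ^ (2 * σ) * q := by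
    rw [Real.rpow_add h0, Real.rpow_add h0, Real.rpow_one, sq, mul_add]
  have b2 : q ^ (2 * n + 2 * ε - 2 * σ + 1) = (q ^ (n + ε)) ^ 2 / q ^ (2 * σ) * q := by
    rw [Real.rpow_add h0, Real.rpow_sub h0, Real.rpow_one, sq, mul_add]
  have b3 : q ^ (2 * n + 2 * ε + 2 * σ - 1) = (q ^ (n + ε)) ^ 2 * q ^ (2 * σ) / q := by
    rw [Real.rpow_sub h0, Real.rpow_add h0, Real.rpow_one, sq, mul_add]
  have b4 : q ^ (2 * n + 2 * ε - 2 * σ - 1) = (q ^ (n + ε)) ^ 2 / q ^ (2 * σ) / q := by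
    rw [Real.rpow_sub h0, Real.rpow_sub h0, Real.rpow_one, sq, mul_add]
  rw [neg_sq]
  simp only [mul_pow, Real.sq_sqrt (p _ _)]
  rw [a1, a2, b1, b2, b3, b4]
  have hq1 : q⁻¹ - q ≠ 0 := by
    have : 1 < q⁻¹ := (one_lt_inv₀ h0).2 h1
    linarith
  have e : (q - q⁻¹)⁻¹ = -(q⁻¹ - q)⁻¹ := by rw [← inv_neg, neg_sub]
  rw [e]
  generalize hw : (q⁻¹ - q)⁻¹ = w
  have hw' : w * (q⁻¹ - q) = 1 := by rw [← hw]; exact inv_mul_cancel₀ hq1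
  generalize q ^ (2 * σ) = z at *
  generalize q ^ (n + ε) = x at *
  have key : q⁻¹ * (x ^ 2)⁻¹ * ((1 + x ^ 2 * z * q) * (1 + x ^ 2 / z * q)) -
      q * (x ^ 2)⁻¹ * ((1 + x ^ 2 * z / q) * (1 + x ^ 2 / z / q)) =
      -(q⁻¹ - q) * (x ^ 2 - (x⁻¹) ^ 2) := by
    field_simp
    ring
  linear_combination w ^ 2 * key - w * (x ^ 2 - (x⁻¹) ^ 2) * hw'

/-- The positive discrete series `π⁺_k`. -/
def posData (q : ℝ) (hq : q ∈ Set.Ioo (0 : ℝ) 1) (k : ℝ) (hk : 0 < k) : WeightData q ℕ where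
  up n := n + 1
  dn n := n - 1
  κ n := q ^ (k + n)
  c n := (q⁻¹ - q)⁻¹ * (q ^ (-1 / 2 - k - n) *
    √((1 - q ^ (2 * (n : ℝ) + 2)) * (1 - q ^ (4 * k + 2 * n))))
  d n := -((q⁻¹ - q)⁻¹ * (q ^ (1 / 2 - k - n) *
    √((1 - q ^ (2 * (n : ℝ))) * (1 - q ^ (4 * k + 2 * n - 2)))))
  κ_ne n := (Real.rpow_pos_of_pos hq.1 _).ne'
  c_up n := by
    refine Or.inr ⟨rfl, ?_, ?_⟩
    · rw [Nat.cast_succ, ← add_assoc, Real.rpow_add_one hq.1.ne', mul_comm]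
    · push_cast
      ring_nf
  d_dn n := by
    rcases n with _ | n
    · left; simp
    · refine Or.inr ⟨rfl, ?_, ?_⟩
      · rw [Nat.cast_succ, ← add_assoc, Real.rpow_add_one hq.1.ne', Nat.add_sub_cancel,
          mul_comm (q ^ _), inv_mul_cancel_left₀ hq.1.ne']
      · rw [Nat.add_sub_cancel]; push_cast
        ring_nf
  sq_sub n := discrete_c_sq hq hk n

/-- The negative discrete series `π⁻_k`. -/
def negData (q : ℝ) (hq : q ∈ Set.Ioo (0 : ℝ) 1) (k : ℝ) (hk : 0 < k) : WeightData q ℕ where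
  up n := n - 1
  dn n := n + 1
  κ n := q ^ (-(k + n))
  c n := -((q⁻¹ - q)⁻¹ * (q ^ (1 / 2 - k - n) *
    √((1 - q ^ (2 * (n : ℝ))) * (1 - q ^ (4 * k + 2 * n - 2)))))
  d n := (q⁻¹ - q)⁻¹ * (q ^ (-1 / 2 - k - n) *
    √((1 - q ^ (2 * (n : ℝ) + 2)) * (1 - q ^ (4 * k + 2 * n))))
  κ_ne n := (Real.rpow_pos_of_pos hq.1 _).ne'
  d_dn n := by
    refine Or.inr ⟨rfl, ?_, ?_⟩
    · rw [Nat.cast_succ, Real.rpow_neg hq.1.le, Real.rpow_neg hq.1.le, ← add_assoc,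
        Real.rpow_add_one hq.1.ne', mul_inv, mul_comm]
    · push_cast
      ring_nf
  c_up n := by
    rcases n with _ | n
    · left; simp
    · refine Or.inr ⟨rfl, ?_, ?_⟩
      · rw [Nat.cast_succ, Real.rpow_neg hq.1.le, Real.rpow_neg hq.1.le, ← add_assoc,
          Real.rpow_add_one hq.1.ne', Nat.add_sub_cancel, mul_inv, mul_comm (_)⁻¹ q⁻¹,
          mul_inv_cancel_left₀ hq.1.ne']
      · rw [Nat.add_sub_cancel]; push_cast
        ring_nf
  sq_sub n := by
    have := discrete_c_sq hq hk n
    rw [Real.rpow_neg hq.1.le, inv_inv]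
    linarith

/-- The strange series `π^S_{σ,ε}`, for arbitrary real labels. -/
def strangeData (q : ℝ) (hq : q ∈ Set.Ioo (0 : ℝ) 1) (σ ε : ℝ) : WeightData q ℤ where
  up n := n + 1
  dn n := n - 1
  κ n := q ^ (n + ε)
  c n := (q⁻¹ - q)⁻¹ * (q ^ (-1 / 2 - n - ε) *
    √((1 + q ^ (2 * n + 2 * ε + 2 * σ + 1)) * (1 + q ^ (2 * n + 2 * ε - 2 * σ + 1))))
  d n := -((q⁻¹ - q)⁻¹ * (q ^ (1 / 2 - n - ε) *
    √((1 + q ^ (2 * n + 2 * ε + 2 * σ - 1)) * (1 + q ^ (2 * n + 2 * ε - 2 * σ - 1)))))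
  κ_ne n := (Real.rpow_pos_of_pos hq.1 _).ne'
  c_up n := by
    refine Or.inr ⟨by simp, ?_, ?_⟩
    · push_cast
      rw [add_right_comm, Real.rpow_add_one hq.1.ne', mul_comm]
    · push_cast
      ring_nf
  d_dn n := by
    refine Or.inr ⟨by simp, ?_, ?_⟩
    · push_cast
      rw [sub_add_eq_add_sub, Real.rpow_sub_one hq.1.ne', div_eq_inv_mul]
    · push_cast
      ring_nf
  sq_sub n := strange_c_sq hq σ ε n

/-! ### Tensor products and direct sums -/

/-- The inclusion of the algebraic tensor product of the domains into the Hilbert space tensor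
product `ℓ²(ι) ⊗ ℓ²(κ) = ℓ²(ι × κ)`, under which `e_i ⊗ e_j` is the basis vector `e_(i,j)`. -/
def embedTensor (ι κ : Type*) : ((ι →₀ ℂ) ⊗[ℂ] (κ →₀ ℂ)) →ₗ[ℂ] ℓ²(ι × κ, ℂ) :=
  embed (ι × κ) ∘ₗ (finsuppTensorFinsupp' ℂ ι κ).toLinearMap

theorem embedTensor_single {ι κ : Type*} (i : ι) (j : κ) (a b : ℂ) :
    embedTensor ι κ (Finsupp.single i a ⊗ₜ[ℂ] Finsupp.single j b) =
      embed (ι × κ) (Finsupp.single (i, j) (a * b)) := by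
  simp [embedTensor]

theorem inner_embedTensor {ι κ : Type*} (v v' : ι →₀ ℂ) (w w' : κ →₀ ℂ) :
    inner ℂ (embedTensor ι κ (v ⊗ₜ[ℂ] w)) (embedTensor ι κ (v' ⊗ₜ[ℂ] w')) =
      inner ℂ (embed ι v) (embed ι v') * inner ℂ (embed κ w) (embed κ w') := by
  classical
  induction v using Finsupp.induction_linear with
  | zero => simp
  | add f g hf hg => simp only [TensorProduct.add_tmul, map_add, inner_add_left, hf, hg, add_mul]
  | single i a =>
  induction v' using Finsupp.induction_linear with
  | zero => simp
  | add f g hf hg => simp only [TensorProduct.add_tmul, map_add, inner_add_right, hf, hg, add_mul]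
  | single i' a' =>
  induction w using Finsupp.induction_linear with
  | zero => simp
  | add f g hf hg => simp only [TensorProduct.tmul_add, map_add, inner_add_left, hf, hg, mul_add]
  | single j b =>
  induction w' using Finsupp.induction_linear with
  | zero => simp
  | add f g hf hg => simp only [TensorProduct.tmul_add, map_add, inner_add_right, hf, hg, mul_add]
  | single j' b' =>
  simp only [embedTensor_single, inner_embed_single, Prod.mk.injEq]
  by_cases h1 : i = i' <;> by_cases h2 : j = j' <;> simp [h1, h2]
  ring

theorem IsAdj.tensor {ι κ : Type*} {s t : ℂ} {A A' : Module.End ℂ (ι →₀ ℂ)}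
    {B B' : Module.End ℂ (κ →₀ ℂ)} (hA : IsAdj (embed ι) s A A') (hB : IsAdj (embed κ) t B B') :
    IsAdj (embedTensor ι κ) (s * t) (TensorProduct.map A B) (TensorProduct.map A' B') := by
  intro x y
  induction x using TensorProduct.induction_on with
  | zero => simp
  | add f g hf hg => simp only [map_add, inner_add_left, hf, hg, mul_add]
  | tmul v w =>
  induction y using TensorProduct.induction_on with
  | zero => simp
  | add f g hf hg => simp only [map_add, inner_add_right, hf, hg, mul_add]
  | tmul v' w' =>
  simp only [TensorProduct.map_tmul, inner_embedTensor, hA v v', hB w w']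
  ring

theorem IsAdj.add {V H : Type*} [AddCommMonoid V] [Module ℂ V] [NormedAddCommGroup H]
    [InnerProductSpace ℂ H] {j : V →ₗ[ℂ] H} {s : ℂ} {A A' B B' : Module.End ℂ V}
    (hA : IsAdj j s A A') (hB : IsAdj j s B B') : IsAdj j s (A + B) (A' + B') := by
  intro v w
  simp only [LinearMap.add_apply, map_add, inner_add_left, inner_add_right, hA v w, hB v w,
    mul_add]

/-- The representation `π₁ ⊗ π₂` of `U_q ⊗ U_q` on `V ⊗ W`. -/
def tensorRep {q : ℝ} {V W : Type*} [AddCommMonoid V] [Module ℂ V] [AddCommMonoid W] [Module ℂ W]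
    (π₁ : Uq q →ₐ[ℂ] Module.End ℂ V) (π₂ : Uq q →ₐ[ℂ] Module.End ℂ W) :
    Uq q ⊗[ℂ] Uq q →ₐ[ℂ] Module.End ℂ (V ⊗[ℂ] W) :=
  (Module.endTensorEndAlgHom (R := ℂ) (S := ℂ) (A := ℂ) (M := V) (N := W)).comp
    (Algebra.TensorProduct.map π₁ π₂)

/-- The direct sum of two representations of an algebra. -/
def sumRep {A V W : Type*} [Semiring A] [Algebra ℂ A] [AddCommMonoid V] [Module ℂ V]
    [AddCommMonoid W] [Module ℂ W] (ρ₁ : A →ₐ[ℂ] Module.End ℂ V) (ρ₂ : A →ₐ[ℂ] Module.End ℂ W) :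
    A →ₐ[ℂ] Module.End ℂ (V × W) :=
  (LinearMap.prodMapAlgHom ℂ V W).comp (ρ₁.prod ρ₂)

theorem tensorRep_tmul {q : ℝ} {V W : Type*} [AddCommMonoid V] [Module ℂ V] [AddCommMonoid W]
    [Module ℂ W] (π₁ : Uq q →ₐ[ℂ] Module.End ℂ V) (π₂ : Uq q →ₐ[ℂ] Module.End ℂ W) (X Y : Uq q) :
    tensorRep π₁ π₂ (X ⊗ₜ Y) = TensorProduct.map (π₁ X) (π₂ Y) := rfl

theorem comul_gen {q : ℝ} (hq : q ≠ 0) :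
    comul q hq (gen q .K) = gen q .K ⊗ₜ[ℂ] gen q .K ∧
    comul q hq (gen q .Kinv) = gen q .Kinv ⊗ₜ[ℂ] gen q .Kinv ∧
    comul q hq (gen q .E) = gen q .K ⊗ₜ[ℂ] gen q .E + gen q .E ⊗ₜ[ℂ] gen q .Kinv ∧
    comul q hq (gen q .F) = gen q .K ⊗ₜ[ℂ] gen q .F + gen q .F ⊗ₜ[ℂ] gen q .Kinv :=
  lift_gen ..

section
variable {q : ℝ} {ι κ : Type*} (D₁ : WeightData q ι) (D₂ : WeightData q κ)

theorem tensor_adj_K (hq : q ≠ 0) :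
    IsAdj (embedTensor ι κ) 1 (tensorRep D₁.rep D₂.rep (comul q hq (gen q .K)))
      (tensorRep D₁.rep D₂.rep (comul q hq (gen q .K))) := by
  rw [(comul_gen hq).1, tensorRep_tmul]
  simpa using D₁.adj_K.tensor D₂.adj_K

theorem tensor_adj_E (hq : q ≠ 0) :
    IsAdj (embedTensor ι κ) (-1) (tensorRep D₁.rep D₂.rep (comul q hq (gen q .E)))
      (tensorRep D₁.rep D₂.rep (comul q hq (gen q .F))) := by
  rw [(comul_gen hq).2.2.1, (comul_gen hq).2.2.2, map_add, map_add, tensorRep_tmul,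
    tensorRep_tmul, tensorRep_tmul, tensorRep_tmul]
  have h1 := D₁.adj_K.tensor D₂.adj_E
  have h2 := D₁.adj_E.tensor D₂.adj_Kinv
  rw [one_mul] at h1
  rw [mul_one] at h2
  exact h1.add h2

end

/-- The Hilbert space `(ℓ²(ℕ) ⊗ ℓ²(ℤ)) ⊕ (ℓ²(ℤ) ⊗ ℓ²(ℕ))`. -/
abbrev HilbT : Type := WithLp 2 (ℓ²(ℕ × ℤ, ℂ) × ℓ²(ℤ × ℕ, ℂ))

/-- The algebraic span of the vectors `e_i ⊗ e_j` in the two summands. -/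
abbrev CoreT : Type := ((ℕ →₀ ℂ) ⊗[ℂ] (ℤ →₀ ℂ)) × ((ℤ →₀ ℂ) ⊗[ℂ] (ℕ →₀ ℂ))

/-- The inclusion of this span into the Hilbert space. -/
def embedT : CoreT →ₗ[ℂ] HilbT :=
  (WithLp.linearEquiv 2 ℂ (ℓ²(ℕ × ℤ, ℂ) × ℓ²(ℤ × ℕ, ℂ))).symm.toLinearMap ∘ₗ
    (embedTensor ℕ ℤ).prodMap (embedTensor ℤ ℕ)

theorem embedTensor_injective (ι κ : Type*) : Function.Injective (embedTensor ι κ) :=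
  (embed_injective _).comp (finsuppTensorFinsupp' ℂ ι κ).injective

theorem embedTensor_denseRange (ι κ : Type*) : DenseRange (embedTensor ι κ) := by
  have := embed_denseRange (ι × κ)
  have h : Set.range (embedTensor ι κ) = Set.range (embed (ι × κ)) :=
    (finsuppTensorFinsupp' ℂ ι κ).surjective.range_comp (embed (ι × κ))
  rwa [DenseRange, h]

theorem embedT_injective : Function.Injective embedT :=
  (WithLp.linearEquiv 2 ℂ (ℓ²(ℕ × ℤ, ℂ) × ℓ²(ℤ × ℕ, ℂ))).symm.injective.comp
    ((embedTensor_injective ℕ ℤ).prodMap (embedTensor_injective ℤ ℕ))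

theorem embedT_denseRange : DenseRange embedT := by
  have h := (embedTensor_denseRange ℕ ℤ).prodMap (embedTensor_denseRange ℤ ℕ)
  exact (WithLp.homeomorphProd 2 ℓ²(ℕ × ℤ, ℂ) ℓ²(ℤ × ℕ, ℂ)).symm.surjective.denseRange.comp h
    (WithLp.homeomorphProd 2 ℓ²(ℕ × ℤ, ℂ) ℓ²(ℤ × ℕ, ℂ)).symm.continuous

theorem inner_embedT (x y : CoreT) : inner ℂ (embedT x) (embedT y) =
    inner ℂ (embedTensor ℕ ℤ x.1) (embedTensor ℕ ℤ y.1) +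
      inner ℂ (embedTensor ℤ ℕ x.2) (embedTensor ℤ ℕ y.2) := rfl

/-- The action of `U_q` on the domain of `T'`:
`((π⁻_{k₁} ⊗ π^S_{k₂-1/2, ε+k₂}) ⊕ (π^S_{k₁-1/2, -ε-k₁} ⊗ π⁺_{k₂})) Δ`. -/
def actionT (q : ℝ) (hq : q ∈ Set.Ioo (0 : ℝ) 1) (k₁ k₂ : ℝ) (h₁ : 0 < k₁) (h₂ : 0 < k₂)
    (ε : ℝ) : Uq q →ₐ[ℂ] Module.End ℂ CoreT :=
  (sumRep
    (tensorRep (negData q hq k₁ h₁).rep (strangeData q hq (k₂ - 1 / 2) (ε + k₂)).rep)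
    (tensorRep (strangeData q hq (k₁ - 1 / 2) (-ε - k₁)).rep (posData q hq k₂ h₂).rep)).comp
  (comul q hq.1.ne')

theorem actionT_apply (q : ℝ) (hq : q ∈ Set.Ioo (0 : ℝ) 1) (k₁ k₂ : ℝ) (h₁ : 0 < k₁)
    (h₂ : 0 < k₂) (ε : ℝ) (X : Uq q) (v : CoreT) :
    actionT q hq k₁ k₂ h₁ h₂ ε X v =
      (tensorRep (negData q hq k₁ h₁).rep (strangeData q hq (k₂ - 1 / 2) (ε + k₂)).rep
        (comul q hq.1.ne' X) v.1,
      tensorRep (strangeData q hq (k₁ - 1 / 2) (-ε - k₁)).rep (posData q hq k₂ h₂).rep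
        (comul q hq.1.ne' X) v.2) := rfl

/-- The representation `T'_{k₁,k₂,ε}`. -/
def repT (q : ℝ) (hq : q ∈ Set.Ioo (0 : ℝ) 1) (k₁ k₂ : ℝ) (h₁ : 0 < k₁) (h₂ : 0 < k₂)
    (ε : ℝ) : StarRep q HilbT :=
  StarRep.ofCore (actionT q hq k₁ k₂ h₁ h₂ ε) embedT embedT_injective embedT_denseRange
    (by
      intro v w
      rw [inner_embedT, inner_embedT, actionT_apply, actionT_apply,
        tensor_adj_K _ _ hq.1.ne' v.1 w.1, tensor_adj_K _ _ hq.1.ne' v.2 w.2, one_mul, one_mul])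
    (by
      intro v w
      rw [inner_embedT, inner_embedT, actionT_apply, actionT_apply,
        tensor_adj_E _ _ hq.1.ne' v.1 w.1, tensor_adj_E _ _ hq.1.ne' v.2 w.2]
      ring)

section
variable {q : ℝ} {ι : Type*} {H : ι → Type*} [∀ i, NormedAddCommGroup (H i)]
  [∀ i, InnerProductSpace ℂ (H i)] (π : ∀ i, StarRep q (H i))

/-- The domain of the direct sum of the `π_i`: the vectors `φ = (φ_i)` of the Hilbert sum such
that `φ_i` is in the domain of `π_i` for all `i` and `∑ ‖π_i(X) φ_i‖² < ∞` for all `X ∈ U_q`. -/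
def sumDomain : Submodule ℂ (lp H 2) where
  carrier := {φ | ∃ h : ∀ i, φ i ∈ (π i).domain,
    ∀ X : Uq q, Memℓp (fun i => ((π i).action X ⟨φ i, h i⟩ : H i)) 2}
  add_mem' := by
    rintro φ ψ ⟨h, hφ⟩ ⟨h', hψ⟩
    refine ⟨fun i => add_mem (h i) (h' i), fun X => ?_⟩
    have e : (fun i => ((π i).action X ⟨φ i + ψ i, add_mem (h i) (h' i)⟩ : H i)) =
        (fun i => ((π i).action X ⟨φ i, h i⟩ : H i)) +
          fun i => ((π i).action X ⟨ψ i, h' i⟩ : H i) := by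
      funext i
      rw [Pi.add_apply, ← Submodule.coe_add, ← map_add]
      rfl
    exact e ▸ (hφ X).add (hψ X)
  zero_mem' := by
    refine ⟨fun i => zero_mem _, fun X => ?_⟩
    have e : (fun i => ((π i).action X ⟨0, zero_mem _⟩ : H i)) = 0 := by
      funext i
      have : (⟨0, zero_mem _⟩ : (π i).domain) = 0 := rfl
      rw [this, map_zero]
      rfl
    exact e ▸ zero_memℓp
  smul_mem' := by
    rintro c φ ⟨h, hφ⟩
    refine ⟨fun i => Submodule.smul_mem _ c (h i), fun X => ?_⟩
    have e : (fun i => ((π i).action X ⟨c • φ i, Submodule.smul_mem _ c (h i)⟩ : H i)) =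
        c • fun i => ((π i).action X ⟨φ i, h i⟩ : H i) := by
      funext i
      rw [Pi.smul_apply, ← Submodule.coe_smul, ← map_smul]
      rfl
    exact e ▸ (hφ X).const_smul c

theorem single_mem_sumDomain [DecidableEq ι] (i : ι) (v : H i) (hv : v ∈ (π i).domain) :
    lp.single 2 i v ∈ sumDomain π := by
  have h : ∀ j, lp.single 2 i v j ∈ (π j).domain := by
    intro j
    by_cases hj : j = i
    · subst hj; rw [lp.single_apply_self]; exact hv
    · rw [lp.single_apply_ne _ _ _ hj]; exact zero_mem _
  refine ⟨h, fun X => (memℓp_zero ((Set.finite_singleton i).subset fun j hj => ?_)).of_exponent_ge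
    zero_le⟩
  by_contra hji
  refine hj ?_
  have : (⟨lp.single 2 i v j, h j⟩ : (π j).domain) = 0 :=
    Subtype.ext (lp.single_apply_ne 2 i v hji)
  change (((π j).action X ⟨lp.single 2 i v j, h j⟩ : (π j).domain) : H j) = 0
  rw [this, map_zero]
  rfl

theorem sumDomain_dense : Dense (sumDomain π : Set (lp H 2)) := by
  classical
  have hc : ∀ (i : ι) (v : H i), lp.single 2 i v ∈ (sumDomain π).topologicalClosure := by
    intro i v
    exact map_mem_closure (f := fun v => lp.single 2 i v)
      (lp.isometry_single i).continuous ((π i).dense v) (fun w hw => single_mem_sumDomain π i w hw)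
  intro φ
  have hmem : φ ∈ (sumDomain π).topologicalClosure :=
    (sumDomain π).isClosed_topologicalClosure.mem_of_tendsto (lp.hasSum_single (by norm_num) φ)
      (Filter.Eventually.of_forall fun s => sum_mem fun i _ => hc i _)
  exact hmem

/-- The componentwise action of `X ∈ U_q` on this domain. -/
def sumActionFun (X : Uq q) (φ : sumDomain π) : sumDomain π :=
  ⟨⟨fun i => ((π i).action X ⟨φ.1 i, φ.2.1 i⟩ : H i), φ.2.2 X⟩,
    fun i => ((π i).action X ⟨φ.1 i, φ.2.1 i⟩).2, fun Y => by
      have h := φ.2.2 (Y * X)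
      have e : (fun i => ((π i).action (Y * X) ⟨φ.1 i, φ.2.1 i⟩ : H i)) =
          fun i => ((π i).action Y ((π i).action X ⟨φ.1 i, φ.2.1 i⟩) : H i) := by
        funext i
        rw [map_mul, Module.End.mul_apply]
      rw [e] at h
      exact h⟩

theorem sumActionFun_apply (X : Uq q) (φ : sumDomain π) (i : ι) :
    (sumActionFun π X φ).1 i = ((π i).action X ⟨φ.1 i, φ.2.1 i⟩ : H i) := rfl

theorem sumDomain_ext {φ ψ : sumDomain π} (h : ∀ i, φ.1 i = ψ.1 i) : φ = ψ :=
  Subtype.ext (lp.ext (funext h))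

/-- The componentwise action of `U_q` on this domain. -/
def sumAction : Uq q →ₐ[ℂ] Module.End ℂ (sumDomain π) :=
  AlgHom.ofLinearMap
    { toFun := fun X =>
        { toFun := sumActionFun π X
          map_add' := fun φ ψ => sumDomain_ext π fun i => by
            have h : ((π i).action X (⟨φ.1 i, φ.2.1 i⟩ + ⟨ψ.1 i, ψ.2.1 i⟩) : H i) =
                ((π i).action X ⟨φ.1 i, φ.2.1 i⟩ : H i) +
                  ((π i).action X ⟨ψ.1 i, ψ.2.1 i⟩ : H i) := by
              rw [map_add, Submodule.coe_add]
            exact h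
          map_smul' := fun c φ => sumDomain_ext π fun i => by
            have h : ((π i).action X (c • ⟨φ.1 i, φ.2.1 i⟩) : H i) =
                c • ((π i).action X ⟨φ.1 i, φ.2.1 i⟩ : H i) := by
              rw [map_smul, Submodule.coe_smul]
            exact h }
      map_add' := fun X Y => LinearMap.ext fun φ => sumDomain_ext π fun i => by
        change (sumActionFun π (X + Y) φ).1 i =
          (sumActionFun π X φ).1 i + (sumActionFun π Y φ).1 i
        rw [sumActionFun_apply, sumActionFun_apply, sumActionFun_apply, map_add]
        rfl
      map_smul' := fun c X => LinearMap.ext fun φ => sumDomain_ext π fun i => by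
        change (sumActionFun π (c • X) φ).1 i = c • (sumActionFun π X φ).1 i
        rw [sumActionFun_apply, sumActionFun_apply, map_smul]
        rfl }
    (LinearMap.ext fun φ => sumDomain_ext π fun i => by
      change (sumActionFun π 1 φ).1 i = φ.1 i
      rw [sumActionFun_apply, map_one]
      rfl)
    (fun X Y => LinearMap.ext fun φ => sumDomain_ext π fun i => by
      change (sumActionFun π (X * Y) φ).1 i = (sumActionFun π X (sumActionFun π Y φ)).1 i
      rw [sumActionFun_apply, sumActionFun_apply, map_mul, Module.End.mul_apply]
      rfl)

/-- The Hilbert space direct sum of a family of `*`-representations. -/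
def StarRep.directSum : StarRep q (lp H 2) where
  domain := sumDomain π
  dense := sumDomain_dense π
  action := sumAction π
  star_K := fun φ ψ => by
    rw [lp.inner_eq_tsum, lp.inner_eq_tsum]
    exact tsum_congr fun i => (π i).star_K ⟨φ.1 i, φ.2.1 i⟩ ⟨ψ.1 i, ψ.2.1 i⟩
  star_E := fun φ ψ => by
    rw [lp.inner_eq_tsum, lp.inner_eq_tsum, ← tsum_neg]
    exact tsum_congr fun i => (π i).star_E ⟨φ.1 i, φ.2.1 i⟩ ⟨ψ.1 i, ψ.2.1 i⟩

end

/-! ### Big `q`-Jacobi polynomials -/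

/-- `(a; q)_n`. -/
def qPoch (a q : ℝ) (n : ℕ) : ℝ := ∏ i ∈ Finset.range n, (1 - a * q ^ i)

/-- `(a; q)_∞`. -/
def qPochInf (a q : ℝ) : ℝ := ∏' i : ℕ, (1 - a * q ^ i)

/-- The normalized Jacobi theta function `θ(x; q) = (x; q)_∞ (q/x; q)_∞`. -/
def qTheta (x q : ℝ) : ℝ := qPochInf x q * qPochInf (q / x) q

/-- The basic hypergeometric series `₃φ₂(a, b, c; d, e; q, z)`. -/
def phi32 (a b c d e q z : ℝ) : ℝ :=
  ∑' k : ℕ, qPoch a q k * qPoch b q k * qPoch c q k /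
    (qPoch q q k * qPoch d q k * qPoch e q k) * z ^ k

/-- The big `q`-Jacobi polynomial `P_m(x; a, b, c; q)`. -/
def bigQJacobi (m : ℕ) (x a b c q : ℝ) : ℝ :=
  phi32 (q ^ m)⁻¹ (a * b * q ^ (m + 1)) x (a * q) (c * q) q q

/-- The weight `u(x; a, b, c; q)`. -/
def weightU (x a b c q : ℝ) : ℝ :=
  qPochInf (x / a) q * qPochInf (x / c) q / (qPochInf x q * qPochInf (b * x / c) q)

/-- The quotient `(1 - a b q^{2m+1}) (abq; q)_m / (1 - abq)`, with the common factor `1 - abq`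
cancelled so that it also makes sense for `abq = 1`. -/
def weightFactor (m : ℕ) (a b q : ℝ) : ℝ :=
  match m with
  | 0 => 1
  | j + 1 => (1 - a * b * q ^ (2 * (j + 1) + 1)) * qPoch (a * b * q ^ 2) q j

/-- The dual weight `v(m; a, b, c; q)`. -/
def weightV (m : ℕ) (a b c q : ℝ) : ℝ :=
  weightFactor m a b q / (a * q) *
    (qPochInf (a * q) q * qPochInf (b * q) q * qPochInf (c * q) q * qPochInf (a * b * q / c) q /
      (qPochInf q q * qPochInf (a * b * q ^ 2) q * qTheta (c / a) q)) *
    (qPoch (a * q) q m * qPoch (c * q) q m /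
      (qPoch q q m * qPoch (b * q) q m * qPoch (a * b * q / c) q m)) *
    ((-(a * c * q ^ 2)) ^ m)⁻¹ * (q ^ (m.choose 2))⁻¹

/-- The normalized big `q`-Jacobi polynomial
`r_x(m) = √(|x| u(x) v(m)) P_m(x)`. -/
def normBigQJacobi (x : ℝ) (m : ℕ) (a b c q : ℝ) : ℝ :=
  √(|x| * weightU x a b c q * weightV m a b c q) * bigQJacobi m x a b c q

/-- `(Θ f⁻_{p,n})(m)`. -/
def thetaNeg (q k₁ k₂ ε : ℝ) (p : ℤ) (n m : ℕ) : ℝ :=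
  normBigQJacobi (q ^ (2 * n + 4 * k₁)) m
    (q ^ (4 * k₁ - 2)) (q ^ (4 * k₂ - 2)) (-q ^ (4 * k₁ - 2 * p - 2 * ε - 2)) (q ^ 2)

/-- `(Θ f⁺_{p,n})(m)`. -/
def thetaPos (q k₁ k₂ ε : ℝ) (p : ℤ) (n m : ℕ) : ℝ :=
  (-1) ^ n * normBigQJacobi (-q ^ (2 * n + 4 * k₁ - 2 * p - 2 * ε)) m
    (q ^ (4 * k₁ - 2)) (q ^ (4 * k₂ - 2)) (-q ^ (4 * k₁ - 2 * p - 2 * ε - 2)) (q ^ 2)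

/-- The vector `e_i ⊗ e_j` of the summand `ℓ²(ℕ) ⊗ ℓ²(ℤ)`. -/
def basisNeg (i : ℕ) (j : ℤ) : HilbT :=
  embedT (Finsupp.single i 1 ⊗ₜ[ℂ] Finsupp.single j 1, 0)

/-- The vector `e_j ⊗ e_i` of the summand `ℓ²(ℤ) ⊗ ℓ²(ℕ)`. -/
def basisPos (j : ℤ) (i : ℕ) : HilbT :=
  embedT (0, Finsupp.single j 1 ⊗ₜ[ℂ] Finsupp.single i 1)

end SU11

end

noncomputable section

namespace SU11

/-! ### `q`-shifted factorials -/

section qPochhammer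

variable {q : ℝ}

/-! The operator `K` has the same eigenvalue on all vectors f^∓_{p,n} with the same p, and different
p give different eigenvalues. So for each p these vectors form an orthonormal basis of one
eigenspace, and on the other side the vectors e_p^{(m)}, m ∈ ℕ, form the matching one. The
intertwiner is a family, indexed by p, of infinite matrices Θ. Each of them must be unitary, and
consecutive ones must be linked by the actions of `E` and `F`.

Unitarity. In base q², with a = q^{4k₁-2}, b = q^{4k₂-2} and c = -q^{4k₁-2p-2ε-2}, the labels (-,n)
and (+,n) are the points a q^{2n+2} and c q^{2n+2} supporting the big q-Jacobi measure. For a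
general base q, multiplying the weight by (x;q)_k (bx/c;q)_l only shifts the parameters of its
denominator. Every integral needed is thus a value of one q-beta integral, which obeys a first-order
recurrence in each parameter (`jMass_step`) and is evaluated in `jMass_eq`. Expanding P_m in (x;q)_k
and testing it against (bx/c;q)_l gives a terminating sum of Chu–Vandermonde type
(`integral_jPoly_mul`); it vanishes for l < m, and for l = m it yields the norm, so that v(m) is the
reciprocal of the squared norm (`weightV_mul_integral`). Hence the rows of Θ are orthonormal. They
are complete because a summable function on a bounded countable set is determined by its polynomial
moments (`eq_zero_of_moments`). A complete orthonormal family of rows is a Hilbert basis, whose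
coordinate map is the unitary (`exists_unitary_of_fibres`).

Intertwining. Replacing p by p + 1 divides c by q². The relation for `E` is a contiguous relation
expressing P_m at level c through level c/q² (`bigQJacobi_up`), and the relation for `F` is its
counterpart in the other direction (`bigQJacobi_down`). After normalization, the ratios of the
weights u and v turn the coefficients into square roots (`normBigQJacobi_up`,
`normBigQJacobi_down`), and these are exactly the matrix coefficients of the discrete and strange
series. Points that leave the support are always multiplied by zero. The generators suffice for all
of U_q (`coreMap_action`), and U v lies in the domain of the direct sum because the vectors
π_m(X)(Uv)_m are the components of the single vector U T'(X) v. -/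

theorem qPoch_zero (y q : ℝ) : qPoch y q 0 = 1 := by simp [qPoch]

theorem qPoch_succ (y q : ℝ) (n : ℕ) : qPoch y q (n + 1) = qPoch y q n * (1 - y * q ^ n) :=
  Finset.prod_range_succ _ _

theorem qPoch_succ' (y q : ℝ) (n : ℕ) : qPoch y q (n + 1) = (1 - y) * qPoch (y * q) q n := by
  simp only [qPoch, Finset.prod_range_succ', pow_zero, mul_one]
  rw [mul_comm]
  congr 1
  exact Finset.prod_congr rfl fun i _ => by ring

theorem qPoch_add (y q : ℝ) (m n : ℕ) :
    qPoch y q (m + n) = qPoch y q m * qPoch (y * q ^ m) q n := by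
  simp only [qPoch, Finset.prod_range_add]
  congr 1
  exact Finset.prod_congr rfl fun i _ => by ring

theorem qPoch_pos (hq : q ∈ Set.Ioo (0 : ℝ) 1) {y : ℝ} (hy : y < 1) (n : ℕ) : 0 < qPoch y q n := by
  refine Finset.prod_pos fun i _ => ?_
  have h1 : 0 < q ^ i := pow_pos hq.1 i
  have h2 : q ^ i ≤ 1 := pow_le_one₀ hq.1.le hq.2.le
  nlinarith

theorem qPoch_ne_zero (hq : q ∈ Set.Ioo (0 : ℝ) 1) {y : ℝ} (hy : y < 1) (n : ℕ) :
    qPoch y q n ≠ 0 := (qPoch_pos hq hy n).ne'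

theorem summable_qPochInf (hq : q ∈ Set.Ioo (0 : ℝ) 1) (y : ℝ) :
    Summable fun i : ℕ => ‖-(y * q ^ i)‖ := by
  have := (summable_geometric_of_lt_one hq.1.le hq.2).mul_left |y|
  refine this.congr fun i => ?_
  rw [norm_neg, Real.norm_eq_abs, abs_mul, abs_of_pos (pow_pos hq.1 i)]

theorem multipliable_qPochInf (hq : q ∈ Set.Ioo (0 : ℝ) 1) (y : ℝ) :
    Multipliable fun i : ℕ => 1 - y * q ^ i := by
  simpa [sub_eq_add_neg] using multipliable_one_add_of_summable (summable_qPochInf hq y)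

theorem tendsto_qPoch (hq : q ∈ Set.Ioo (0 : ℝ) 1) (y : ℝ) :
    Filter.Tendsto (qPoch y q) Filter.atTop (nhds (qPochInf y q)) :=
  (multipliable_qPochInf hq y).hasProd.tendsto_prod_nat

theorem qPochInf_split (hq : q ∈ Set.Ioo (0 : ℝ) 1) (y : ℝ) (n : ℕ) :
    qPochInf y q = qPoch y q n * qPochInf (y * q ^ n) q := by
  have h1 := (tendsto_qPoch hq y).comp (Filter.tendsto_add_atTop_nat n)
  have h2 := (tendsto_qPoch hq (y * q ^ n)).const_mul (qPoch y q n)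
  refine tendsto_nhds_unique h1 (h2.congr fun m => ?_)
  rw [Function.comp_apply, add_comm, qPoch_add]

theorem qPochInf_step (hq : q ∈ Set.Ioo (0 : ℝ) 1) (y : ℝ) :
    qPochInf y q = (1 - y) * qPochInf (y * q) q := by
  have := qPochInf_split hq y 1
  rwa [qPoch_succ, qPoch_zero, pow_zero, one_mul, mul_one, pow_one] at this

theorem qPochInf_nonneg (hq : q ∈ Set.Ioo (0 : ℝ) 1) {y : ℝ} (hy : y ≤ 1) : 0 ≤ qPochInf y q := by
  refine ge_of_tendsto' (tendsto_qPoch hq y) fun n => Finset.prod_nonneg fun i _ => ?_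
  have h1 : 0 < q ^ i := pow_pos hq.1 i
  have h2 : q ^ i ≤ 1 := pow_le_one₀ hq.1.le hq.2.le
  nlinarith

theorem qPochInf_pos (hq : q ∈ Set.Ioo (0 : ℝ) 1) {y : ℝ} (hy : y < 1) : 0 < qPochInf y q := by
  refine lt_of_le_of_ne (qPochInf_nonneg hq hy.le) (Ne.symm ?_)
  have := tprod_one_add_ne_zero_of_summable (f := fun i : ℕ => -(y * q ^ i)) (fun i => by
    have h1 : 0 < q ^ i := pow_pos hq.1 i
    have h2 : q ^ i ≤ 1 := pow_le_one₀ hq.1.le hq.2.le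
    nlinarith) (summable_qPochInf hq y)
  simpa [qPochInf, sub_eq_add_neg] using this

/-- Every factor of the product is nonnegative and decreasing in the argument as long as the
argument is at most 1. This is what bounds the weight by its values at extreme arguments. -/
theorem qPochInf_anti (hq : q ∈ Set.Ioo (0 : ℝ) 1) {x y : ℝ} (hxy : x ≤ y) (hy : y ≤ 1) :
    qPochInf y q ≤ qPochInf x q := by
  refine le_of_tendsto_of_tendsto' (tendsto_qPoch hq y) (tendsto_qPoch hq x) fun n =>
    Finset.prod_le_prod (fun i _ => ?_) fun i _ => ?_
  · have h1 : 0 < q ^ i := pow_pos hq.1 i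
    have h2 : q ^ i ≤ 1 := pow_le_one₀ hq.1.le hq.2.le
    nlinarith
  · have h1 : 0 < q ^ i := pow_pos hq.1 i
    nlinarith

theorem tendsto_qPochInf_mul_pow (hq : q ∈ Set.Ioo (0 : ℝ) 1) {y : ℝ} (hy : y < 1) :
    Filter.Tendsto (fun n => qPochInf (y * q ^ n) q) Filter.atTop (nhds 1) := by
  have h := (tendsto_qPoch hq y).inv₀ (qPochInf_pos hq hy).ne'
  have h2 := h.const_mul (qPochInf y q)
  rw [mul_inv_cancel₀ (qPochInf_pos hq hy).ne'] at h2
  refine h2.congr fun n => ?_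
  rw [qPochInf_split hq y n]
  have := qPoch_ne_zero hq hy n
  field_simp

theorem qPochInf_zero (q : ℝ) : qPochInf 0 q = 1 := by simp [qPochInf]

theorem qPoch_inv_pow_eq_zero (hq : q ∈ Set.Ioo (0 : ℝ) 1) {m k : ℕ} (h : m < k) :
    qPoch (q ^ m)⁻¹ q k = 0 := by
  refine Finset.prod_eq_zero (Finset.mem_range.2 h) ?_
  rw [inv_mul_cancel₀ (pow_pos hq.1 m).ne', sub_self]

theorem qPoch_inv_pow_self (hq : q ∈ Set.Ioo (0 : ℝ) 1) (m : ℕ) :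
    qPoch (q ^ m)⁻¹ q m = (-1) ^ m * qPoch q q m * (q ^ ((m + 1).choose 2))⁻¹ := by
  induction m with
  | zero => simp [qPoch_zero]
  | succ m ih =>
    have h0 := hq.1.ne'
    rw [qPoch_succ', qPoch_succ, show (q ^ (m + 1))⁻¹ * q = (q ^ m)⁻¹ by rw [pow_succ]; field_simp, ih,
      Nat.choose_succ_succ' (m + 1) 1, Nat.choose_one_right, pow_add, pow_succ (-1 : ℝ)]
    field_simp
    ring

/-- The terminating `q`-Chu–Vandermonde sum. -/
theorem qChuVandermonde (hq : q ∈ Set.Ioo (0 : ℝ) 1) (m : ℕ) :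
    ∀ M, m < M → ∀ B C : ℝ, C < 1 →
      ∑ k ∈ Finset.range M, qPoch (q ^ m)⁻¹ q k * qPoch B q k / (qPoch q q k * qPoch C q k) * q ^ k
        = (∏ i ∈ Finset.range m, (B - C * q ^ i)) / qPoch C q m := by
  have h0 := hq.1.ne'
  induction m with
  | zero =>
    intro M hM B C _
    obtain ⟨M, rfl⟩ : ∃ M', M = M' + 1 := ⟨M - 1, by omega⟩
    rw [Finset.sum_range_succ']
    simp [qPoch_succ', qPoch_zero]
  | succ m ih =>
    intro M hM B C hC
    obtain ⟨M, rfl⟩ : ∃ M', M = M' + 1 := ⟨M - 1, by omega⟩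
    have hCq : C * q < 1 := by
      have := hq.1; have := hq.2
      rcases le_or_gt C 0 with h | h <;> nlinarith
    -- Pascal-type rule: (q^{-m-1};q)_{k+1} - (q^{-m};q)_{k+1} = -q^{-m-1} (1 - q^{k+1})
    -- (q^{-m};q)_k, and the factor 1 - q^{k+1} cancels against (q;q)_{k+1}. The second sum has
    -- parameters Bq and Cq, so the induction has to run over all B and C.
    have key : ∑ k ∈ Finset.range (M + 1), qPoch (q ^ (m + 1))⁻¹ q k * qPoch B q k /
          (qPoch q q k * qPoch C q k) * q ^ k =
        ∑ k ∈ Finset.range (M + 1), qPoch (q ^ m)⁻¹ q k * qPoch B q k /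
          (qPoch q q k * qPoch C q k) * q ^ k -
        (q ^ m)⁻¹ * (1 - B) / (1 - C) * ∑ k ∈ Finset.range M, qPoch (q ^ m)⁻¹ q k *
          qPoch (B * q) q k / (qPoch q q k * qPoch (C * q) q k) * q ^ k := by
      rw [Finset.sum_range_succ', Finset.sum_range_succ', Finset.mul_sum, add_sub_right_comm,
        ← Finset.sum_sub_distrib]
      congr 1
      · refine Finset.sum_congr rfl fun k _ => ?_
        rw [qPoch_succ', qPoch_succ (q ^ m)⁻¹, qPoch_succ' B, qPoch_succ' C, qPoch_succ q,
          show (q ^ (m + 1))⁻¹ * q = (q ^ m)⁻¹ by rw [pow_succ]; field_simp]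
        have e1 := qPoch_ne_zero hq hq.2 k
        have e2 := qPoch_ne_zero hq hCq k
        have e3 : 1 - C ≠ 0 := by linarith
        have e4 : 1 - q * q ^ k ≠ 0 := by
          have := pow_le_one₀ hq.1.le hq.2.le (n := k)
          have := pow_pos hq.1 k
          nlinarith [hq.1, hq.2]
        field_simp
        ring
    have e3 : 1 - C ≠ 0 := by linarith
    have e1 := qPoch_ne_zero hq hC m
    have e2 := qPoch_ne_zero hq hCq m
    have e4 : 1 - C * q ^ m ≠ 0 := by
      have := qPoch_ne_zero hq hC (m + 1)
      rw [qPoch_succ] at this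
      exact right_ne_zero_of_mul this
    have e5 : qPoch C q m * (1 - C * q ^ m) = (1 - C) * qPoch (C * q) q m := by
      rw [← qPoch_succ, qPoch_succ']
    have e6 : (∏ i ∈ Finset.range m, (B * q - C * q * q ^ i)) =
        q ^ m * ∏ i ∈ Finset.range m, (B - C * q ^ i) := by
      rw [← Finset.card_range m, ← Finset.prod_const, Finset.card_range, ← Finset.prod_mul_distrib]
      exact Finset.prod_congr rfl fun i _ => by ring
    rw [key, ih (M + 1) (by omega) B C hC, ih M (by omega) _ _ hCq, e6, Finset.prod_range_succ,
      qPoch_succ]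
    have e7 : qPoch (C * q) q m = qPoch C q m * (1 - C * q ^ m) / (1 - C) := by
      rw [e5]; field_simp
    rw [e7]
    field_simp
    ring

end qPochhammer

/-! ### A two-sided `q`-integral -/

/-- The support `{a q^{n+1}} ∪ {c q^{n+1}}` of the orthogonality measure. -/
def jPoint (a c q : ℝ) : ℕ ⊕ ℕ → ℝ :=
  Sum.elim (fun n => a * q * q ^ n) fun n => c * q * q ^ n

/-- The weight `(x/a, x/c; q)_∞ / (dx, ex; q)_∞`. -/
def jWeight (a c d e q x : ℝ) : ℝ :=
  qPochInf (x / a) q * qPochInf (x / c) q / (qPochInf (d * x) q * qPochInf (e * x) q)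

/-- The `q`-integral (divided by `1 - q`) of `f` from `cq` to `aq`. -/
def jInt (a c q : ℝ) (f : ℝ → ℝ) : ℝ := ∑' i, |jPoint a c q i| * f (jPoint a c q i)

section jInt

variable {a c q d e : ℝ}

theorem jPoint_mem (hq : q ∈ Set.Ioo (0 : ℝ) 1) (ha : 0 < a) (hc : c < 0) (i : ℕ ⊕ ℕ) :
    jPoint a c q i ∈ Set.Icc (c * q) (a * q) := by
  have h := hq.1
  have haq : 0 < a * q := mul_pos ha h
  have hcq : c * q < 0 := mul_neg_of_neg_of_pos hc h
  rcases i with n | n <;>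
  · have h1 : 0 < q ^ n := pow_pos h n
    have h2 : q ^ n ≤ 1 := pow_le_one₀ h.le hq.2.le
    simp only [jPoint, Sum.elim_inl, Sum.elim_inr]
    constructor <;> nlinarith

theorem summable_abs_jPoint (hq : q ∈ Set.Ioo (0 : ℝ) 1) (a c : ℝ) :
    Summable fun i => |jPoint a c q i| := by
  have h (b : ℝ) : Summable fun n : ℕ => |b * q * q ^ n| := by
    refine ((summable_geometric_of_lt_one hq.1.le hq.2).mul_left |b * q|).congr fun n => ?_
    rw [abs_mul _ (q ^ n), abs_of_pos (pow_pos hq.1 n)]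
  exact Summable.sum _ (h a) (h c)

theorem tsum_abs_jPoint (hq : q ∈ Set.Ioo (0 : ℝ) 1) (ha : 0 < a) (hc : c < 0) :
    ∑' i, |jPoint a c q i| = (a - c) * q / (1 - q) := by
  have h := summable_abs_jPoint hq a c
  have haq : 0 < a * q := mul_pos ha hq.1
  have hcq : c * q < 0 := mul_neg_of_neg_of_pos hc hq.1
  have e1 : ∀ n : ℕ, |a * q * q ^ n| = a * q * q ^ n := fun n =>
    abs_of_pos (mul_pos haq (pow_pos hq.1 n))
  have e2 : ∀ n : ℕ, |c * q * q ^ n| = -(c * q) * q ^ n := fun n => by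
    rw [abs_of_neg (mul_neg_of_neg_of_pos hcq (pow_pos hq.1 n)), neg_mul]
  rw [Summable.tsum_sum (h.comp_injective Sum.inl_injective) (h.comp_injective Sum.inr_injective)]
  simp only [jPoint, Sum.elim_inl, Sum.elim_inr, e1, e2, tsum_mul_left,
    tsum_geometric_of_lt_one hq.1.le hq.2]
  have : 1 - q ≠ 0 := by linarith [hq.2]
  field_simp
  ring

theorem summable_jInt (hq : q ∈ Set.Ioo (0 : ℝ) 1) {f : ℝ → ℝ} {B : ℝ}
    (hf : ∀ i, |f (jPoint a c q i)| ≤ B) :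
    Summable fun i => |jPoint a c q i| * f (jPoint a c q i) := by
  refine ((summable_abs_jPoint hq a c).mul_right B).of_norm_bounded fun i => ?_
  rw [Real.norm_eq_abs, abs_mul, abs_abs]
  exact mul_le_mul_of_nonneg_left (hf i) (abs_nonneg _)

/-- A linear function on an interval is largest at an endpoint. For this reason the conditions on
`d` and `e` below are imposed only at `a * q` and `c * q`. -/
theorem mul_le_max_of_mem {d x l r : ℝ} (hx : x ∈ Set.Icc l r) : d * x ≤ max (d * r) (d * l) := by
  rcases le_total 0 d with h | h
  · exact le_max_of_le_left (mul_le_mul_of_nonneg_left hx.2 h)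
  · exact le_max_of_le_right (mul_le_mul_of_nonpos_left hx.1 h)

theorem mul_lt_one_of_mem (hd : d * (a * q) < 1) (hd' : d * (c * q) < 1) {x : ℝ}
    (hx : x ∈ Set.Icc (c * q) (a * q)) : d * x < 1 :=
  (mul_le_max_of_mem hx).trans_lt (max_lt hd hd')

theorem div_mem_of_mem (ha : 0 < a) (hc : c < 0) {x : ℝ} (hx : x ∈ Set.Icc (c * q) (a * q)) :
    x / a ∈ Set.Icc (c * q / a) q ∧ x / c ∈ Set.Icc (a * q / c) q := by
  refine ⟨⟨by gcongr; exact hx.1, (div_le_iff₀ ha).2 (by linarith [hx.2])⟩, ?_, ?_⟩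
  · exact div_le_div_of_nonpos_of_le hc.le hx.2
  · exact (div_le_iff_of_neg hc).2 (by linarith [hx.1])

theorem jWeight_pos (hq : q ∈ Set.Ioo (0 : ℝ) 1) (ha : 0 < a) (hc : c < 0)
    (hd : d * (a * q) < 1) (hd' : d * (c * q) < 1) (he : e * (a * q) < 1) (he' : e * (c * q) < 1)
    {x : ℝ} (hx : x ∈ Set.Icc (c * q) (a * q)) : 0 < jWeight a c d e q x := by
  obtain ⟨h1, h2⟩ := div_mem_of_mem ha hc hx
  exact div_pos (mul_pos (qPochInf_pos hq (h1.2.trans_lt hq.2))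
    (qPochInf_pos hq (h2.2.trans_lt hq.2))) (mul_pos (qPochInf_pos hq (mul_lt_one_of_mem hd hd' hx))
    (qPochInf_pos hq (mul_lt_one_of_mem he he' hx)))

theorem jWeight_le (hq : q ∈ Set.Ioo (0 : ℝ) 1) (ha : 0 < a) (hc : c < 0) {δ η : ℝ}
    (hδ : δ < 1) (hη : η < 1) {x : ℝ} (hx : x ∈ Set.Icc (c * q) (a * q)) (hd : d * x ≤ δ)
    (he : e * x ≤ η) : jWeight a c d e q x ≤
      qPochInf (c * q / a) q * qPochInf (a * q / c) q / (qPochInf δ q * qPochInf η q) := by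
  obtain ⟨h1, h2⟩ := div_mem_of_mem ha hc hx
  have p1 := qPochInf_pos hq hδ
  have p2 := qPochInf_pos hq hη
  have p3 := qPochInf_anti hq hd hδ.le
  have p4 := qPochInf_anti hq he hη.le
  have p5 := qPochInf_pos hq (h1.2.trans_lt hq.2)
  have p6 := qPochInf_pos hq (h2.2.trans_lt hq.2)
  have p7 := qPochInf_anti hq h1.1 (h1.2.trans hq.2.le)
  have p8 := qPochInf_anti hq h2.1 (h2.2.trans hq.2.le)
  exact div_le_div₀ (mul_nonneg (p5.le.trans p7) (p6.le.trans p8)) (mul_le_mul p7 p8 p6.le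
    (p5.le.trans p7)) (mul_pos p1 p2) (mul_le_mul p3 p4 p2.le (p1.le.trans p3))

/-- A bound for the weight that does not depend on the point of the support. -/
theorem exists_jWeight_bound (hq : q ∈ Set.Ioo (0 : ℝ) 1) (ha : 0 < a) (hc : c < 0)
    (hd : d * (a * q) < 1) (hd' : d * (c * q) < 1) (he : e * (a * q) < 1)
    (he' : e * (c * q) < 1) :
    ∃ B, ∀ n : ℕ, ∀ i, |jWeight a c (d * q ^ n) (e * q ^ n) q (jPoint a c q i)| ≤ B := by
  -- The maximum with 0 makes the bound uniform in n: if d x is negative, multiplication by q^n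
  -- moves it up towards 0 instead of down.
  have hm : ∀ d : ℝ, d * (a * q) < 1 → d * (c * q) < 1 →
      max (max (d * (a * q)) (d * (c * q))) 0 < 1 := fun d h h' => by simp [h, h']
  have hle : ∀ (d : ℝ) (n : ℕ) (i), d * q ^ n * jPoint a c q i ≤
      max (max (d * (a * q)) (d * (c * q))) 0 := fun d n i => by
    have h := mul_le_max_of_mem (d := d) (jPoint_mem hq ha hc i)
    have h1 := pow_pos hq.1 n
    have h2 : q ^ n ≤ 1 := pow_le_one₀ hq.1.le hq.2.le
    rcases le_total (d * jPoint a c q i) 0 with h3 | h3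
    · refine le_max_of_le_right ?_
      nlinarith
    · refine le_max_of_le_left (le_trans ?_ h)
      nlinarith
  refine ⟨qPochInf (c * q / a) q * qPochInf (a * q / c) q /
    (qPochInf (max (max (d * (a * q)) (d * (c * q))) 0) q *
      qPochInf (max (max (e * (a * q)) (e * (c * q))) 0) q), fun n i => ?_⟩
  have hx := jPoint_mem hq ha hc i
  rw [abs_of_nonneg]
  · exact jWeight_le hq ha hc (hm d hd hd') (hm e he he') hx (hle d n i) (hle e n i)
  · obtain ⟨h1, h2⟩ := div_mem_of_mem ha hc hx
    exact div_nonneg (mul_nonneg (qPochInf_nonneg hq (h1.2.trans hq.2.le))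
      (qPochInf_nonneg hq (h2.2.trans hq.2.le))) (mul_nonneg
      (qPochInf_nonneg hq ((hle d n i).trans (hm d hd hd').le))
      (qPochInf_nonneg hq ((hle e n i).trans (hm e he he').le)))

/-! ### Parameter shifts of the weight and the q-beta integral -/

theorem jWeight_mul_left (hq : q ∈ Set.Ioo (0 : ℝ) 1) {x : ℝ} (hd : d * x < 1) :
    jWeight a c (d * q) e q x = (1 - d * x) * jWeight a c d e q x := by
  unfold jWeight
  have h : 1 - d * x ≠ 0 := by linarith
  rw [qPochInf_step hq (d * x), show d * q * x = d * x * q by ring]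
  generalize d * x = y at *
  field_simp

theorem jWeight_comm (x : ℝ) : jWeight a c d e q x = jWeight a c e d q x := by
  unfold jWeight
  rw [mul_comm (qPochInf (d * x) q)]

/-- The total mass of the weight. -/
def jMass (a c d e q : ℝ) : ℝ := jInt a c q (jWeight a c d e q)

theorem jMass_comm : jMass a c d e q = jMass a c e d q := by
  unfold jMass jInt
  simp only [jWeight_comm (d := d)]

theorem summable_jMass (hq : q ∈ Set.Ioo (0 : ℝ) 1) (ha : 0 < a) (hc : c < 0)
    (hd : d * (a * q) < 1) (hd' : d * (c * q) < 1) (he : e * (a * q) < 1)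
    (he' : e * (c * q) < 1) :
    Summable fun i => |jPoint a c q i| * jWeight a c d e q (jPoint a c q i) := by
  obtain ⟨B, hB⟩ := exists_jWeight_bound hq ha hc hd hd' he he'
  exact summable_jInt hq (f := jWeight a c d e q) fun i => by simpa using hB 0 i

/-- The telescoping sum over one half of the support. -/
theorem hasSum_telescope (hq : q ∈ Set.Ioo (0 : ℝ) 1) {b s : ℝ} (hb : b ≠ 0) (hs : s ≠ 0)
    (hs' : b / s * q < 1) (hd : ∀ n : ℕ, d * (b * q * q ^ n) < 1)
    (he : ∀ n : ℕ, e * (b * q * q ^ n) < 1)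
    (hsum : Summable fun n : ℕ => b * q * q ^ n * (jWeight b s d e q (b * q * q ^ n) *
      (d + e - 1 / (b * q) - 1 / (s * q) + b * q * q ^ n * (1 / (b * s * q ^ 2) - d * e)))) :
    HasSum (fun n : ℕ => b * q * q ^ n * (jWeight b s d e q (b * q * q ^ n) *
      (d + e - 1 / (b * q) - 1 / (s * q) + b * q * q ^ n * (1 / (b * s * q ^ 2) - d * e)))) (-1) := by
  have h0 := hq.1.ne'
  -- `G n` is the value at x = b q^{n+1} of (x/(bq), x/(sq);q)_∞ / (dx, ex;q)_∞, which is symmetric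
  -- in b and s. The summand is its q-difference, so the sum is G 0 - lim G.
  set G : ℕ → ℝ := fun n => qPochInf (q ^ n) q * qPochInf (b / s * q ^ n) q /
    (qPochInf (d * (b * q) * q ^ n) q * qPochInf (e * (b * q) * q ^ n) q) with hG
  have hd0 : ∀ n : ℕ, d * (b * q) * q ^ n < 1 := fun n => by have := hd n; linarith
  have he0 : ∀ n : ℕ, e * (b * q) * q ^ n < 1 := fun n => by have := he n; linarith
  have hstep : ∀ n : ℕ, b * q * q ^ n * (jWeight b s d e q (b * q * q ^ n) *
      (d + e - 1 / (b * q) - 1 / (s * q) + b * q * q ^ n * (1 / (b * s * q ^ 2) - d * e))) =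
      G n - G (n + 1) := fun n => by
    have p1 := (qPochInf_pos hq (hd0 (n + 1))).ne'
    have p2 := (qPochInf_pos hq (he0 (n + 1))).ne'
    simp only [hG, jWeight]
    rw [qPochInf_step hq (q ^ n), qPochInf_step hq (b / s * q ^ n),
      show d * (b * q * q ^ n) = d * (b * q) * q ^ n by ring,
      show e * (b * q * q ^ n) = e * (b * q) * q ^ n by ring,
      qPochInf_step hq (d * (b * q) * q ^ n), qPochInf_step hq (e * (b * q) * q ^ n),
      show b * q * q ^ n / b = q ^ (n + 1) by field_simp; ring,
      show b * q * q ^ n / s = b / s * q ^ (n + 1) by field_simp; ring,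
      show q ^ n * q = q ^ (n + 1) by ring, show b / s * q ^ n * q = b / s * q ^ (n + 1) by ring,
      show d * (b * q) * q ^ n * q = d * (b * q) * q ^ (n + 1) by ring,
      show e * (b * q) * q ^ n * q = e * (b * q) * q ^ (n + 1) by ring]
    have p3 : 1 - d * (b * q) * q ^ n ≠ 0 := by linarith [hd0 n]
    have p4 : 1 - e * (b * q) * q ^ n ≠ 0 := by linarith [he0 n]
    generalize qPochInf (q ^ (n + 1)) q = A
    generalize qPochInf (b / s * q ^ (n + 1)) q = B
    generalize qPochInf (d * (b * q) * q ^ (n + 1)) q = C at *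
    generalize qPochInf (e * (b * q) * q ^ (n + 1)) q = D at *
    generalize q ^ n = t at *
    have key : b * q * t * (d + e - 1 / (b * q) - 1 / (s * q) +
        b * q * t * (1 / (b * s * q ^ 2) - d * e)) = (1 - t) * (1 - b / s * t) -
        (1 - d * (b * q) * t) * (1 - e * (b * q) * t) := by
      field_simp
      ring
    rw [show ∀ W Z : ℝ, b * q * t * (W * Z) = W * (b * q * t * Z) from fun _ _ => by ring, key]
    generalize 1 - d * (b * q) * t = u at *
    generalize 1 - e * (b * q) * t = v at *
    field_simp
  have hlim : Filter.Tendsto G Filter.atTop (nhds 1) := by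
    rw [← Filter.tendsto_add_atTop_iff_nat 1]
    have t1 := tendsto_qPochInf_mul_pow hq hq.2
    have t2 := tendsto_qPochInf_mul_pow hq hs'
    have t3 := tendsto_qPochInf_mul_pow hq (hd0 1)
    have t4 := tendsto_qPochInf_mul_pow hq (he0 1)
    have := (t1.mul t2).div (t3.mul t4) (by norm_num)
    norm_num at this
    refine this.congr fun n => ?_
    simp only [hG, Pi.div_apply]
    rw [show q * q ^ n = q ^ (n + 1) by ring, show b / s * q * q ^ n = b / s * q ^ (n + 1) by ring,
      show d * (b * q) * q * q ^ n = d * (b * q) * q ^ (n + 1) by ring,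
      show e * (b * q) * q * q ^ n = e * (b * q) * q ^ (n + 1) by ring]
  -- The factor (1;q)_∞ vanishes, so the endpoint of the support contributes nothing; the limit x →
  -- 0 contributes 1.
  have hG0 : G 0 = 0 := by
    simp only [hG, pow_zero]
    rw [qPochInf_step hq 1]
    simp
  have := hsum.hasSum.tendsto_sum_nat
  simp only [hstep] at this hsum ⊢
  have h2 := tendsto_nhds_unique this
    (((hlim.const_sub (G 0))).congr fun n => (Finset.sum_range_sub' G n).symm)
  rw [hG0] at h2
  have h3 := hsum.hasSum
  rw [h2] at h3
  simpa using h3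

theorem jWeight_swap (x : ℝ) : jWeight a c d e q x = jWeight c a d e q x := by
  unfold jWeight
  rw [mul_comm (qPochInf (x / a) q)]

/-- `q`-integration by parts. -/
theorem hasSum_jInt_parts (hq : q ∈ Set.Ioo (0 : ℝ) 1) (ha : 0 < a) (hc : c < 0)
    (hd : d * (a * q) < 1) (hd' : d * (c * q) < 1) (he : e * (a * q) < 1)
    (he' : e * (c * q) < 1) :
    HasSum (fun i => |jPoint a c q i| * (jWeight a c d e q (jPoint a c q i) *
      (d + e - 1 / (a * q) - 1 / (c * q) + jPoint a c q i * (1 / (a * c * q ^ 2) - d * e)))) 0 := by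
  obtain ⟨B, hB⟩ := exists_jWeight_bound hq ha hc hd hd' he he'
  set A : ℝ → ℝ := fun x =>
    d + e - 1 / (a * q) - 1 / (c * q) + x * (1 / (a * c * q ^ 2) - d * e) with hA
  have hsum := summable_jInt (a := a) (c := c) hq (f := fun x => jWeight a c d e q x * A x)
    (B := B * (|d + e - 1 / (a * q) - 1 / (c * q)| + (a * q - c * q) *
      |1 / (a * c * q ^ 2) - d * e|)) fun i => by
    have h0 := hB 0 i
    simp only [pow_zero, mul_one] at h0
    have hx := jPoint_mem hq ha hc i
    have haq : 0 < a * q := mul_pos ha hq.1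
    have hcq : c * q < 0 := mul_neg_of_neg_of_pos hc hq.1
    have hx' : |jPoint a c q i| ≤ a * q - c * q :=
      abs_le.2 ⟨by linarith [hx.1, hx.2], by linarith [hx.1, hx.2]⟩
    rw [abs_mul]
    refine mul_le_mul h0 ((abs_add_le _ _).trans ?_) (abs_nonneg _) ((abs_nonneg _).trans h0)
    rw [abs_mul]
    gcongr
  have hmem := fun i => jPoint_mem hq ha hc i
  have h1 := hsum.comp_injective Sum.inl_injective
  have h2 := hsum.comp_injective Sum.inr_injective
  have haq : 0 < a * q := mul_pos ha hq.1
  have hcq : c * q < 0 := mul_neg_of_neg_of_pos hc hq.1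
  have ac : a / c * q < 1 := by
    have : a / c < 0 := div_neg_of_pos_of_neg ha hc
    nlinarith [hq.1]
  have ca : c / a * q < 1 := by
    have : c / a < 0 := div_neg_of_neg_of_pos hc ha
    nlinarith [hq.1]
  have e1 : ∀ n : ℕ, |a * q * q ^ n| = a * q * q ^ n := fun n =>
    abs_of_pos (mul_pos haq (pow_pos hq.1 n))
  have e2 : ∀ n : ℕ, |c * q * q ^ n| = -(c * q * q ^ n) := fun n =>
    abs_of_neg (mul_neg_of_neg_of_pos hcq (pow_pos hq.1 n))
  simp only [Function.comp_def, jPoint, Sum.elim_inl, Sum.elim_inr, e1, e2, hA] at h1 h2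
  have t1 := hasSum_telescope hq ha.ne' hc.ne ac
    (fun n => mul_lt_one_of_mem hd hd' (hmem (Sum.inl n)))
    (fun n => mul_lt_one_of_mem he he' (hmem (Sum.inl n))) h1
  have h3 := h2.neg
  have hcc : ∀ n : ℕ, -(-(c * q * q ^ n) * (jWeight a c d e q (c * q * q ^ n) *
      (d + e - 1 / (a * q) - 1 / (c * q) + c * q * q ^ n * (1 / (a * c * q ^ 2) - d * e)))) =
      c * q * q ^ n * (jWeight c a d e q (c * q * q ^ n) *
      (d + e - 1 / (c * q) - 1 / (a * q) + c * q * q ^ n * (1 / (c * a * q ^ 2) - d * e))) :=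
    fun n => by rw [jWeight_swap, mul_comm c a]; ring
  have t2 := (hasSum_telescope hq hc.ne ha.ne' ca
    (fun n => mul_lt_one_of_mem hd hd' (hmem (Sum.inr n)))
    (fun n => mul_lt_one_of_mem he he' (hmem (Sum.inr n))) (h3.congr hcc)).neg
  -- Each half telescopes to -1 when weighted by x. On the negative half |x| = -x, which turns -1
  -- into +1, and the two contributions at x = 0 cancel.
  have t3 := HasSum.sum (f := fun i => |jPoint a c q i| * (jWeight a c d e q (jPoint a c q i) *
      A (jPoint a c q i))) (a := -1) (b := 1) ?_ ?_
  · rw [neg_add_cancel] at t3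
    exact t3
  · simpa only [Function.comp_def, jPoint, Sum.elim_inl, Sum.elim_inr, e1, e2, hA] using t1
  · simp only [← hcc, neg_neg] at t2
    simpa only [Function.comp_def, jPoint, Sum.elim_inl, Sum.elim_inr, e1, e2, hA] using t2

/-- Replacing d by dq multiplies the weight by 1 - dx, which is affine in x, and integration by
parts is one linear relation between the integrals of 1 and x. Subtracting dacq² times that relation
from (1 - adq)(1 - cdq) times the mass leaves (1 - acdeq²)(1 - dx) under the integral. -/
theorem jMass_step (hq : q ∈ Set.Ioo (0 : ℝ) 1) (ha : 0 < a) (hc : c < 0)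
    (hd : d * (a * q) < 1) (hd' : d * (c * q) < 1) (he : e * (a * q) < 1)
    (he' : e * (c * q) < 1) :
    jMass a c (d * q) e q * (1 - a * c * d * e * q ^ 2) =
      (1 - a * d * q) * (1 - c * d * q) * jMass a c d e q := by
  have h1 := (summable_jMass hq ha hc hd hd' he he').hasSum
  have h2 := hasSum_jInt_parts hq ha hc hd hd' he he'
  have h3 := (h1.mul_left ((1 - a * d * q) * (1 - c * d * q))).sub
    (h2.mul_left (d * a * c * q ^ 2))
  have h0 := hq.1.ne'
  rw [mul_zero, sub_zero] at h3
  rw [mul_comm (jMass _ _ _ _ _), jMass, jInt, ← tsum_mul_left]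
  refine HasSum.tsum_eq (h3.congr_fun fun i => ?_)
  rw [jWeight_mul_left hq (mul_lt_one_of_mem hd hd' (jPoint_mem hq ha hc i))]
  have hc0 := hc.ne
  have ha0 := ha.ne'
  field_simp
  ring

theorem mul_pow_lt_one (hq : q ∈ Set.Ioo (0 : ℝ) 1) {y : ℝ} (h : d * y < 1) (n : ℕ) :
    d * q ^ n * y < 1 := by
  have h1 := pow_pos hq.1 n
  have h2 : q ^ n ≤ 1 := pow_le_one₀ hq.1.le hq.2.le
  rcases le_total (d * y) 0 with h3 | h3 <;> nlinarith

theorem jMass_mul_pow_left (hq : q ∈ Set.Ioo (0 : ℝ) 1) (ha : 0 < a) (hc : c < 0)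
    (hd : d * (a * q) < 1) (hd' : d * (c * q) < 1) (he : e * (a * q) < 1)
    (he' : e * (c * q) < 1) (k : ℕ) :
    jMass a c (d * q ^ k) e q * qPoch (a * c * d * e * q ^ 2) q k =
      qPoch (a * d * q) q k * qPoch (c * d * q) q k * jMass a c d e q := by
  induction k with
  | zero => simp [qPoch_zero]
  | succ k ih =>
    have h := jMass_step hq ha hc (mul_pow_lt_one hq hd k) (mul_pow_lt_one hq hd' k) he he'
    rw [pow_succ, ← mul_assoc, qPoch_succ, qPoch_succ, qPoch_succ]
    linear_combination qPoch (a * c * d * e * q ^ 2) q k * h +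
      (1 - a * d * q * q ^ k) * (1 - c * d * q * q ^ k) * ih

/-- Iteration of the one-step recurrence in `d`, then in `e` by the symmetry of the weight. The
second iteration starts from acdeq^{2+k}, which is why the symbols on the left join to one of length
`k + l`. -/
theorem jMass_mul_pow (hq : q ∈ Set.Ioo (0 : ℝ) 1) (ha : 0 < a) (hc : c < 0)
    (hd : d * (a * q) < 1) (hd' : d * (c * q) < 1) (he : e * (a * q) < 1)
    (he' : e * (c * q) < 1) (k l : ℕ) :
    jMass a c (d * q ^ k) (e * q ^ l) q * qPoch (a * c * d * e * q ^ 2) q (k + l) =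
      qPoch (a * d * q) q k * qPoch (c * d * q) q k * (qPoch (a * e * q) q l *
        qPoch (c * e * q) q l) * jMass a c d e q := by
  have h1 := jMass_mul_pow_left hq ha hc hd hd' he he' k
  have h2 := jMass_mul_pow_left hq ha hc he he' (mul_pow_lt_one hq hd k)
    (mul_pow_lt_one hq hd' k) l
  rw [jMass_comm, jMass_comm (d := e), show a * c * e * (d * q ^ k) * q ^ 2 =
    a * c * d * e * q ^ 2 * q ^ k by ring] at h2
  rw [qPoch_add]
  linear_combination qPoch (a * c * d * e * q ^ 2) q k * h2 +
    qPoch (a * e * q) q l * qPoch (c * e * q) q l * h1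

theorem tendsto_jMass (hq : q ∈ Set.Ioo (0 : ℝ) 1) (ha : 0 < a) (hc : c < 0)
    (hd : d * (a * q) < 1) (hd' : d * (c * q) < 1) (he : e * (a * q) < 1)
    (he' : e * (c * q) < 1) :
    Filter.Tendsto (fun n : ℕ => jMass a c (d * q ^ n) (e * q ^ n) q) Filter.atTop
      (nhds (jMass a c 0 0 q)) := by
  obtain ⟨B, hB⟩ := exists_jWeight_bound hq ha hc hd hd' he he'
  refine tendsto_tsum_of_dominated_convergence
    (bound := fun i => |jPoint a c q i| * B) ((summable_abs_jPoint hq a c).mul_right B)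
    (fun i => ?_) (Filter.Eventually.of_forall fun n i => ?_)
  · have hx := jPoint_mem hq ha hc i
    have t1 := tendsto_qPochInf_mul_pow hq (mul_lt_one_of_mem hd hd' hx)
    have t2 := tendsto_qPochInf_mul_pow hq (mul_lt_one_of_mem he he' hx)
    refine Filter.Tendsto.const_mul _ ?_
    have t3 := (tendsto_const_nhds (x := qPochInf (jPoint a c q i / a) q *
      qPochInf (jPoint a c q i / c) q)).div (t1.mul t2) (by norm_num)
    unfold jWeight
    rw [zero_mul, qPochInf_zero]
    refine t3.congr fun n => ?_
    rw [Pi.div_apply, mul_right_comm, mul_right_comm e]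
  · rw [Real.norm_eq_abs, abs_mul, abs_abs]
    exact mul_le_mul_of_nonneg_left (hB n i) (abs_nonneg _)

/-- Limit of `jMass_mul_pow` along k = l = n → ∞: both denominator parameters shrink to 0, and the
finite symbols become infinite products. -/
theorem jMass_eq_zero_mass (hq : q ∈ Set.Ioo (0 : ℝ) 1) (ha : 0 < a) (hc : c < 0)
    (hd : d * (a * q) < 1) (hd' : d * (c * q) < 1) (he : e * (a * q) < 1)
    (he' : e * (c * q) < 1) :
    jMass a c 0 0 q * qPochInf (a * c * d * e * q ^ 2) q =
      qPochInf (a * d * q) q * qPochInf (c * d * q) q * (qPochInf (a * e * q) q *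
        qPochInf (c * e * q) q) * jMass a c d e q := by
  have h2 : Filter.Tendsto (fun n : ℕ => n + n) Filter.atTop Filter.atTop :=
    Filter.tendsto_atTop_mono (fun n => Nat.le_add_left n n) Filter.tendsto_id
  have t1 := (tendsto_jMass hq ha hc hd hd' he he').mul
    ((tendsto_qPoch hq (a * c * d * e * q ^ 2)).comp h2)
  have t2 := (((tendsto_qPoch hq (a * d * q)).mul (tendsto_qPoch hq (c * d * q))).mul
    ((tendsto_qPoch hq (a * e * q)).mul (tendsto_qPoch hq (c * e * q)))).mul_const
      (jMass a c d e q)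
  exact tendsto_nhds_unique t1 (t2.congr fun n =>
    (jMass_mul_pow hq ha hc hd hd' he he' n n).symm)

/-- The mass with d = e = 0 does not depend on d and e, so it can be read off from any case where
the integral is known. For d = 1/c and e = 1/a the weight is identically 1 on the support and the
mass is a pair of geometric series. -/
theorem jMass_zero (hq : q ∈ Set.Ioo (0 : ℝ) 1) (ha : 0 < a) (hc : c < 0) :
    jMass a c 0 0 q = a * q * qPochInf q q * qTheta (c / a) q := by
  have h0 := hq.1
  have ha0 := ha.ne'
  have hc0 := hc.ne
  have n1 : a * q / c < 0 := div_neg_of_pos_of_neg (mul_pos ha h0) hc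
  have n2 : c * q / a < 0 := div_neg_of_neg_of_pos (mul_neg_of_neg_of_pos hc h0) ha
  have d1 : 1 / c * (a * q) < 1 := by rw [one_div_mul_eq_div]; linarith
  have d2 : 1 / c * (c * q) < 1 := by
    rw [one_div_mul_eq_div, mul_div_cancel_left₀ _ hc0]; exact hq.2
  have d3 : 1 / a * (a * q) < 1 := by
    rw [one_div_mul_eq_div, mul_div_cancel_left₀ _ ha0]; exact hq.2
  have d4 : 1 / a * (c * q) < 1 := by rw [one_div_mul_eq_div]; linarith
  have hm : jMass a c (1 / c) (1 / a) q = (a - c) * q / (1 - q) := by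
    rw [← tsum_abs_jPoint hq ha hc]
    refine tsum_congr fun i => ?_
    have hx := jPoint_mem hq ha hc i
    have p1 := (qPochInf_pos hq (mul_lt_one_of_mem d1 d2 hx)).ne'
    have p2 := (qPochInf_pos hq (mul_lt_one_of_mem d3 d4 hx)).ne'
    rw [one_div_mul_eq_div] at p1 p2
    rw [jWeight, one_div_mul_eq_div, one_div_mul_eq_div]
    field_simp
  have h := jMass_eq_zero_mass hq ha hc d1 d2 d3 d4
  have hq2 : q * q < 1 := by nlinarith [hq.2]
  have hp := (qPochInf_pos hq hq2).ne'
  rw [hm, show a * c * (1 / c) * (1 / a) * q ^ 2 = q * q by field_simp,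
    show a * (1 / c) * q = a * q / c by ring, show c * (1 / a) * q = c * q / a by ring,
    show c * (1 / c) * q = q by field_simp, show a * (1 / a) * q = q by field_simp] at h
  have hs := qPochInf_step hq q
  have hs2 := qPochInf_step hq (c / a)
  have h1q : 1 - q ≠ 0 := by linarith [hq.2]
  rw [qTheta, hs2, show c / a * q = c * q / a by ring, show q / (c / a) = a * q / c by field_simp]
  refine mul_right_cancel₀ hp (h.trans ?_)
  rw [hs]
  field_simp

/-- The evaluation of the `q`-beta integral of Al-Salam and Verma. -/
theorem jMass_eq (hq : q ∈ Set.Ioo (0 : ℝ) 1) (ha : 0 < a) (hc : c < 0)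
    (hd : d * (a * q) < 1) (hd' : d * (c * q) < 1) (he : e * (a * q) < 1)
    (he' : e * (c * q) < 1) :
    qPochInf (a * d * q) q * qPochInf (c * d * q) q * (qPochInf (a * e * q) q *
        qPochInf (c * e * q) q) * jMass a c d e q =
      a * q * qPochInf q q * qTheta (c / a) q * qPochInf (a * c * d * e * q ^ 2) q := by
  rw [← jMass_eq_zero_mass hq ha hc hd hd' he he', jMass_zero hq ha hc]

end jInt

/-! ### Orthogonality of the big `q`-Jacobi polynomials -/

open Polynomial in
/-- A linear map that vanishes on polynomials `p_0, …, p_n` of degrees `0, …, n` vanishes on all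
polynomials of degree at most `n`. -/
theorem eq_zero_of_forall_degree {E : Type*} [AddCommGroup E] [Module ℝ E] (p : ℕ → ℝ[X])
    (hp : ∀ j, (p j).natDegree ≤ j) (hp' : ∀ j, (p j).coeff j ≠ 0) (Λ : ℝ[X] →ₗ[ℝ] E) (n : ℕ)
    (h : ∀ j ≤ n, Λ (p j) = 0) (f : ℝ[X]) (hf : f.natDegree ≤ n) : Λ f = 0 := by
  induction n generalizing f with
  | zero =>
    have e1 := eq_C_of_natDegree_le_zero hf
    have e2 := eq_C_of_natDegree_le_zero (hp 0)
    have e3 : f = (f.coeff 0 / (p 0).coeff 0) • p 0 := by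
      rw [e2, smul_C, coeff_C_zero, smul_eq_mul, div_mul_cancel₀ _ (hp' 0)]
      exact e1
    rw [e3, map_smul, h 0 le_rfl, smul_zero]
  | succ n ih =>
    set t := f.coeff (n + 1) / (p (n + 1)).coeff (n + 1) with ht
    have hg : (f - t • p (n + 1)).natDegree ≤ n := by
      refine natDegree_le_iff_coeff_eq_zero.2 fun N hN => ?_
      rcases (Nat.succ_le_of_lt hN).eq_or_lt with rfl | hN'
      · simp [ht, hp' (n + 1)]
      · rw [coeff_sub, coeff_smul, coeff_eq_zero_of_natDegree_lt (hf.trans_lt hN'),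
          coeff_eq_zero_of_natDegree_lt ((hp _).trans_lt hN'), smul_zero, sub_zero]
    have h1 := ih (fun j hj => h j (hj.trans n.le_succ)) _ hg
    rw [map_sub, map_smul, h (n + 1) le_rfl, smul_zero, sub_zero] at h1
    exact h1

/-- The conditions under which the big `q`-Jacobi polynomials are orthogonal. -/
structure IsJacobiParam (a b c q : ℝ) : Prop where
  hq : q ∈ Set.Ioo (0 : ℝ) 1
  ha : 0 < a
  haq : a * q < 1
  hb : 0 < b
  hbq : b * q < 1
  hc : c < 0

/-- The coefficient of `(x; q)_k` in `P_m(x; a, b, c; q)`. -/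
def jCoeff (m : ℕ) (a b c q : ℝ) (k : ℕ) : ℝ :=
  qPoch (q ^ m)⁻¹ q k * qPoch (a * b * q ^ (m + 1)) q k /
    (qPoch q q k * qPoch (a * q) q k * qPoch (c * q) q k) * q ^ k

theorem jCoeff_eq_zero {q : ℝ} (hq : q ∈ Set.Ioo (0 : ℝ) 1) (a b c : ℝ) {m k : ℕ} (h : m < k) :
    jCoeff m a b c q k = 0 := by
  simp [jCoeff, qPoch_inv_pow_eq_zero hq h]

/-- The series terminates because (q^{-m};q)_k = 0 for k > m. The free upper limit `M` leaves room
for index shifts in the contiguous relations. -/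
theorem bigQJacobi_eq_sum {q : ℝ} (hq : q ∈ Set.Ioo (0 : ℝ) 1) (a b c x : ℝ) {m M : ℕ}
    (h : m < M) :
    bigQJacobi m x a b c q = ∑ k ∈ Finset.range M, jCoeff m a b c q k * qPoch x q k := by
  rw [bigQJacobi, phi32, tsum_eq_sum (s := Finset.range M)]
  · exact Finset.sum_congr rfl fun k _ => by rw [jCoeff]; ring
  · intro k hk
    rw [qPoch_inv_pow_eq_zero hq (h.trans_le (by simpa using hk))]
    simp

/-! ### Big q-Jacobi polynomials as elements of ℝ[X] -/

section Polynomial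
open Polynomial

/-- The polynomial `(eX; q)_k`. -/
def qPochX (e q : ℝ) (k : ℕ) : ℝ[X] := ∏ i ∈ Finset.range k, (1 - C (e * q ^ i) * X)

theorem eval_qPochX (e q x : ℝ) (k : ℕ) : (qPochX e q k).eval x = qPoch (e * x) q k := by
  simp only [qPochX, qPoch, eval_prod, eval_sub, eval_one, eval_mul, eval_C, eval_X]
  exact Finset.prod_congr rfl fun i _ => by ring

theorem natDegree_qPochX_le (e q : ℝ) (k : ℕ) : (qPochX e q k).natDegree ≤ k := by
  refine (natDegree_prod_le _ _).trans ((Finset.sum_le_card_nsmul _ _ 1 fun i _ => ?_).trans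
    (by simp))
  compute_degree

theorem coeff_qPochX (e q : ℝ) (k : ℕ) :
    (qPochX e q k).coeff k = (-e) ^ k * q ^ (k.choose 2) := by
  induction k with
  | zero => simp [qPochX]
  | succ k ih =>
    have h : qPochX e q (k + 1) = qPochX e q k * (1 - C (e * q ^ k) * X) :=
      Finset.prod_range_succ _ _
    rw [h, mul_sub, mul_one, coeff_sub,
      coeff_eq_zero_of_natDegree_lt (Nat.lt_succ_of_le (natDegree_qPochX_le e q k)),
      ← mul_assoc, coeff_mul_X, coeff_mul_C, ih, Nat.choose_succ_succ' k 1, Nat.choose_one_right,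
      pow_add]
    ring

/-- The big `q`-Jacobi polynomial as a polynomial. -/
def jPoly (a b c q : ℝ) (m : ℕ) : ℝ[X] :=
  ∑ k ∈ Finset.range (m + 1), C (jCoeff m a b c q k) * qPochX 1 q k

theorem eval_jPoly {q : ℝ} (hq : q ∈ Set.Ioo (0 : ℝ) 1) (a b c x : ℝ) (m : ℕ) :
    (jPoly a b c q m).eval x = bigQJacobi m x a b c q := by
  rw [bigQJacobi_eq_sum hq a b c x m.lt_succ_self, jPoly]
  simp [eval_finsetSum, eval_qPochX]

theorem natDegree_jPoly_le (a b c q : ℝ) (m : ℕ) : (jPoly a b c q m).natDegree ≤ m := by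
  refine natDegree_sum_le_of_forall_le _ _ fun k hk => ?_
  refine (natDegree_C_mul_le _ _).trans ((natDegree_qPochX_le _ _ _).trans ?_)
  simpa [Nat.lt_succ_iff] using hk

theorem coeff_jPoly (a b c q : ℝ) (m : ℕ) :
    (jPoly a b c q m).coeff m = jCoeff m a b c q m * ((-1) ^ m * q ^ (m.choose 2)) := by
  rw [jPoly, finsetSum_coeff, Finset.sum_range_succ, Finset.sum_eq_zero, zero_add, coeff_C_mul,
    coeff_qPochX]
  intro k hk
  rw [coeff_C_mul, coeff_eq_zero_of_natDegree_lt
    ((natDegree_qPochX_le _ _ _).trans_lt (Finset.mem_range.1 hk)), mul_zero]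

end Polynomial

/-- For m ≥ 1 both sides are (abq²;q)_{2m}, split in two ways. In this form no division by 1 - abq
occurs, so the case abq = 1 needs no separate treatment. -/
theorem weightFactor_mul (a b q : ℝ) (m : ℕ) : qPoch (a * b * q ^ (m + 1)) q m * weightFactor m a b q =
    qPoch (a * b * q ^ 2) q m * qPoch (a * b * q ^ (m + 2)) q m := by
  rcases m with _ | j
  · simp [weightFactor, qPoch_zero]
  · have h := qPoch_add (a * b * q ^ 2) q j (j + 2)
    rw [show a * b * q ^ 2 * q ^ j = a * b * q ^ (j + 1 + 1) by ring,
      qPoch_succ _ q (j + 1)] at h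
    rw [show a * b * q ^ (j + 1 + 2) = a * b * q ^ 2 * q ^ (j + 1) by ring, ← qPoch_add,
      show j + 1 + (j + 1) = j + (j + 2) by ring, h]
    simp only [weightFactor]
    ring

/-! ### Orthogonality relations and norms -/

namespace IsJacobiParam

variable {a b c q : ℝ} (P : IsJacobiParam a b c q)
include P

theorem q_ne : q ≠ 0 := P.hq.1.ne'

theorem cq_neg : c * q < 0 := mul_neg_of_neg_of_pos P.hc P.hq.1

theorem one_aq : 1 * (a * q) < 1 := by rw [one_mul]; exact P.haq

theorem one_cq : 1 * (c * q) < 1 := by linarith [P.cq_neg]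

theorem bc_aq_neg : b / c * (a * q) < 0 :=
  mul_neg_of_neg_of_pos (div_neg_of_pos_of_neg P.hb P.hc) (mul_pos P.ha P.hq.1)

theorem bc_aq : b / c * (a * q) < 1 := P.bc_aq_neg.trans one_pos

theorem bc_cq : b / c * (c * q) < 1 := by
  have := P.hc.ne
  rw [show b / c * (c * q) = b * q by field_simp]
  exact P.hbq

theorem abqq : a * b * q ^ 2 < 1 := by
  have h1 := mul_pos P.ha P.hq.1
  have h2 := mul_pos P.hb P.hq.1
  nlinarith [P.haq, P.hbq]

theorem abq_pow (n : ℕ) : a * b * q ^ (n + 2) < 1 := by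
  have h1 := mul_pos (mul_pos P.ha P.hb) (pow_pos P.hq.1 2)
  have h2 : q ^ n ≤ 1 := pow_le_one₀ P.hq.1.le P.hq.2.le
  rw [pow_add]
  nlinarith [P.abqq]

theorem jMass_qpow (k l : ℕ) :
    jMass a c (1 * q ^ k) (b / c * q ^ l) q * qPoch (a * b * q ^ 2) q (k + l) =
      qPoch (a * q) q k * qPoch (c * q) q k * (qPoch (a * b * q / c) q l *
        qPoch (b * q) q l) * jMass a c 1 (b / c) q := by
  have h := jMass_mul_pow P.hq P.ha P.hc P.one_aq P.one_cq P.bc_aq P.bc_cq k l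
  have := P.hc.ne
  rwa [show a * c * 1 * (b / c) * q ^ 2 = a * b * q ^ 2 by field_simp, mul_one, mul_one,
    show a * (b / c) * q = a * b * q / c by ring, show c * (b / c) * q = b * q by field_simp] at h

/-- The denominator (x, bx/c;q)_∞ of the weight absorbs finite q-shifted factorials in x and in
bx/c. This makes (x;q)_k the natural basis for expanding P_m and (bx/c;q)_l the natural family of
test polynomials. -/
theorem jWeight_mul_qPoch {x : ℝ} (hx : x ∈ Set.Icc (c * q) (a * q)) (k l : ℕ) :
    jWeight a c 1 (b / c) q x * (qPoch (1 * x) q k * qPoch (b / c * x) q l) =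
      jWeight a c (1 * q ^ k) (b / c * q ^ l) q x := by
  have h1 := mul_lt_one_of_mem P.one_aq P.one_cq hx
  have h2 := mul_lt_one_of_mem P.bc_aq P.bc_cq hx
  have e1 := qPoch_ne_zero P.hq h1 k
  have e2 := qPoch_ne_zero P.hq h2 l
  unfold jWeight
  rw [qPochInf_split P.hq (1 * x) k, qPochInf_split P.hq (b / c * x) l,
    show 1 * q ^ k * x = 1 * x * q ^ k by ring, show b / c * q ^ l * x = b / c * x * q ^ l by ring]
  generalize 1 * x = y at *
  generalize b / c * x = z at *
  field_simp

theorem weight_pos (i : ℕ ⊕ ℕ) : 0 < jWeight a c 1 (b / c) q (jPoint a c q i) :=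
  jWeight_pos P.hq P.ha P.hc P.one_aq P.one_cq P.bc_aq P.bc_cq (jPoint_mem P.hq P.ha P.hc i)

theorem exists_eval_bound (f : Polynomial ℝ) : ∃ B, ∀ i, |f.eval (jPoint a c q i)| ≤ B := by
  obtain ⟨B, hB⟩ := isCompact_Icc.exists_bound_of_continuousOn (s := Set.Icc (c * q) (a * q))
    f.continuous.continuousOn
  exact ⟨B, fun i => hB _ (jPoint_mem P.hq P.ha P.hc i)⟩

theorem summable_eval (f : Polynomial ℝ) : Summable fun i => |jPoint a c q i| *
    (jWeight a c 1 (b / c) q (jPoint a c q i) * f.eval (jPoint a c q i)) := by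
  obtain ⟨B, hB⟩ := P.exists_eval_bound f
  refine ((summable_jMass P.hq P.ha P.hc P.one_aq P.one_cq P.bc_aq P.bc_cq).mul_right
    B).of_norm_bounded fun i => ?_
  rw [← mul_assoc, norm_mul, Real.norm_eq_abs, Real.norm_eq_abs,
    abs_of_nonneg (mul_nonneg (abs_nonneg _) (P.weight_pos i).le)]
  exact mul_le_mul_of_nonneg_left (hB i) (mul_nonneg (abs_nonneg _) (P.weight_pos i).le)

/-- Integration of polynomials against the orthogonality measure. -/
def integral : Polynomial ℝ →ₗ[ℝ] ℝ where
  toFun f := jInt a c q fun x => jWeight a c 1 (b / c) q x * f.eval x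
  map_add' f g := by
    unfold jInt
    rw [← (P.summable_eval f).tsum_add (P.summable_eval g)]
    exact tsum_congr fun i => by simp only [Polynomial.eval_add]; ring
  map_smul' r f := by
    unfold jInt
    rw [smul_eq_mul, RingHom.id_apply, ← tsum_mul_left]
    exact tsum_congr fun i => by simp only [Polynomial.eval_smul, smul_eq_mul]; ring

theorem integral_qPochX (k l : ℕ) : P.integral (qPochX 1 q k * qPochX (b / c) q l) =
    jMass a c (1 * q ^ k) (b / c * q ^ l) q := by
  refine tsum_congr fun i => ?_
  simp only [Polynomial.eval_mul, eval_qPochX]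
  rw [P.jWeight_mul_qPoch (jPoint_mem P.hq P.ha P.hc i)]

/-- Term by term the integral is a shifted mass. By `jMass_qpow` its factors (aq, cq;q)_k cancel
those in the coefficients of P_m, and a terminating ₂φ₁ with B = abq^{m+1} and C = abq^{l+2}
remains, to which `qChuVandermonde` applies. -/
theorem integral_jPoly_mul (m l : ℕ) : P.integral (jPoly a b c q m * qPochX (b / c) q l) =
    qPoch (a * b * q / c) q l * qPoch (b * q) q l * jMass a c 1 (b / c) q /
      qPoch (a * b * q ^ 2) q l * ((∏ i ∈ Finset.range m,
        (a * b * q ^ (m + 1) - a * b * q ^ (l + 2) * q ^ i)) / qPoch (a * b * q ^ (l + 2)) q m) := by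
  rw [← qChuVandermonde P.hq m (m + 1) m.lt_succ_self _ _ (P.abq_pow l), jPoly, Finset.sum_mul,
    map_sum, Finset.mul_sum]
  refine Finset.sum_congr rfl fun k _ => ?_
  rw [mul_assoc, ← Polynomial.smul_eq_C_mul, map_smul, P.integral_qPochX, smul_eq_mul]
  have h := P.jMass_qpow k l
  have e1 := qPoch_ne_zero P.hq P.abqq l
  have e2 := qPoch_ne_zero P.hq (P.abq_pow l) k
  have e3 := qPoch_ne_zero P.hq P.haq k
  have e4 := qPoch_ne_zero P.hq (P.cq_neg.trans one_pos) k
  have e5 := qPoch_ne_zero P.hq P.hq.2 k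
  rw [add_comm k l, qPoch_add, show a * b * q ^ 2 * q ^ l = a * b * q ^ (l + 2) by ring] at h
  have h2 : jMass a c (1 * q ^ k) (b / c * q ^ l) q = qPoch (a * q) q k * qPoch (c * q) q k *
      (qPoch (a * b * q / c) q l * qPoch (b * q) q l) * jMass a c 1 (b / c) q /
      (qPoch (a * b * q ^ 2) q l * qPoch (a * b * q ^ (l + 2)) q k) := by
    rw [← h, mul_div_cancel_right₀ _ (mul_ne_zero e1 e2)]
  rw [h2, jCoeff]
  generalize qPoch (a * b * q ^ 2) q l = X1 at *
  generalize qPoch (a * b * q ^ (l + 2)) q k = X2 at *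
  generalize qPoch (a * q) q k = X3 at *
  generalize qPoch (c * q) q k = X4 at *
  generalize qPoch q q k = X5 at *
  field_simp

theorem integral_jPoly_mul_of_lt {m l : ℕ} (h : l < m) :
    P.integral (jPoly a b c q m * qPochX (b / c) q l) = 0 := by
  -- The factor abq^{m+1} - abq^{l+2+i} vanishes at i = m - 1 - l, which lies in the range exactly
  -- because l < m.
  rw [P.integral_jPoly_mul, Finset.prod_eq_zero (i := m - 1 - l)]
  · simp
  · exact Finset.mem_range.2 (by omega)
  · rw [mul_assoc (a * b), ← pow_add, show l + 2 + (m - 1 - l) = m + 1 by omega, sub_self]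

theorem integral_jPoly_mul_self (m : ℕ) : P.integral (jPoly a b c q m * qPochX (b / c) q m) =
    qPoch (a * b * q / c) q m * qPoch (b * q) q m * jMass a c 1 (b / c) q /
      qPoch (a * b * q ^ 2) q m * (((a * b * q ^ (m + 1)) ^ m * qPoch q q m) /
        qPoch (a * b * q ^ (m + 2)) q m) := by
  rw [P.integral_jPoly_mul]
  congr 3
  have h := Finset.prod_const (s := Finset.range m) (a * b * q ^ (m + 1))
  rw [Finset.card_range] at h
  rw [qPoch, ← h, ← Finset.prod_mul_distrib]
  exact Finset.prod_congr rfl fun i _ => by ring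

theorem weightFactor_pos (m : ℕ) : 0 < weightFactor m a b q := by
  rcases m with _ | j
  · exact one_pos
  · refine mul_pos ?_ (qPoch_pos P.hq P.abqq _)
    have := P.abq_pow (2 * j + 1)
    rw [show 2 * (j + 1) + 1 = 2 * j + 1 + 2 by ring]
    linarith

theorem jCoeff_self_ne_zero (m : ℕ) : jCoeff m a b c q m ≠ 0 := by
  have h0 := P.q_ne
  have e1 : qPoch (q ^ m)⁻¹ q m ≠ 0 := by
    rw [qPoch_inv_pow_self P.hq]
    have := qPoch_ne_zero P.hq P.hq.2 m
    positivity
  -- Only abq² < 1 is known; abq itself may equal 1. It occurs only for m = 0, where the symbol is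
  -- an empty product.
  have e2 : qPoch (a * b * q ^ (m + 1)) q m ≠ 0 := by
    rcases m with _ | m
    · simp [qPoch_zero]
    · exact qPoch_ne_zero P.hq (P.abq_pow m) _
  have e3 := qPoch_ne_zero P.hq P.haq m
  have e4 := qPoch_ne_zero P.hq (P.cq_neg.trans one_pos) m
  have e5 := qPoch_ne_zero P.hq P.hq.2 m
  unfold jCoeff
  exact mul_ne_zero (div_ne_zero (mul_ne_zero e1 e2) (mul_ne_zero (mul_ne_zero e5 e3) e4))
    (pow_ne_zero _ h0)

/-- Since P_m annihilates all lower degrees, its pairing with a polynomial of degree at most m sees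
only the coefficient of x^m. The constant is fixed by the test polynomial (bx/c;q)_m, whose leading
coefficient is (-b/c)^m q^{m(m-1)/2}. -/
theorem integral_jPoly_mul_eq (m : ℕ) (f : Polynomial ℝ) (hf : f.natDegree ≤ m) :
    P.integral (jPoly a b c q m * f) = f.coeff m * (P.integral (jPoly a b c q m *
      qPochX (b / c) q m) / ((-(b / c)) ^ m * q ^ (m.choose 2))) := by
  have hbc : b / c ≠ 0 := div_ne_zero P.hb.ne' P.hc.ne
  have hne : ∀ j : ℕ, (-(b / c)) ^ j * q ^ (j.choose 2) ≠ 0 := fun j =>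
    mul_ne_zero (pow_ne_zero _ (neg_ne_zero.2 hbc)) (pow_ne_zero _ P.q_ne)
  -- The functional is the difference of the two sides as a function of f. It kills (bx/c;q)_j for j
  -- < m by orthogonality and for j = m by the choice of the constant.
  have h := eq_zero_of_forall_degree (qPochX (b / c) q) (natDegree_qPochX_le _ _)
    (fun j => by rw [coeff_qPochX]; exact hne j)
    (P.integral.comp (LinearMap.mulLeft ℝ (jPoly a b c q m)) - (P.integral (jPoly a b c q m *
      qPochX (b / c) q m) / ((-(b / c)) ^ m * q ^ (m.choose 2))) • Polynomial.lcoeff ℝ m) m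
    (fun j hj => ?_) f hf
  · simp only [LinearMap.sub_apply, LinearMap.comp_apply, LinearMap.mulLeft_apply,
      LinearMap.smul_apply, Polynomial.lcoeff_apply, smul_eq_mul] at h
    linarith
  · simp only [LinearMap.sub_apply, LinearMap.comp_apply, LinearMap.mulLeft_apply,
      LinearMap.smul_apply, Polynomial.lcoeff_apply, smul_eq_mul]
    rcases hj.eq_or_lt with rfl | hj
    · rw [coeff_qPochX, div_mul_cancel₀ _ (hne j), sub_self]
    · rw [P.integral_jPoly_mul_of_lt hj, Polynomial.coeff_eq_zero_of_natDegree_lt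
        ((natDegree_qPochX_le _ _ _).trans_lt hj), mul_zero, sub_self]

theorem integral_jPoly_mul_jPoly_of_lt {m n : ℕ} (h : n < m) :
    P.integral (jPoly a b c q m * jPoly a b c q n) = 0 := by
  rw [P.integral_jPoly_mul_eq m _ ((natDegree_jPoly_le _ _ _ _ _).trans h.le),
    Polynomial.coeff_eq_zero_of_natDegree_lt ((natDegree_jPoly_le _ _ _ _ _).trans_lt h), zero_mul]

/-- The squared norm is the ratio of the leading coefficients of P_m and (bx/c;q)_m times
`integral_jPoly_mul_self`; inserting the value of the total mass gives 1/v(m). -/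
theorem weightV_mul_integral (m : ℕ) :
    weightV m a b c q * P.integral (jPoly a b c q m * jPoly a b c q m) = 1 := by
  have h0 := P.q_ne
  have ha := P.ha.ne'
  have hb := P.hb.ne'
  have hc := P.hc.ne
  have habc : a * b * q / c < 1 := by
    have := P.bc_aq
    rwa [show b / c * (a * q) = a * b * q / c by ring] at this
  have hcq := P.cq_neg.trans one_pos
  rw [P.integral_jPoly_mul_eq m _ (natDegree_jPoly_le _ _ _ _ _), P.integral_jPoly_mul_self,
    coeff_jPoly, jCoeff, qPoch_inv_pow_self P.hq]
  have hM := jMass_eq P.hq P.ha P.hc P.one_aq P.one_cq P.bc_aq P.bc_cq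
  have hF := weightFactor_mul a b q m
  have hF0 := (P.weightFactor_pos m).ne'
  rw [show a * c * 1 * (b / c) * q ^ 2 = a * b * q ^ 2 by field_simp, mul_one, mul_one,
    show a * (b / c) * q = a * b * q / c by ring, show c * (b / c) * q = b * q by field_simp] at hM
  have hθ : qTheta (c / a) q ≠ 0 := by
    have n1 : c / a < 0 := div_neg_of_neg_of_pos P.hc P.ha
    have n2 : q / (c / a) < 0 := div_neg_of_pos_of_neg P.hq.1 n1
    exact mul_ne_zero (qPochInf_pos P.hq (n1.trans one_pos)).ne'
      (qPochInf_pos P.hq (n2.trans one_pos)).ne'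
  have z1 := (qPochInf_pos P.hq P.haq).ne'
  have z2 := (qPochInf_pos P.hq hcq).ne'
  have z3 := (qPochInf_pos P.hq habc).ne'
  have z4 := (qPochInf_pos P.hq P.hbq).ne'
  have z5 := (qPochInf_pos P.hq P.abqq).ne'
  have z6 := (qPochInf_pos P.hq P.hq.2).ne'
  have y1 := qPoch_ne_zero P.hq P.haq m
  have y2 := qPoch_ne_zero P.hq hcq m
  have y3 := qPoch_ne_zero P.hq habc m
  have y4 := qPoch_ne_zero P.hq P.hbq m
  have y5 := qPoch_ne_zero P.hq P.abqq m
  have y6 := qPoch_ne_zero P.hq P.hq.2 m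
  have y7 := qPoch_ne_zero P.hq (P.abq_pow m) m
  have hM' : jMass a c 1 (b / c) q = a * q * qPochInf q q * qTheta (c / a) q *
      qPochInf (a * b * q ^ 2) q / (qPochInf (a * q) q * qPochInf (c * q) q *
        (qPochInf (a * b * q / c) q * qPochInf (b * q) q)) := by
    rw [← hM, mul_div_cancel_left₀ _ (by positivity)]
  have hF' : qPoch (a * b * q ^ (m + 1)) q m = qPoch (a * b * q ^ 2) q m *
      qPoch (a * b * q ^ (m + 2)) q m / weightFactor m a b q := by
    rw [← hF, mul_div_cancel_right₀ _ hF0]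
  -- All signs and powers of q are collected here: those of the leading coefficients and the factor
  -- (abq^{m+1})^m. The exponents match through 2·(m choose 2) + 2m = m(m+1).
  have hpow : (-1 : ℝ) ^ m * (q ^ ((m + 1).choose 2))⁻¹ * q ^ m * ((-1) ^ m * q ^ (m.choose 2)) *
      (a * b * q ^ (m + 1)) ^ m / ((-(b / c)) ^ m * q ^ (m.choose 2)) =
      (-(a * c * q ^ 2)) ^ m * q ^ (m.choose 2) := by
    have h3 : (a * b * q ^ (m + 1)) ^ m = (-(b / c)) ^ m * (-(a * c * q ^ 2)) ^ m *
        (q ^ (m.choose 2) * q ^ (m.choose 2)) := by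
      have h6 : 2 * m.choose 2 + 2 * m = (m + 1) * m := by
        rw [Nat.choose_two_right]
        have h8 := Nat.div_mul_cancel (Nat.even_mul_pred_self m).two_dvd
        rcases m with _ | m
        · rfl
        · simp only [Nat.add_sub_cancel] at h8 ⊢
          linarith
      have h9 : q ^ ((m + 1) * m) = (q ^ 2) ^ m * (q ^ (m.choose 2) * q ^ (m.choose 2)) := by
        rw [← h6, ← pow_mul]
        ring
      rw [mul_pow (a * b), ← pow_mul, h9, ← mul_pow, ← mul_assoc, ← mul_pow]
      rw [← mul_pow (-(b / c)), neg_mul_neg]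
      congr 2
      field_simp
    have h4 : (-(b / c)) ^ m ≠ 0 := pow_ne_zero _ (neg_ne_zero.2 (div_ne_zero hb hc))
    have h5 : (-1 : ℝ) ^ m * (-1) ^ m = 1 := by rw [← mul_pow]; simp
    rw [h3, Nat.choose_succ_succ' m 1, Nat.choose_one_right, pow_add]
    generalize (-(b / c)) ^ m = B at *
    generalize (-(a * c * q ^ 2)) ^ m = Z
    field_simp
    linear_combination Z * h5
  have hZ : (-(a * c * q ^ 2)) ^ m ≠ 0 :=
    pow_ne_zero _ (neg_ne_zero.2 (mul_ne_zero (mul_ne_zero ha hc) (pow_ne_zero _ h0)))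
  have hT : q ^ (m.choose 2) ≠ 0 := pow_ne_zero _ h0
  have hB : (-(b / c)) ^ m ≠ 0 := pow_ne_zero _ (neg_ne_zero.2 (div_ne_zero hb hc))
  have hone : (-(a * c * q ^ 2)) ^ m * q ^ (m.choose 2) * ((-(a * c * q ^ 2)) ^ m)⁻¹ *
      (q ^ (m.choose 2))⁻¹ = 1 := by
    field_simp
  rw [← hpow] at hone
  refine Eq.trans ?_ hone
  rw [hM', hF', weightV]
  -- What remains is an identity of rational functions in the symbols, which may be treated as
  -- independent variables with the nonvanishing facts above.
  clear hpow hone hM' hF' hM hF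
  generalize qPoch (a * b * q ^ 2) q m = X1 at *
  generalize qPoch (a * b * q ^ (m + 2)) q m = X2 at *
  generalize qPoch (a * b * q / c) q m = X3 at *
  generalize qPoch (a * q) q m = X4 at *
  generalize qPoch (b * q) q m = X5 at *
  generalize qPoch (c * q) q m = X6 at *
  generalize qPoch q q m = X7 at *
  generalize qPochInf (a * b * q ^ 2) q = Y1 at *
  generalize qPochInf (a * b * q / c) q = Y2 at *
  generalize qPochInf (a * q) q = Y3 at *
  generalize qPochInf (b * q) q = Y4 at *
  generalize qPochInf (c * q) q = Y5 at *
  generalize qPochInf q q = Y6 at *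
  generalize qTheta (c / a) q = Y7 at *
  generalize weightFactor m a b q = Y8 at *
  generalize (-(b / c)) ^ m = B at *
  generalize (-(a * c * q ^ 2)) ^ m = Z at *
  generalize (a * b * q ^ (m + 1)) ^ m = W at *
  generalize q ^ (m.choose 2) = T at *
  generalize (q ^ ((m + 1).choose 2))⁻¹ = S at *
  generalize (-1 : ℝ) ^ m = s at *
  generalize q ^ m = r at *
  field_simp

end IsJacobiParam

/-! ### Orthonormality and completeness of the normalized big `q`-Jacobi polynomials -/

theorem jPoint_injective {a c q : ℝ} (hq : q ∈ Set.Ioo (0 : ℝ) 1) (ha : 0 < a) (hc : c < 0) :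
    Function.Injective (jPoint a c q) := by
  have haq : 0 < a * q := mul_pos ha hq.1
  have hcq : c * q < 0 := mul_neg_of_neg_of_pos hc hq.1
  have hinj := pow_right_injective₀ hq.1 hq.2.ne
  rintro (m | m) (n | n) h <;> simp only [jPoint, Sum.elim_inl, Sum.elim_inr] at h
  · rw [hinj (mul_left_cancel₀ haq.ne' h)]
  · have h1 := mul_pos haq (pow_pos hq.1 m)
    have h2 := mul_neg_of_neg_of_pos hcq (pow_pos hq.1 n)
    linarith
  · have h1 := mul_pos haq (pow_pos hq.1 n)
    have h2 := mul_neg_of_neg_of_pos hcq (pow_pos hq.1 m)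
    linarith
  · rw [hinj (mul_left_cancel₀ hcq.ne h)]

theorem weightU_eq_jWeight (x a b c q : ℝ) : weightU x a b c q = jWeight a c 1 (b / c) q x := by
  rw [weightU, jWeight, one_mul, div_mul_eq_mul_div]

theorem jPoint_ne_zero {a c q : ℝ} (hq : q ∈ Set.Ioo (0 : ℝ) 1) (ha : 0 < a) (hc : c < 0)
    (i : ℕ ⊕ ℕ) : jPoint a c q i ≠ 0 := by
  have := hq.1.ne'
  have := ha.ne'
  have := hc.ne
  rcases i with n | n <;> simp only [jPoint, Sum.elim_inl, Sum.elim_inr] <;> positivity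

namespace IsJacobiParam

variable {a b c q : ℝ} (P : IsJacobiParam a b c q)
include P

theorem mass_pos (i : ℕ ⊕ ℕ) :
    0 < |jPoint a c q i| * weightU (jPoint a c q i) a b c q := by
  rw [weightU_eq_jWeight]
  exact mul_pos (abs_pos.2 (jPoint_ne_zero P.hq P.ha P.hc i)) (P.weight_pos i)

/-- The sign comes from the norm: v(m) times the integral of P_m² is 1, and that integral is
nonnegative. No inspection of the factors of v is needed. -/
theorem weightV_pos (m : ℕ) : 0 < weightV m a b c q := by
  have h1 := P.weightV_mul_integral m
  have h2 : 0 ≤ P.integral (jPoly a b c q m * jPoly a b c q m) :=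
    tsum_nonneg fun i => mul_nonneg (abs_nonneg _) (mul_nonneg (P.weight_pos i).le (by
      rw [Polynomial.eval_mul]; exact mul_self_nonneg _))
  by_contra h
  nlinarith

theorem normBigQJacobi_eq (i : ℕ ⊕ ℕ) (m : ℕ) :
    normBigQJacobi (jPoint a c q i) m a b c q =
      √(|jPoint a c q i| * weightU (jPoint a c q i) a b c q) * √(weightV m a b c q) *
        bigQJacobi m (jPoint a c q i) a b c q := by
  rw [normBigQJacobi, Real.sqrt_mul (P.mass_pos i).le]

theorem hasSum_normBigQJacobi_mul (m n : ℕ) :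
    HasSum (fun i => normBigQJacobi (jPoint a c q i) m a b c q *
      normBigQJacobi (jPoint a c q i) n a b c q) (if m = n then 1 else 0) := by
  have h := ((P.summable_eval (jPoly a b c q m * jPoly a b c q n)).hasSum).mul_left
    (√(weightV m a b c q) * √(weightV n a b c q))
  have e : ∑' i, |jPoint a c q i| * (jWeight a c 1 (b / c) q (jPoint a c q i) *
      (jPoly a b c q m * jPoly a b c q n).eval (jPoint a c q i)) =
      P.integral (jPoly a b c q m * jPoly a b c q n) := rfl
  have e2 : √(weightV m a b c q) * √(weightV n a b c q) *
      P.integral (jPoly a b c q m * jPoly a b c q n) = if m = n then 1 else 0 := by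
    rcases lt_trichotomy m n with hmn | rfl | hmn
    · rw [mul_comm (jPoly _ _ _ _ _), P.integral_jPoly_mul_jPoly_of_lt hmn, mul_zero,
        if_neg hmn.ne]
    · rw [Real.mul_self_sqrt (P.weightV_pos m).le, P.weightV_mul_integral, if_pos rfl]
    · rw [P.integral_jPoly_mul_jPoly_of_lt hmn, mul_zero, if_neg hmn.ne']
  rw [e, e2] at h
  refine h.congr_fun fun i => ?_
  rw [P.normBigQJacobi_eq, P.normBigQJacobi_eq, Polynomial.eval_mul, eval_jPoly P.hq,
    eval_jPoly P.hq, ← weightU_eq_jWeight]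
  have h1 := Real.mul_self_sqrt (P.mass_pos i).le
  linear_combination (√(weightV m a b c q) * √(weightV n a b c q) *
    bigQJacobi m (jPoint a c q i) a b c q * bigQJacobi n (jPoint a c q i) a b c q) * h1

/-- The polynomial p(x) = 1 - (x - x_i)²/M² equals 1 at x_i and lies in [0,1) at every other support
point. Its powers converge pointwise to the indicator of x_i, and dominated convergence isolates h_i
from the vanishing moments. -/
theorem eq_zero_of_moments {h : ℕ ⊕ ℕ → ℂ} (hs : Summable fun i => ‖h i‖)
    (hm : ∀ f : Polynomial ℝ, ∑' i, ((f.eval (jPoint a c q i) : ℝ) : ℂ) * h i = 0) (i : ℕ ⊕ ℕ) :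
    h i = 0 := by
  have haq : 0 < a * q := mul_pos P.ha P.hq.1
  -- The length of an interval containing the support, so that |x_j - x_i| ≤ M.
  set M := a * q - c * q with hM
  have hM0 : 0 < M := by linarith [P.cq_neg]
  set p : Polynomial ℝ := 1 - Polynomial.C ((M ^ 2)⁻¹) *
    (Polynomial.X - Polynomial.C (jPoint a c q i)) ^ 2 with hp
  have hev : ∀ j, p.eval (jPoint a c q j) =
      1 - (M ^ 2)⁻¹ * (jPoint a c q j - jPoint a c q i) ^ 2 := fun j => by simp [hp]
  have h01 : ∀ j, p.eval (jPoint a c q j) ∈ Set.Icc (0 : ℝ) 1 := fun j => by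
    have h1 := jPoint_mem P.hq P.ha P.hc j
    have h2 := jPoint_mem P.hq P.ha P.hc i
    rw [hev]
    refine ⟨sub_nonneg.2 ?_, sub_le_self _ (by positivity)⟩
    rw [inv_mul_le_iff₀ (by positivity), mul_one]
    exact sq_le_sq' (by linarith [h1.1, h2.2]) (by linarith [h1.2, h2.1])
  have t := tendsto_tsum_of_dominated_convergence (𝓕 := Filter.atTop)
    (f := fun (n : ℕ) j => (((p ^ n).eval (jPoint a c q j) : ℝ) : ℂ) * h j)
    (g := fun j => if j = i then h i else 0) hs (fun j => ?_)
    (Filter.Eventually.of_forall fun n j => ?_)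
  · simp only [hm, tsum_ite_eq] at t
    exact (tendsto_nhds_unique t tendsto_const_nhds)
  · simp only [Polynomial.eval_pow, Complex.ofReal_pow]
    by_cases hj : j = i
    · subst hj
      rw [hev]
      simp
    · rw [if_neg hj]
      have h1 : p.eval (jPoint a c q j) < 1 := by
        rw [hev]
        have h2 := sub_ne_zero.2 ((jPoint_injective P.hq P.ha P.hc).ne hj)
        have h3 : 0 < (M ^ 2)⁻¹ * (jPoint a c q j - jPoint a c q i) ^ 2 := by positivity
        linarith
      have h2 := (tendsto_pow_atTop_nhds_zero_of_lt_one (h01 j).1 h1)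
      have h3 := (Complex.continuous_ofReal.tendsto 0).comp h2
      have h4 := h3.mul_const (h j)
      rw [Complex.ofReal_zero, zero_mul] at h4
      exact h4.congr fun n => by simp
  · rw [norm_mul, Complex.norm_real, Polynomial.eval_pow, norm_pow, Real.norm_eq_abs,
      abs_of_nonneg (h01 j).1]
    exact mul_le_of_le_one_left (norm_nonneg _) (pow_le_one₀ (h01 j).1 (h01 j).2)

theorem summable_mass : Summable fun i =>
    |jPoint a c q i| * weightU (jPoint a c q i) a b c q := by
  simpa only [weightU_eq_jWeight] using
    summable_jMass P.hq P.ha P.hc P.one_aq P.one_cq P.bc_aq P.bc_cq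

/-- Multiplying g by the square root of the mass gives a summable family whose integrals against all
P_m vanish. As P_m has degree exactly m, all polynomial moments vanish, and `eq_zero_of_moments`
applies. -/
theorem eq_zero_of_orthogonal {g : ℕ ⊕ ℕ → ℂ} (hg : Summable fun i => ‖g i‖ ^ 2)
    (hm : ∀ m, ∑' i, (normBigQJacobi (jPoint a c q i) m a b c q : ℂ) * g i = 0) (i : ℕ ⊕ ℕ) :
    g i = 0 := by
  set s : ℕ ⊕ ℕ → ℝ := fun i => √(|jPoint a c q i| * weightU (jPoint a c q i) a b c q) with hs
  -- The product of two square-summable families is summable, since |s g| ≤ s² + |g|².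
  have hsum : Summable fun i => ‖(s i : ℂ) * g i‖ := by
    refine (P.summable_mass.add hg).of_norm_bounded fun i => ?_
    have h1 := Real.sq_sqrt (P.mass_pos i).le
    rw [norm_norm, norm_mul, Complex.norm_real, Real.norm_eq_abs, ← h1, ← sq_abs (√_)]
    nlinarith [sq_nonneg (|s i| - ‖g i‖), abs_nonneg (s i), norm_nonneg (g i)]
  have hsumf : ∀ f : Polynomial ℝ,
      Summable fun i => ((f.eval (jPoint a c q i) : ℝ) : ℂ) * ((s i : ℂ) * g i) := fun f => by
    obtain ⟨B, hB⟩ := P.exists_eval_bound f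
    refine (hsum.mul_left B).of_norm_bounded fun i => ?_
    rw [norm_mul, Complex.norm_real]
    exact mul_le_mul_of_nonneg_right (hB i) (norm_nonneg _)
  let Λ : Polynomial ℝ →ₗ[ℝ] ℂ :=
    { toFun := fun f => ∑' i, ((f.eval (jPoint a c q i) : ℝ) : ℂ) * ((s i : ℂ) * g i)
      map_add' := fun f f' => by
        rw [← (hsumf f).tsum_add (hsumf f')]
        exact tsum_congr fun i => by rw [Polynomial.eval_add]; push_cast; ring
      map_smul' := fun r f => by
        rw [RingHom.id_apply, Complex.real_smul, ← tsum_mul_left]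
        exact tsum_congr fun i => by rw [Polynomial.eval_smul, smul_eq_mul]; push_cast; ring }
  have hΛ : ∀ m, Λ (jPoly a b c q m) = 0 := fun m => by
    have h1 := hm m
    have h2 : (√(weightV m a b c q) : ℂ) ≠ 0 :=
      Complex.ofReal_ne_zero.2 (Real.sqrt_pos.2 (P.weightV_pos m)).ne'
    refine mul_left_cancel₀ h2 ?_
    rw [mul_zero, ← h1]
    change _ * (∑' i, _) = _
    rw [← tsum_mul_left]
    refine tsum_congr fun i => ?_
    rw [eval_jPoly P.hq, P.normBigQJacobi_eq]
    push_cast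
    ring
  have hne : ∀ j, (jPoly a b c q j).coeff j ≠ 0 := fun j => by
    rw [coeff_jPoly]
    exact mul_ne_zero (P.jCoeff_self_ne_zero j) (mul_ne_zero (pow_ne_zero _ (by norm_num))
      (pow_ne_zero _ P.q_ne))
  have h0 := P.eq_zero_of_moments hsum (fun f => eq_zero_of_forall_degree _
    (natDegree_jPoly_le a b c q) hne Λ f.natDegree (fun j _ => hΛ j) f le_rfl) i
  refine (mul_eq_zero.1 h0).resolve_left (Complex.ofReal_ne_zero.2 ?_)
  exact (Real.sqrt_pos.2 (P.mass_pos i)).ne'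

end IsJacobiParam

/-! ### Contiguous relations -/

theorem qPoch_div_mul (y q : ℝ) (hq : q ≠ 0) (k : ℕ) :
    qPoch (y / q) q (k + 1) = (1 - y / q) * qPoch y q k := by
  rw [qPoch_succ', div_mul_cancel₀ _ hq]

/-- True term by term in (x;q)_k: since (1 - x)(qx;q)_k = (x;q)_k (1 - xq^k), the left side gets the
factor -(x/c)(1 - cq^k), and (1 - cq^k)/(cq;q)_k = (1 - c)/(c;q)_k turns the coefficient into that
for c/q. -/
theorem bigQJacobi_down {a b c q : ℝ} (P : IsJacobiParam a b c q) (m : ℕ) (x : ℝ) :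
    (1 - x / c) * bigQJacobi m x a b c q - (1 - x) * bigQJacobi m (q * x) a b c q =
      x * (1 - 1 / c) * bigQJacobi m x a b (c / q) q := by
  have h0 := P.q_ne
  have hc := P.hc.ne
  simp only [bigQJacobi_eq_sum P.hq _ _ _ _ m.lt_succ_self, Finset.mul_sum,
    ← Finset.sum_sub_distrib]
  refine Finset.sum_congr rfl fun k _ => ?_
  have e1 : (1 - x) * qPoch (q * x) q k = qPoch x q k * (1 - x * q ^ k) := by
    rw [← qPoch_succ, qPoch_succ', mul_comm q]
  have e2 : qPoch c q k * (1 - c * q ^ k) = (1 - c) * qPoch (c * q) q k := by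
    rw [← qPoch_succ, qPoch_succ']
  have hc1 : c < 1 := P.hc.trans one_pos
  have n1 := qPoch_ne_zero P.hq hc1 k
  have n2 := qPoch_ne_zero P.hq (P.cq_neg.trans one_pos) k
  have n3 : 1 - c ≠ 0 := by linarith
  have n4 := qPoch_ne_zero P.hq P.haq k
  have n5 := qPoch_ne_zero P.hq P.hq.2 k
  rw [show (1 - x) * (jCoeff m a b c q k * qPoch (q * x) q k) =
    jCoeff m a b c q k * (qPoch x q k * (1 - x * q ^ k)) by rw [← e1]; ring]
  simp only [jCoeff]
  rw [div_mul_cancel₀ _ h0, show qPoch (c * q) q k = qPoch c q k * (1 - c * q ^ k) / (1 - c) by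
    rw [e2]; field_simp]
  have n6 : 1 - c * q ^ k ≠ 0 := by
    intro h
    rw [h, mul_zero] at e2
    exact mul_ne_zero n3 n2 e2.symm
  generalize qPoch (q ^ m)⁻¹ q k = X1
  generalize qPoch (a * b * q ^ (m + 1)) q k = X2
  generalize qPoch (a * q) q k = X3 at *
  generalize qPoch q q k = X4 at *
  generalize qPoch c q k = X5 at *
  generalize qPoch x q k = X6
  clear e1 e2 n2
  field_simp
  ring

/-- Coefficients of the telescoping decomposition used for `bigQJacobi_up`. -/
theorem qPoch_up_decomposition {a b c q : ℝ} (ha : a ≠ 0) (hq : q ≠ 0) (hc : c ≠ 0) (x : ℝ)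
    (k : ℕ) :
    (1 - b * x / c) * qPoch x q (k + 1) - (1 - x / (a * q)) * qPoch (x / q) q (k + 1) =
      x * ((1 - q ^ (k + 1)) / q * (1 - (q ^ (k + 1))⁻¹ / a) * qPoch x q k +
        ((q ^ (k + 2))⁻¹ / a - b / c) * qPoch x q (k + 1)) := by
  have hk := pow_ne_zero k hq
  rw [qPoch_div_mul _ _ hq, qPoch_succ]
  generalize qPoch x q k = X
  rw [pow_succ q k, show q ^ (k + 2) = q ^ k * q * q by ring]
  generalize q ^ k = t at *
  field_simp
  ring

/-- Here each term on the left spreads over (x;q)_k and (x;q)_{k+1} by `qPoch_up_decomposition`.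
After an index shift, two neighbouring coefficients at c/q must combine to one coefficient at c, and
the product in m on the right is what this combination produces. -/
theorem bigQJacobi_up {a b c q : ℝ} (P : IsJacobiParam a b c q) (m : ℕ) (x : ℝ) :
    a * q * (c - 1) * ((1 - b * x / c) * bigQJacobi m x a b (c / q) q -
      (1 - x / (a * q)) * bigQJacobi m (x / q) a b (c / q) q) =
      c * x * ((1 - a * b * q ^ (m + 1) / c) * (1 - (q ^ m)⁻¹ / c)) * bigQJacobi m x a b c q := by
  have h0 := P.q_ne
  have hc := P.hc.ne
  have ha := P.ha.ne'
  have hc1 : c < 1 := P.hc.trans one_pos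
  rw [bigQJacobi_eq_sum P.hq a b c x m.lt_succ_self,
    bigQJacobi_eq_sum P.hq a b (c / q) x (m.lt_succ_self.trans (m + 1).lt_succ_self),
    bigQJacobi_eq_sum P.hq a b (c / q) (x / q) (m.lt_succ_self.trans (m + 1).lt_succ_self)]
  -- The sums run one step too far on purpose: the extra coefficient is zero, so the index shift
  -- leaves no boundary term at the top.
  have hA : jCoeff m a b (c / q) q (m + 1) = 0 := jCoeff_eq_zero P.hq _ _ _ m.lt_succ_self
  have hsplit : (1 - b * x / c) * ∑ k ∈ Finset.range (m + 1).succ,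
        jCoeff m a b (c / q) q k * qPoch x q k -
      (1 - x / (a * q)) * ∑ k ∈ Finset.range (m + 1).succ,
        jCoeff m a b (c / q) q k * qPoch (x / q) q k =
      x * ∑ k ∈ Finset.range (m + 1), (jCoeff m a b (c / q) q (k + 1) *
        ((1 - q ^ (k + 1)) / q * (1 - (q ^ (k + 1))⁻¹ / a)) +
        jCoeff m a b (c / q) q k * ((q ^ (k + 1))⁻¹ / a - b / c)) * qPoch x q k := by
    simp only [add_mul, Finset.sum_add_distrib]
    rw [Finset.sum_range_succ' (fun k => jCoeff m a b (c / q) q k * _ * _), Finset.sum_range_succ'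
      (fun k => jCoeff m a b (c / q) q k * qPoch x q k), Finset.sum_range_succ'
      (fun k => jCoeff m a b (c / q) q k * qPoch (x / q) q k), Finset.sum_range_succ (fun k =>
      jCoeff m a b (c / q) q (k + 1) * qPoch x q (k + 1)), Finset.sum_range_succ (fun k =>
      jCoeff m a b (c / q) q (k + 1) * qPoch (x / q) q (k + 1)), Finset.sum_range_succ (fun k =>
      jCoeff m a b (c / q) q (k + 1) * _ * _), hA]
    have h := Finset.sum_congr rfl fun k (_ : k ∈ Finset.range m) =>
      congrArg (jCoeff m a b (c / q) q (k + 1) * ·) (qPoch_up_decomposition (b := b) ha h0 hc x k)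
    simp only [mul_sub, mul_add, Finset.sum_sub_distrib, Finset.sum_add_distrib] at h
    simp only [qPoch_zero, zero_mul, mul_one, zero_add, pow_one, add_zero, mul_add,
      Finset.mul_sum]
    have h' : ∑ k ∈ Finset.range m, (1 - b * x / c) * (jCoeff m a b (c / q) q (k + 1) *
          qPoch x q (k + 1)) - ∑ k ∈ Finset.range m, (1 - x / (a * q)) *
          (jCoeff m a b (c / q) q (k + 1) * qPoch (x / q) q (k + 1)) =
        ∑ k ∈ Finset.range m, x * (jCoeff m a b (c / q) q (k + 1) *
          ((1 - q ^ (k + 1)) / q * (1 - (q ^ (k + 1))⁻¹ / a)) * qPoch x q k) +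
        ∑ k ∈ Finset.range m, x * (jCoeff m a b (c / q) q (k + 1) *
          ((q ^ (k + 1 + 1))⁻¹ / a - b / c) * qPoch x q (k + 1)) := by
      rw [← Finset.sum_sub_distrib, ← Finset.sum_add_distrib]
      refine Finset.sum_congr rfl fun k _ => ?_
      linear_combination jCoeff m a b (c / q) q (k + 1) *
        qPoch_up_decomposition (b := b) ha h0 hc x k
    have h3 : x * (q⁻¹ / a) = x / (a * q) := by field_simp
    linear_combination h' - jCoeff m a b (c / q) q 0 * h3
  rw [hsplit, Finset.mul_sum, Finset.mul_sum, Finset.mul_sum]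
  refine Finset.sum_congr rfl fun k _ => ?_
  have e2 : qPoch c q k * (1 - c * q ^ k) = (1 - c) * qPoch (c * q) q k := by
    rw [← qPoch_succ, qPoch_succ']
  have n1 := qPoch_ne_zero P.hq hc1 k
  have n2 := qPoch_ne_zero P.hq (P.cq_neg.trans one_pos) k
  have n3 : 1 - c ≠ 0 := by linarith
  have n4 := qPoch_ne_zero P.hq P.haq k
  have n5 := qPoch_ne_zero P.hq P.hq.2 k
  have n6 : 1 - c * q ^ k ≠ 0 := by
    intro h
    rw [h, mul_zero] at e2
    exact mul_ne_zero n3 n2 e2.symm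
  have n7 : 1 - a * q * q ^ k ≠ 0 := by
    have := qPoch_ne_zero P.hq P.haq (k + 1)
    rw [qPoch_succ] at this
    exact right_ne_zero_of_mul this
  have n8 : 1 - q * q ^ k ≠ 0 := by
    have := qPoch_ne_zero P.hq P.hq.2 (k + 1)
    rw [qPoch_succ] at this
    exact right_ne_zero_of_mul this
  have hk := pow_ne_zero k h0
  have hm := pow_ne_zero m h0
  simp only [jCoeff]
  rw [div_mul_cancel₀ _ h0, show qPoch (c * q) q k = qPoch c q k * (1 - c * q ^ k) / (1 - c) by
    rw [e2]; field_simp]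
  rw [qPoch_succ (q ^ m)⁻¹, qPoch_succ (a * b * q ^ (m + 1)), qPoch_succ q, qPoch_succ (a * q),
    qPoch_succ c]
  rw [pow_succ q m, pow_succ q k]
  have hx1 : qPoch (a * b * (q ^ m * q)) q k = qPoch (a * b * (q ^ m * q)) q k := rfl
  generalize qPoch (q ^ m)⁻¹ q k = X1
  generalize qPoch (a * b * (q ^ m * q)) q k = X2
  generalize qPoch (a * q) q k = X3 at *
  generalize qPoch q q k = X4 at *
  generalize qPoch c q k = X5 at *
  generalize qPoch x q k = X6
  clear e2 n2 hA hsplit hx1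
  generalize q ^ k = t at *
  generalize q ^ m = s at *
  field_simp
  ring

/-! ### Contiguous relations for the normalized polynomials -/

namespace IsJacobiParam

variable {a b c q : ℝ} (P : IsJacobiParam a b c q)
include P

theorem div_q : IsJacobiParam a b (c / q) q :=
  ⟨P.hq, P.ha, P.haq, P.hb, P.hbq, div_neg_of_neg_of_pos P.hc P.hq.1⟩

theorem mem_Icc_div {x : ℝ} (hx : x ∈ Set.Icc (c * q) (a * q)) :
    x ∈ Set.Icc (c / q * q) (a * q) := by
  refine ⟨?_, hx.2⟩
  rw [div_mul_cancel₀ _ P.q_ne]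
  have := P.hc
  have := P.hq.2
  nlinarith [hx.1]

theorem one_sub_pos {x : ℝ} (hx : x ∈ Set.Icc (c * q) (a * q)) :
    0 < 1 - x ∧ 0 < 1 - x / a ∧ 0 < 1 - x / c ∧ 0 < 1 - b * x / c := by
  obtain ⟨h1, h2⟩ := div_mem_of_mem P.ha P.hc hx
  have h3 := mul_lt_one_of_mem P.one_aq P.one_cq hx
  have h4 := mul_lt_one_of_mem P.bc_aq P.bc_cq hx
  have := P.hq.2
  rw [div_mul_eq_mul_div] at h4
  exact ⟨by linarith, by linarith [h1.2], by linarith [h2.2], by linarith⟩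

theorem weightU_div {x : ℝ} (hx : x ∈ Set.Icc (c * q) (a * q)) :
    weightU x a b (c / q) q * (1 - x / c) = weightU x a b c q * (1 - b * x / c) := by
  have h0 := P.q_ne
  have hc := P.hc.ne
  obtain ⟨h1, h2, h3, h4⟩ := P.one_sub_pos hx
  have h5 : b * x / c * q < 1 := by
    have := (P.div_q.one_sub_pos (P.mem_Icc_div hx)).2.2.2
    rw [show b * x / (c / q) = b * x / c * q by field_simp] at this
    linarith
  rw [weightU, weightU, qPochInf_step P.hq (x / c), qPochInf_step P.hq (b * x / c),
    show x / (c / q) = x / c * q by field_simp, show b * x / (c / q) = b * x / c * q by field_simp]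
  have n1 := (qPochInf_pos P.hq h5).ne'
  have n2 := (qPochInf_pos P.hq (sub_pos.1 h1)).ne'
  generalize b * x / c = z at *
  generalize x / c = y at *
  field_simp

/-- With y = xq^{-1} and c divided by q at the same time, x/c and bx/c do not change. Only the
factors (x/a;q)_∞ and (x;q)_∞ move, each by one step. -/
theorem weightU_mul {y : ℝ} (hy : y ∈ Set.Icc c (a * q)) :
    weightU (y * q) a b c q * (1 - y / a) = weightU y a b (c / q) q * (1 - y) := by
  have h0 := P.q_ne
  have hc := P.hc.ne
  have hy' : y ∈ Set.Icc (c / q * q) (a * q) := by rwa [div_mul_cancel₀ _ h0]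
  obtain ⟨h1, h2, h3, h4⟩ := P.div_q.one_sub_pos hy'
  have h5 : y * q < 1 := by
    have := P.hq.1
    have := P.hq.2
    rcases le_total y 0 with h | h <;> nlinarith
  rw [weightU, weightU, qPochInf_step P.hq y, qPochInf_step P.hq (y / a),
    show y * q / a = y / a * q by ring, show y / (c / q) = y * q / c by field_simp,
    show b * y / (c / q) = b * (y * q) / c by field_simp]
  have n1 := (qPochInf_pos P.hq h5).ne'
  rw [show b * y / (c / q) = b * (y * q) / c by field_simp] at h4
  have n2 := (qPochInf_pos P.hq (sub_pos.1 h4)).ne'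
  generalize b * (y * q) / c = z at *
  generalize y * q / c = w at *
  generalize y / a = u at *
  field_simp

theorem weightU_pos {x : ℝ} (hx : x ∈ Set.Icc (c * q) (a * q)) : 0 < weightU x a b c q := by
  rw [weightU_eq_jWeight]
  exact jWeight_pos P.hq P.ha P.hc P.one_aq P.one_cq P.bc_aq P.bc_cq hx

theorem eigenvalue_factors_pos (m : ℕ) :
    0 < 1 - a * b * q ^ (m + 1) / c ∧ 0 < 1 - (q ^ m)⁻¹ / c := by
  have h1 : a * b * q ^ (m + 1) / c < 0 :=
    div_neg_of_pos_of_neg (mul_pos (mul_pos P.ha P.hb) (pow_pos P.hq.1 _)) P.hc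
  have h2 : (q ^ m)⁻¹ / c < 0 := div_neg_of_pos_of_neg (inv_pos.2 (pow_pos P.hq.1 _)) P.hc
  exact ⟨by linarith, by linarith⟩

/-- Every factor of v that contains c moves by one step, and the theta quotient θ(c/(aq))/θ(c/a) is
-c/(aq). The product on the left is the one in `bigQJacobi_up`; its square root becomes the
coefficient of `E` in the m-th strange representation. -/
theorem weightV_div (m : ℕ) :
    weightV m a b (c / q) q * ((1 - a * b * q ^ (m + 1) / c) * (1 - (q ^ m)⁻¹ / c)) =
      ((c - 1) / c) ^ 2 * (a * q) * weightV m a b c q := by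
  have h0 := P.q_ne
  have ha := P.ha.ne'
  have hc := P.hc.ne
  have hc1 : c < 1 := P.hc.trans one_pos
  have habc : a * b * q / c < 1 := by
    have := P.bc_aq
    rwa [show b / c * (a * q) = a * b * q / c by ring] at this
  have habc' : a * b * q / c * q < 1 := by
    have := P.div_q.bc_aq
    rwa [show b / (c / q) * (a * q) = a * b * q / c * q by field_simp] at this
  have g1 : qPoch c q m * (1 - c * q ^ m) = (1 - c) * qPoch (c * q) q m := by
    rw [← qPoch_succ, qPoch_succ']
  have g2 : qPoch (a * b * q / c) q m * (1 - a * b * q / c * q ^ m) =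
      (1 - a * b * q / c) * qPoch (a * b * q / c * q) q m := by
    rw [← qPoch_succ, qPoch_succ']
  have n1 : c / a < 0 := div_neg_of_neg_of_pos P.hc P.ha
  have n2 : a * q / c < 0 := div_neg_of_pos_of_neg (mul_pos P.ha P.hq.1) P.hc
  have n3 : c / (a * q) < 0 := div_neg_of_neg_of_pos P.hc (mul_pos P.ha P.hq.1)
  have n4 : a * q / c * q < 0 := mul_neg_of_neg_of_pos n2 P.hq.1
  have t1 : qTheta (c / q / a) q = (1 - c / (a * q)) * qPochInf (c / a) q *
      qPochInf (a * q / c * q) q := by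
    rw [qTheta, show c / q / a = c / (a * q) by field_simp, qPochInf_step P.hq (c / (a * q)),
      show c / (a * q) * q = c / a by field_simp,
      show q / (c / (a * q)) = a * q / c * q by field_simp]
  have t2 : qTheta (c / a) q = (1 - a * q / c) * qPochInf (c / a) q *
      qPochInf (a * q / c * q) q := by
    rw [qTheta, show q / (c / a) = a * q / c by field_simp, qPochInf_step P.hq (a * q / c)]
    ring
  have z1 := (qPochInf_pos P.hq (n1.trans one_pos)).ne'
  have z2 := (qPochInf_pos P.hq (n4.trans one_pos)).ne'
  have z3 := (qPochInf_pos P.hq habc').ne'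
  have z4 := (qPochInf_pos P.hq (P.cq_neg.trans one_pos)).ne'
  have z5 := (qPochInf_pos P.hq P.abqq).ne'
  have z6 := (qPochInf_pos P.hq P.hq.2).ne'
  have y1 := qPoch_ne_zero P.hq hc1 m
  have y2 := qPoch_ne_zero P.hq (P.cq_neg.trans one_pos) m
  have y3 := qPoch_ne_zero P.hq habc m
  have y4 := qPoch_ne_zero P.hq habc' m
  have y5 := qPoch_ne_zero P.hq P.hbq m
  have y6 := qPoch_ne_zero P.hq P.hq.2 m
  have u1 : 1 - c ≠ 0 := by linarith
  have u2 : 1 - a * b * q / c ≠ 0 := by linarith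
  have u3 : 1 - c / (a * q) ≠ 0 := by linarith
  have u4 : 1 - a * q / c ≠ 0 := by linarith
  have hm := pow_ne_zero m h0
  have hZ : (-(a * c * q ^ 2)) ^ m = (-(a * (c / q) * q ^ 2)) ^ m * q ^ m := by
    rw [← mul_pow]; congr 1; field_simp
  have hZ0 : (-(a * (c / q) * q ^ 2)) ^ m ≠ 0 := pow_ne_zero _ (neg_ne_zero.2
    (mul_ne_zero (mul_ne_zero ha (div_ne_zero hc h0)) (pow_ne_zero _ h0)))
  have hT : q ^ (m.choose 2) ≠ 0 := pow_ne_zero _ h0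
  have g1' : qPoch (c * q) q m = qPoch c q m * (1 - c * q ^ m) / (1 - c) :=
    eq_div_of_mul_eq u1 (by rw [g1]; ring)
  have g2' : qPoch (a * b * q / c * q) q m = qPoch (a * b * q / c) q m *
      (1 - a * b * q / c * q ^ m) / (1 - a * b * q / c) :=
    eq_div_of_mul_eq u2 (by rw [g2]; ring)
  have v1 : 1 - c * q ^ m ≠ 0 := fun h => by
    rw [h, mul_zero] at g1
    exact mul_ne_zero u1 y2 g1.symm
  have v2 : 1 - a * b * q / c * q ^ m ≠ 0 := fun h => by
    rw [h, mul_zero] at g2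
    exact mul_ne_zero u2 y4 g2.symm
  rw [weightV, weightV, t1, t2, hZ, div_mul_cancel₀ _ h0, qPochInf_step P.hq c,
    show a * b * q / (c / q) = a * b * q / c * q by field_simp,
    qPochInf_step P.hq (a * b * q / c), g1', g2',
    show a * b * q ^ (m + 1) / c = a * b * q / c * q ^ m by ring]
  have f1 : (1 - c / (a * q)) = -(c / (a * q)) * (1 - a * q / c) := by field_simp; ring
  have f2 : 1 - (q ^ m)⁻¹ / c = -(1 - c * q ^ m) / (c * q ^ m) := by field_simp; ring
  rw [f1, f2]
  clear g1 g2 g1' g2' t1 t2 f1 f2 hZ n1 n2 n3 n4 habc habc' u3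
  generalize qPochInf (c / a) q = Y1 at *
  generalize qPochInf (a * q / c * q) q = Y2 at *
  generalize qPochInf (a * b * q / c * q) q = Y3 at *
  generalize qPochInf (c * q) q = Y4 at *
  generalize qPochInf (a * b * q ^ 2) q = Y5 at *
  generalize qPochInf q q = Y6 at *
  generalize qPochInf (a * q) q = Y7 at *
  generalize qPochInf (b * q) q = Y8 at *
  generalize qPoch c q m = X1 at *
  generalize qPoch (c * q) q m = X2 at *
  generalize qPoch (a * b * q / c) q m = X3 at *
  generalize qPoch (a * b * q / c * q) q m = X4 at *
  generalize qPoch (b * q) q m = X5 at *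
  generalize qPoch q q m = X6 at *
  generalize qPoch (a * q) q m = X7 at *
  generalize weightFactor m a b q = W at *
  generalize (-(a * (c / q) * q ^ 2)) ^ m = Z at *
  generalize q ^ (m.choose 2) = T at *
  generalize 1 - a * b * q / c * q ^ m = U1 at *
  generalize 1 - c * q ^ m = U2 at *
  generalize 1 - a * b * q / c = U3 at *
  generalize 1 - a * q / c = U4 at *
  generalize q ^ m = r at *
  rw [show c - 1 = -(1 - c) by ring]
  generalize 1 - c = U5 at *
  field_simp

/-- The square root of the factor appearing in `weightV_div`. -/
theorem sqrt_weightV_div (m : ℕ) :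
    √((1 - a * b * q ^ (m + 1) / c) * (1 - (q ^ m)⁻¹ / c)) * √(weightV m a b (c / q) q) =
      (c - 1) / c * √(a * q) * √(weightV m a b c q) := by
  obtain ⟨h1, h2⟩ := P.eigenvalue_factors_pos m
  have h3 : 0 ≤ (c - 1) / c := div_nonneg_of_nonpos (by linarith [P.hc]) P.hc.le
  rw [← Real.sqrt_mul (mul_pos h1 h2).le, mul_comm, P.weightV_div,
    Real.sqrt_mul (mul_nonneg (sq_nonneg _) (mul_pos P.ha P.hq.1).le),
    Real.sqrt_mul (sq_nonneg _), Real.sqrt_sq h3]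

theorem normBigQJacobi_eq_of_mem {x : ℝ} (hx : x ∈ Set.Icc (c * q) (a * q)) (m : ℕ) :
    normBigQJacobi x m a b c q = √(|x|) * √(weightU x a b c q) * √(weightV m a b c q) *
        bigQJacobi m x a b c q := by
  rw [normBigQJacobi, Real.sqrt_mul (mul_nonneg (abs_nonneg _) (P.weightU_pos hx).le),
    Real.sqrt_mul (abs_nonneg _)]

/-- From w' B = w A with positive factors follow √(AB) √w' = A √w and √(AB) √w = B √w'. The square
roots in the coefficients of the representations thus become the rational factors of the contiguous
relations. -/
theorem sqrt_weightU_div {x : ℝ} (hx : x ∈ Set.Icc (c * q) (a * q)) :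
    √((1 - b * x / c) * (1 - x / c)) * √(weightU x a b (c / q) q) =
        (1 - b * x / c) * √(weightU x a b c q) ∧
      √((1 - b * x / c) * (1 - x / c)) * √(weightU x a b c q) =
        (1 - x / c) * √(weightU x a b (c / q) q) := by
  obtain ⟨h1, h2, h3, h4⟩ := P.one_sub_pos hx
  have h := P.weightU_div hx
  constructor
  · rw [← Real.sqrt_mul (mul_pos h4 h3).le, show (1 - b * x / c) * (1 - x / c) *
      weightU x a b (c / q) q = (1 - b * x / c) ^ 2 * weightU x a b c q by
        linear_combination (1 - b * x / c) * h, Real.sqrt_mul (sq_nonneg _), Real.sqrt_sq h4.le]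
  · rw [← Real.sqrt_mul (mul_pos h4 h3).le, show (1 - b * x / c) * (1 - x / c) *
      weightU x a b c q = (1 - x / c) ^ 2 * weightU x a b (c / q) q by
        linear_combination -(1 - x / c) * h, Real.sqrt_mul (sq_nonneg _), Real.sqrt_sq h3.le]

theorem sqrt_weightU_mul {y : ℝ} (hy : y ∈ Set.Icc c (a * q)) :
    √((1 - y / a) * (1 - y)) * √(weightU y a b (c / q) q) =
        (1 - y / a) * √(weightU (y * q) a b c q) ∧
      √((1 - y / a) * (1 - y)) * √(weightU (y * q) a b c q) =
        (1 - y) * √(weightU y a b (c / q) q) := by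
  have hy' : y ∈ Set.Icc (c / q * q) (a * q) := by rwa [div_mul_cancel₀ _ P.q_ne]
  obtain ⟨h1, h2, h3, h4⟩ := P.div_q.one_sub_pos hy'
  have h := P.weightU_mul hy
  constructor
  · rw [← Real.sqrt_mul (mul_pos h2 h1).le, show (1 - y / a) * (1 - y) *
      weightU y a b (c / q) q = (1 - y / a) ^ 2 * weightU (y * q) a b c q by
        linear_combination -(1 - y / a) * h, Real.sqrt_mul (sq_nonneg _), Real.sqrt_sq h2.le]
  · rw [← Real.sqrt_mul (mul_pos h2 h1).le, show (1 - y / a) * (1 - y) *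
      weightU (y * q) a b c q = (1 - y) ^ 2 * weightU y a b (c / q) q by
        linear_combination (1 - y) * h, Real.sqrt_mul (sq_nonneg _), Real.sqrt_sq h1.le]

theorem mul_q_mem {y : ℝ} (hy : y ∈ Set.Icc c (a * q)) : y * q ∈ Set.Icc (c * q) (a * q) := by
  have h1 := P.hq.1
  have h2 := P.hq.2
  have h3 := mul_pos P.ha h1
  exact ⟨mul_le_mul_of_nonneg_right hy.1 h1.le, by nlinarith [hy.2]⟩

/-- The raising relation, with `x` at level `c` expressed through `x` and `x/q` at level `c/q`. -/
theorem normBigQJacobi_up {x : ℝ} (hx : x ∈ Set.Icc (c * q) (a * q))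
    (hx' : x = a * q ∨ x / q ∈ Set.Icc c (a * q)) (m : ℕ) :
    √((1 - b * x / c) * (1 - x / c)) * normBigQJacobi x m a b (c / q) q -
      √q * √((1 - x / (a * q)) * (1 - x / q)) * normBigQJacobi (x / q) m a b (c / q) q =
      x / √(a * q) * √((1 - a * b * q ^ (m + 1) / c) * (1 - (q ^ m)⁻¹ / c)) *
        normBigQJacobi x m a b c q := by
  have h0 := P.q_ne
  have hc := P.hc.ne
  have hq0 : √q ≠ 0 := (Real.sqrt_pos.2 P.hq.1).ne'
  have haq : √(a * q) ≠ 0 := (Real.sqrt_pos.2 (mul_pos P.ha P.hq.1)).ne'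
  have hc1 : c - 1 ≠ 0 := by linarith [P.hc]
  obtain ⟨h1, h2⟩ := P.eigenvalue_factors_pos m
  have hS : √q * √((1 - x / (a * q)) * (1 - x / q)) * normBigQJacobi (x / q) m a b (c / q) q =
      (1 - x / (a * q)) * (√(|x|) * √(weightU x a b c q) * √(weightV m a b (c / q) q) *
        bigQJacobi m (x / q) a b (c / q) q) := by
    -- At the largest point x = aq the point x/q lies outside the support, but its coefficient
    -- contains 1 - x/(aq) = 0.
    rcases hx' with rfl | hy
    · have := (mul_pos P.ha P.hq.1).ne'
      rw [div_self this]
      simp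
    · have hy' : x / q ∈ Set.Icc (c / q * q) (a * q) := by rwa [div_mul_cancel₀ _ h0]
      have e := (P.sqrt_weightU_mul hy).1
      rw [show x / q / a = x / (a * q) by field_simp, div_mul_cancel₀ _ h0] at e
      rw [P.div_q.normBigQJacobi_eq_of_mem hy', abs_div, abs_of_pos P.hq.1,
        Real.sqrt_div (abs_nonneg x)]
      have e2 : √q * (√(|x|) / √q) = √(|x|) := by field_simp
      linear_combination (√(|x|) / √q * √q * √(weightV m a b (c / q) q) *
        bigQJacobi m (x / q) a b (c / q) q) * e + ((1 - x / (a * q)) * √(weightU x a b c q) *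
        √(weightV m a b (c / q) q) * bigQJacobi m (x / q) a b (c / q) q) * e2
  rw [hS, P.div_q.normBigQJacobi_eq_of_mem (P.mem_Icc_div hx), P.normBigQJacobi_eq_of_mem hx]
  have e1 := (P.sqrt_weightU_div hx).1
  have e3 := P.sqrt_weightV_div m
  have e4 := bigQJacobi_up P m x
  have e5 := Real.mul_self_sqrt (mul_pos P.ha P.hq.1).le
  have e6 := Real.mul_self_sqrt (mul_pos h1 h2).le
  set C := √((1 - a * b * q ^ (m + 1) / c) * (1 - (q ^ m)⁻¹ / c)) with hC
  rw [← e6] at e4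
  -- Eliminating v at level c produces a second factor `C`; together they give the product `C * C`
  -- on the right of `bigQJacobi_up`.
  have e7 : √(weightV m a b c q) = C * √(weightV m a b (c / q) q) * c / ((c - 1) * √(a * q)) := by
    rw [e3]; field_simp
  rw [e7]
  have e8 : (1 - b * x / c) * bigQJacobi m x a b (c / q) q -
      (1 - x / (a * q)) * bigQJacobi m (x / q) a b (c / q) q =
      c * x * (C * C) * bigQJacobi m x a b c q / (√(a * q) * √(a * q) * (c - 1)) := by
    rw [← e4, e5]
    have := mul_ne_zero (mul_pos P.ha P.hq.1).ne' hc1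
    rw [mul_div_cancel_left₀ _ this]
  have e9 : x / √(a * q) * C * (√(|x|) * √(weightU x a b c q) *
      (C * √(weightV m a b (c / q) q) * c / ((c - 1) * √(a * q))) * bigQJacobi m x a b c q) =
      √(|x|) * √(weightU x a b c q) * √(weightV m a b (c / q) q) *
      (c * x * (C * C) * bigQJacobi m x a b c q / (√(a * q) * √(a * q) * (c - 1))) := by
    field_simp
  rw [e9, ← e8]
  linear_combination (√(|x|) * √(weightV m a b (c / q) q) * bigQJacobi m x a b (c / q) q) * e1

/-- The lowering relation, with `y` at level `c/q` expressed through `y` and `yq` at level `c`. -/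
theorem normBigQJacobi_down {y : ℝ} (hy : y ∈ Set.Icc c (a * q))
    (hy' : y = c ∨ y ∈ Set.Icc (c * q) (a * q)) (m : ℕ) :
    √((1 - b * y / c) * (1 - y / c)) * normBigQJacobi y m a b c q -
      (√q)⁻¹ * √((1 - y / a) * (1 - y)) * normBigQJacobi (y * q) m a b c q =
      y / √(a * q) * √((1 - a * b * q ^ (m + 1) / c) * (1 - (q ^ m)⁻¹ / c)) *
        normBigQJacobi y m a b (c / q) q := by
  have h0 := P.q_ne
  have hc := P.hc.ne
  have hq0 : √q ≠ 0 := (Real.sqrt_pos.2 P.hq.1).ne'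
  have haq : √(a * q) ≠ 0 := (Real.sqrt_pos.2 (mul_pos P.ha P.hq.1)).ne'
  have hdq : y ∈ Set.Icc (c / q * q) (a * q) := by rwa [div_mul_cancel₀ _ h0]
  have hS : √((1 - b * y / c) * (1 - y / c)) * normBigQJacobi y m a b c q =
      (1 - y / c) * (√(|y|) * √(weightU y a b (c / q) q) * √(weightV m a b c q) *
        bigQJacobi m y a b c q) := by
    -- The point y = c belongs to the support at level c/q but not at level c; its coefficient
    -- contains 1 - y/c = 0.
    rcases hy' with rfl | hx
    · rw [div_self hc]
      simp
    · have e := (P.sqrt_weightU_div hx).2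
      rw [P.normBigQJacobi_eq_of_mem hx]
      linear_combination (√(|y|) * √(weightV m a b c q) * bigQJacobi m y a b c q) * e
  rw [hS, P.normBigQJacobi_eq_of_mem (P.mul_q_mem hy), P.div_q.normBigQJacobi_eq_of_mem hdq,
    abs_mul, abs_of_pos P.hq.1, Real.sqrt_mul (abs_nonneg y)]
  have e1 := (P.sqrt_weightU_mul hy).2
  have e3 := P.sqrt_weightV_div m
  have e4 := bigQJacobi_down P m y
  rw [mul_comm q y] at e4
  have e5 : (√q)⁻¹ * √q = 1 := inv_mul_cancel₀ hq0
  have e6 : √(a * q) / √(a * q) = 1 := div_self haq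
  have e7 : (c - 1) / c = 1 - 1 / c := by field_simp
  rw [e7] at e3
  linear_combination √(|y|) * √(weightU y a b (c / q) q) * √(weightV m a b c q) * e4 -
    √(|y|) * √(weightV m a b c q) * bigQJacobi m (y * q) a b c q * e1 -
    (√((1 - y / a) * (1 - y)) * (√(|y|) * √(weightU (y * q) a b c q) * √(weightV m a b c q) *
      bigQJacobi m (y * q) a b c q)) * e5 -
    y / √(a * q) * √(|y|) * √(weightU y a b (c / q) q) * bigQJacobi m y a b (c / q) q * e3 -
    y * (1 - 1 / c) * √(weightV m a b c q) * √(|y|) * √(weightU y a b (c / q) q) *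
      bigQJacobi m y a b (c / q) q * e6

end IsJacobiParam

/-! ### Matrix coefficients of the tensor products -/

section Coefficients

variable {q k₁ k₂ ε : ℝ}

theorem isJacobiParam (hq : q ∈ Set.Ioo (0 : ℝ) 1) (h₁ : 0 < k₁) (h₂ : 0 < k₂) (ε p : ℝ) :
    IsJacobiParam (q ^ (4 * k₁ - 2)) (q ^ (4 * k₂ - 2)) (-q ^ (4 * k₁ - 2 * p - 2 * ε - 2))
      (q ^ 2) := by
  have h (k : ℝ) (hk : 0 < k) : q ^ (4 * k - 2) * q ^ 2 < 1 := by
    rw [← Real.rpow_natCast, ← Real.rpow_add hq.1]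
    exact Real.rpow_lt_one hq.1.le hq.2 (by push_cast; linarith)
  exact ⟨⟨pow_pos hq.1 2, pow_lt_one₀ hq.1.le hq.2 two_ne_zero⟩, Real.rpow_pos_of_pos hq.1 _,
    h k₁ h₁, Real.rpow_pos_of_pos hq.1 _, h k₂ h₂, neg_neg_of_pos (Real.rpow_pos_of_pos hq.1 _)⟩

theorem rpow_two_mul_natCast (hq : 0 < q) (n : ℕ) : q ^ (2 * (n : ℝ)) = (q ^ 2) ^ n := by
  rw [Real.rpow_mul hq.le, Real.rpow_natCast, Real.rpow_two]

theorem rpow_sub_two_index (hq : 0 < q) (x : ℝ) : -q ^ (x - 2) = -q ^ x / q ^ 2 := by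
  rw [neg_div, ← Real.rpow_two, ← Real.rpow_sub hq]

/-- One step in p is one step of the contiguous relations: c is divided by the base, which is q²
here. -/
theorem jParam_succ (hq : 0 < q) (p : ℝ) : -q ^ (4 * k₁ - 2 * (p + 1) - 2 * ε - 2) =
    -q ^ (4 * k₁ - 2 * p - 2 * ε - 2) / q ^ 2 := by
  rw [neg_div, ← Real.rpow_two, ← Real.rpow_sub hq]
  ring_nf

theorem jPoint_neg (hq : 0 < q) (c : ℝ) (n : ℕ) :
    jPoint (q ^ (4 * k₁ - 2)) c (q ^ 2) (Sum.inl n) = q ^ (2 * n + 4 * k₁) := by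
  simp only [jPoint, Sum.elim_inl]
  rw [← rpow_two_mul_natCast hq, ← Real.rpow_two, ← Real.rpow_add hq, ← Real.rpow_add hq]
  ring_nf

theorem jPoint_pos (hq : 0 < q) (a p : ℝ) (n : ℕ) :
    jPoint a (-q ^ (4 * k₁ - 2 * p - 2 * ε - 2)) (q ^ 2) (Sum.inr n) =
      -q ^ (2 * n + 4 * k₁ - 2 * p - 2 * ε) := by
  simp only [jPoint, Sum.elim_inr]
  rw [← rpow_two_mul_natCast hq, ← Real.rpow_two, neg_mul, neg_mul, ← Real.rpow_add hq,
    ← Real.rpow_add hq]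
  ring_nf

theorem sqrt_aq (hq : 0 < q) : √(q ^ (4 * k₁ - 2) * q ^ 2) = q ^ (2 * k₁) := by
  rw [← Real.rpow_two, ← Real.rpow_add hq, show 4 * k₁ - 2 + 2 = 2 * k₁ + 2 * k₁ by ring,
    Real.rpow_add hq, Real.sqrt_mul_self (Real.rpow_pos_of_pos hq _).le]

/-- The prefactor in front of the square root is independent of m and reappears in all four
coefficient formulas below, so it drops out of the intertwining relations. -/
theorem strange_c_eq (hq : q ∈ Set.Ioo (0 : ℝ) 1) (p : ℤ) (m : ℕ) :
    (strangeData q hq (k₁ + k₂ - 1 / 2 + m) (ε - k₁ + k₂)).c p =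
      (q⁻¹ - q)⁻¹ * q ^ (-1 / 2 - p - ε + k₁ - k₂) *
        √((1 - q ^ (4 * k₁ - 2) * q ^ (4 * k₂ - 2) * (q ^ 2) ^ (m + 1) /
          (-q ^ (4 * k₁ - 2 * p - 2 * ε - 2))) *
          (1 - ((q ^ 2) ^ m)⁻¹ / (-q ^ (4 * k₁ - 2 * p - 2 * ε - 2)))) := by
  have h0 := hq.1
  simp only [strangeData]
  rw [div_neg, div_neg, sub_neg_eq_add, sub_neg_eq_add, ← rpow_two_mul_natCast h0,
    ← rpow_two_mul_natCast h0, ← Real.rpow_neg h0.le, ← Real.rpow_add h0, ← Real.rpow_add h0,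
    ← Real.rpow_sub h0, ← Real.rpow_sub h0, mul_assoc]
  push_cast
  ring_nf

theorem negStrange_coeff_up (hq : q ∈ Set.Ioo (0 : ℝ) 1) (h₁ : 0 < k₁) (n : ℕ) (p : ℤ) {x c : ℝ}
    (hx : x = q ^ (2 * n + 4 * k₁)) (hc : c = -q ^ (4 * k₁ - 2 * p - 2 * ε - 2)) :
    (negData q hq k₁ h₁).κ n * (strangeData q hq (k₂ - 1 / 2) (ε + k₂)).c (n + p) =
      (q⁻¹ - q)⁻¹ * q ^ (-1 / 2 - p - ε + k₁ - k₂) * (√(q ^ (4 * k₁ - 2) * q ^ 2) / x) *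
        √((1 - q ^ (4 * k₂ - 2) * x / c) * (1 - x / c)) := by
  have h0 := hq.1
  subst hx hc
  simp only [negData, strangeData]
  rw [sqrt_aq h0, div_neg, div_neg, sub_neg_eq_add, sub_neg_eq_add, ← Real.rpow_add h0,
    ← Real.rpow_sub h0, ← Real.rpow_sub h0, ← Real.rpow_sub h0, mul_assoc (_)⁻¹,
    ← Real.rpow_add h0, mul_left_comm, ← mul_assoc (q ^ _), ← Real.rpow_add h0, ← mul_assoc]
  push_cast
  ring_nf

theorem negStrange_coeff_down (hq : q ∈ Set.Ioo (0 : ℝ) 1) (h₁ : 0 < k₁) (n : ℕ) (p : ℤ) {x : ℝ}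
    (hx : x = q ^ (2 * n + 4 * k₁)) :
    (negData q hq k₁ h₁).c n * ((strangeData q hq (k₂ - 1 / 2) (ε + k₂)).κ (n + p))⁻¹ =
      -((q⁻¹ - q)⁻¹ * q ^ (-1 / 2 - p - ε + k₁ - k₂) * (√(q ^ (4 * k₁ - 2) * q ^ 2) / x) *
        (√(q ^ 2) * √((1 - x / (q ^ (4 * k₁ - 2) * q ^ 2)) * (1 - x / q ^ 2)))) := by
  have h0 := hq.1
  subst hx
  simp only [negData, strangeData]
  have r1 : q ^ (2 * n + 4 * k₁) / (q ^ (4 * k₁ - 2) * q ^ 2) = q ^ (2 * (n : ℝ)) := by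
    rw [← Real.rpow_two, ← Real.rpow_add h0, ← Real.rpow_sub h0]
    ring_nf
  have r2 : q ^ (2 * n + 4 * k₁) / q ^ 2 = q ^ (4 * k₁ + 2 * n - 2) := by
    rw [← Real.rpow_two, ← Real.rpow_sub h0]
    ring_nf
  have e : q ^ (1 / 2 - k₁ - n) * (q ^ (((n + p : ℤ) : ℝ) + (ε + k₂)))⁻¹ =
      q ^ (-1 / 2 - p - ε + k₁ - k₂) * (q ^ (2 * k₁) / q ^ (2 * n + 4 * k₁)) * q := by
    rw [← Real.rpow_neg h0.le, ← Real.rpow_add h0, ← Real.rpow_sub h0, ← Real.rpow_add h0,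
      ← Real.rpow_add_one h0.ne']
    push_cast
    ring_nf
  rw [sqrt_aq h0, Real.sqrt_sq h0.le, r1, r2]
  linear_combination (-(q⁻¹ - q)⁻¹ *
    √((1 - q ^ (2 * (n : ℝ))) * (1 - q ^ (4 * k₁ + 2 * n - 2)))) * e

/-- On this half x is negative, so the minus sign makes the coefficient positive. The sign differs
from that in `negStrange_coeff_up`; the factor (-1)^n in Θ f⁺ compensates for it. -/
theorem strangePos_coeff_up (hq : q ∈ Set.Ioo (0 : ℝ) 1) (h₂ : 0 < k₂) {N : ℤ} (hε : 2 * ε = N)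
    (n : ℕ) (p : ℤ) {x c : ℝ} (hx : x = -q ^ (2 * n + 4 * k₁ - 2 * p - 2 * ε))
    (hc : c = -q ^ (4 * k₁ - 2 * p - 2 * ε - 2)) :
    (strangeData q hq (k₁ - 1 / 2) (-ε - k₁)).κ (N - n + p) * (posData q hq k₂ h₂).c n =
      -((q⁻¹ - q)⁻¹ * q ^ (-1 / 2 - p - ε + k₁ - k₂) * (√(q ^ (4 * k₁ - 2) * q ^ 2) / x) *
        √((1 - q ^ (4 * k₂ - 2) * x / c) * (1 - x / c))) := by
  have h0 := hq.1
  subst hx hc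
  simp only [strangeData, posData]
  have r1 : q ^ (4 * k₂ - 2) * -q ^ (2 * n + 4 * k₁ - 2 * p - 2 * ε) /
      (-q ^ (4 * k₁ - 2 * p - 2 * ε - 2)) = q ^ (4 * k₂ + 2 * n) := by
    rw [mul_neg, neg_div_neg_eq, ← Real.rpow_add h0, ← Real.rpow_sub h0]
    ring_nf
  have r2 : -q ^ (2 * n + 4 * k₁ - 2 * p - 2 * ε) / (-q ^ (4 * k₁ - 2 * p - 2 * ε - 2)) =
      q ^ (2 * (n : ℝ) + 2) := by
    rw [neg_div_neg_eq, ← Real.rpow_sub h0]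
    ring_nf
  have e : q ^ (((N - n + p : ℤ) : ℝ) + (-ε - k₁)) * q ^ (-1 / 2 - k₂ - n) =
      q ^ (-1 / 2 - p - ε + k₁ - k₂) *
        (q ^ (2 * k₁) / q ^ (2 * n + 4 * k₁ - 2 * p - 2 * ε)) := by
    rw [← Real.rpow_sub h0, ← Real.rpow_add h0, ← Real.rpow_add h0]
    push_cast
    rw [← hε]
    ring_nf
  rw [sqrt_aq h0, r1, r2, div_neg, mul_comm (1 - q ^ (4 * k₂ + 2 * n))]
  linear_combination ((q⁻¹ - q)⁻¹ *
    √((1 - q ^ (2 * (n : ℝ) + 2)) * (1 - q ^ (4 * k₂ + 2 * n)))) * e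

theorem strangePos_coeff_down (hq : q ∈ Set.Ioo (0 : ℝ) 1) (h₂ : 0 < k₂) {N : ℤ}
    (hε : 2 * ε = N) (n : ℕ) (p : ℤ) {x : ℝ} (hx : x = -q ^ (2 * n + 4 * k₁ - 2 * p - 2 * ε)) :
    (strangeData q hq (k₁ - 1 / 2) (-ε - k₁)).c (N - n + p) * ((posData q hq k₂ h₂).κ n)⁻¹ =
      -((q⁻¹ - q)⁻¹ * q ^ (-1 / 2 - p - ε + k₁ - k₂) * (√(q ^ (4 * k₁ - 2) * q ^ 2) / x) *
        (√(q ^ 2) * √((1 - x / (q ^ (4 * k₁ - 2) * q ^ 2)) * (1 - x / q ^ 2)))) := by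
  have h0 := hq.1
  subst hx
  simp only [strangeData, posData]
  have r1 : -q ^ (2 * n + 4 * k₁ - 2 * p - 2 * ε) / (q ^ (4 * k₁ - 2) * q ^ 2) =
      -q ^ (2 * n - 2 * p - 2 * ε) := by
    rw [← Real.rpow_two, ← Real.rpow_add h0, neg_div, ← Real.rpow_sub h0]
    ring_nf
  have r2 : -q ^ (2 * n + 4 * k₁ - 2 * p - 2 * ε) / q ^ 2 =
      -q ^ (2 * n + 4 * k₁ - 2 * p - 2 * ε - 2) := by
    rw [← Real.rpow_two, neg_div, ← Real.rpow_sub h0]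
  have hs : √((1 + q ^ (2 * ((N - n + p : ℤ) : ℝ) + 2 * (-ε - k₁) + 2 * (k₁ - 1 / 2) + 1)) *
      (1 + q ^ (2 * ((N - n + p : ℤ) : ℝ) + 2 * (-ε - k₁) - 2 * (k₁ - 1 / 2) + 1))) =
      q ^ (2 * ε - 2 * n + 2 * p - 2 * k₁ + 1) * √((1 + q ^ (2 * n - 2 * p - 2 * ε)) *
        (1 + q ^ (2 * n + 4 * k₁ - 2 * p - 2 * ε - 2))) := by
    -- The strange series carries the exponents with the opposite sign to those in the contiguous
    -- relation. Pulling out q^y from each factor reverses them at the cost of a power of q.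
    have hinv : ∀ y : ℝ, 1 + q ^ y = q ^ y * (1 + q ^ (-y)) := fun y => by
      rw [mul_add, ← Real.rpow_add h0]
      simp [add_comm]
    rw [hinv, hinv (2 * ((N - n + p : ℤ) : ℝ) + 2 * (-ε - k₁) - 2 * (k₁ - 1 / 2) + 1),
      mul_mul_mul_comm, ← Real.rpow_add h0, Real.sqrt_mul (Real.rpow_pos_of_pos h0 _).le]
    congr 1
    · rw [Real.sqrt_eq_rpow, ← Real.rpow_mul h0.le]
      push_cast
      rw [← hε]
      ring_nf
    · push_cast
      rw [← hε]
      ring_nf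
  have e : q ^ (-1 / 2 - ((N - n + p : ℤ) : ℝ) - (-ε - k₁)) *
      q ^ (2 * ε - 2 * n + 2 * p - 2 * k₁ + 1) * (q ^ (k₂ + n))⁻¹ =
      q ^ (-1 / 2 - p - ε + k₁ - k₂) *
        (q ^ (2 * k₁) / q ^ (2 * n + 4 * k₁ - 2 * p - 2 * ε)) * q := by
    rw [← Real.rpow_neg h0.le, ← Real.rpow_sub h0, ← Real.rpow_add h0, ← Real.rpow_add h0,
      ← Real.rpow_add h0, ← Real.rpow_add_one h0.ne']
    push_cast
    rw [← hε]
    ring_nf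
  rw [sqrt_aq h0, Real.sqrt_sq h0.le, r1, r2, hs, div_neg, sub_neg_eq_add, sub_neg_eq_add]
  linear_combination ((q⁻¹ - q)⁻¹ * √((1 + q ^ (2 * n - 2 * p - 2 * ε)) *
        (1 + q ^ (2 * n + 4 * k₁ - 2 * p - 2 * ε - 2)))) * e

/-- The relation E* = -F on matrix coefficients. With its analogues for the other series, it reduces
the coefficients of `F` to those of `E`. -/
theorem negData_d (hq : q ∈ Set.Ioo (0 : ℝ) 1) (h₁ : 0 < k₁) (n : ℕ) :
    (negData q hq k₁ h₁).d n = -(negData q hq k₁ h₁).c (n + 1) := by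
  rcases (negData q hq k₁ h₁).d_dn n with h | ⟨-, -, h⟩
  · simp only [negData] at h ⊢
    push_cast
    ring_nf
  · rw [show (negData q hq k₁ h₁).dn n = n + 1 from rfl] at h
    rw [h, neg_neg]

theorem posData_d (hq : q ∈ Set.Ioo (0 : ℝ) 1) (h₂ : 0 < k₂) (n : ℕ) :
    (posData q hq k₂ h₂).d (n + 1) = -(posData q hq k₂ h₂).c n := by
  simp only [posData]
  push_cast
  ring_nf

theorem strangeData_d (hq : q ∈ Set.Ioo (0 : ℝ) 1) (σ ε : ℝ) (j : ℤ) :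
    (strangeData q hq σ ε).d (j + 1) = -(strangeData q hq σ ε).c j := by
  simp only [strangeData]
  push_cast
  ring_nf

theorem negData_c_zero (hq : q ∈ Set.Ioo (0 : ℝ) 1) (h₁ : 0 < k₁) :
    (negData q hq k₁ h₁).c 0 = 0 := by
  simp [negData]

theorem posData_d_zero (hq : q ∈ Set.Ioo (0 : ℝ) 1) (h₂ : 0 < k₂) :
    (posData q hq k₂ h₂).d 0 = 0 := by
  simp [posData]

/-! ### The matrix coefficients Θ and their relations under E and F -/

theorem thetaNeg_eq (q k₁ k₂ ε : ℝ) (p : ℤ) (n m : ℕ) : thetaNeg q k₁ k₂ ε p n m =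
    normBigQJacobi (q ^ (2 * n + 4 * k₁)) m (q ^ (4 * k₁ - 2)) (q ^ (4 * k₂ - 2))
      (-q ^ (4 * k₁ - 2 * p - 2 * ε - 2)) (q ^ 2) := rfl

theorem thetaNeg_succ (hq : 0 < q) (p : ℤ) (n m : ℕ) : thetaNeg q k₁ k₂ ε (p + 1) n m =
    normBigQJacobi (q ^ (2 * n + 4 * k₁)) m (q ^ (4 * k₁ - 2)) (q ^ (4 * k₂ - 2))
      (-q ^ (4 * k₁ - 2 * p - 2 * ε - 2) / q ^ 2) (q ^ 2) := by
  rw [thetaNeg_eq, ← jParam_succ hq]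
  push_cast
  rfl

theorem thetaPos_eq (q k₁ k₂ ε : ℝ) (p : ℤ) (n m : ℕ) : thetaPos q k₁ k₂ ε p n m =
    (-1) ^ n * normBigQJacobi (-q ^ (2 * n + 4 * k₁ - 2 * p - 2 * ε)) m (q ^ (4 * k₁ - 2))
      (q ^ (4 * k₂ - 2)) (-q ^ (4 * k₁ - 2 * p - 2 * ε - 2)) (q ^ 2) := rfl

theorem thetaPos_succ (hq : 0 < q) (p : ℤ) (n m : ℕ) : thetaPos q k₁ k₂ ε (p + 1) n m =
    (-1) ^ n * normBigQJacobi (-q ^ (2 * n + 4 * k₁ - 2 * p - 2 * ε) / q ^ 2) m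
      (q ^ (4 * k₁ - 2)) (q ^ (4 * k₂ - 2)) (-q ^ (4 * k₁ - 2 * p - 2 * ε - 2) / q ^ 2)
      (q ^ 2) := by
  rw [thetaPos_eq, ← jParam_succ hq, neg_div, ← Real.rpow_two, ← Real.rpow_sub hq]
  push_cast
  ring_nf

theorem rpow_succ_index (hq : 0 < q) (n : ℕ) (y : ℝ) :
    q ^ (2 * ((n + 1 : ℕ) : ℝ) + y) = q ^ (2 * n + y) * q ^ 2 := by
  rw [← Real.rpow_two, ← Real.rpow_add hq]
  push_cast
  ring_nf

theorem rpow_succ_index' (hq : 0 < q) (n : ℕ) (x y z : ℝ) :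
    q ^ (2 * ((n + 1 : ℕ) : ℝ) + x - y - z) = q ^ (2 * n + x - y - z) * q ^ 2 := by
  rw [← Real.rpow_two, ← Real.rpow_add hq]
  push_cast
  ring_nf

variable {N : ℤ}

/-- The coefficient identity behind the intertwining relations. -/
theorem combine_relation {t r s₁ s₂ S W W₁ W₂ A B C x : ℝ} (hx : x ≠ 0) (hr : r ≠ 0)
    (hA : A = t * (r / x) * s₁) (hB : B = -(t * (r / x) * s₂)) (hC : C = t * S)
    (h : s₁ * W₁ - s₂ * W₂ = x / r * S * W) : A * W₁ + B * W₂ = C * W := by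
  have e : r / x * (x / r) = 1 := by rw [div_mul_div_cancel₀ hx, div_self hr]
  rw [hA, hB, hC]
  linear_combination t * (r / x) * h + t * S * W * e

theorem sqrt_aq_ne (hq : 0 < q) : √(q ^ (4 * k₁ - 2) * q ^ 2) ≠ 0 := by
  rw [sqrt_aq hq]
  exact (Real.rpow_pos_of_pos hq _).ne'

/-- `E` sends f⁻_{p,n} to a combination of f⁻_{p+1,n} and f⁻_{p+1,n-1}, which sit at x and x/q² for
the parameter c/q². The relation is `normBigQJacobi_up` in base q². -/
theorem thetaNeg_E (hq : q ∈ Set.Ioo (0 : ℝ) 1) (h₁ : 0 < k₁) (h₂ : 0 < k₂) (p : ℤ)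
    (n m : ℕ) :
    (negData q hq k₁ h₁).κ n * (strangeData q hq (k₂ - 1 / 2) (ε + k₂)).c (n + p) *
        thetaNeg q k₁ k₂ ε (p + 1) n m +
      (negData q hq k₁ h₁).c n * ((strangeData q hq (k₂ - 1 / 2) (ε + k₂)).κ (n + p))⁻¹ *
        thetaNeg q k₁ k₂ ε (p + 1) (n - 1) m =
      (strangeData q hq (k₁ + k₂ - 1 / 2 + m) (ε - k₁ + k₂)).c p * thetaNeg q k₁ k₂ ε p n m := by
  have h0 := hq.1
  have P := isJacobiParam hq h₁ h₂ ε p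
  have hC := strange_c_eq (k₁ := k₁) (k₂ := k₂) (ε := ε) hq p m
  have hA := negStrange_coeff_up (k₂ := k₂) (ε := ε) hq h₁ n p rfl rfl
  have hB := negStrange_coeff_down (k₂ := k₂) (ε := ε) hq h₁ n p rfl
  rw [thetaNeg_succ h0 p n, thetaNeg_eq q k₁ k₂ ε p n]
  set c := -q ^ (4 * k₁ - 2 * p - 2 * ε - 2) with hc
  have hx : q ^ (2 * n + 4 * k₁) ∈ Set.Icc (c * q ^ 2) (q ^ (4 * k₁ - 2) * q ^ 2) := by
    rw [← jPoint_neg h0 c]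
    exact jPoint_mem P.hq P.ha P.hc _
  have hx' : q ^ (2 * n + 4 * k₁) = q ^ (4 * k₁ - 2) * q ^ 2 ∨
      q ^ (2 * n + 4 * k₁) / q ^ 2 ∈ Set.Icc c (q ^ (4 * k₁ - 2) * q ^ 2) := by
    rcases n with _ | n
    · left
      rw [← Real.rpow_two, ← Real.rpow_add h0]
      push_cast
      ring_nf
    · right
      have := jPoint_mem P.div_q.hq P.div_q.ha P.div_q.hc (Sum.inl n)
      rw [jPoint_neg h0] at this
      rw [rpow_succ_index h0, mul_div_cancel_right₀ _ P.q_ne]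
      rwa [div_mul_cancel₀ _ P.q_ne] at this
  -- For n = 0 the truncated index `n - 1` does not correspond to x/q², but the coefficient `c 0`
  -- vanishes and either value may be used.
  have hsh : (negData q hq k₁ h₁).c n * ((strangeData q hq (k₂ - 1 / 2) (ε + k₂)).κ (n + p))⁻¹ *
      thetaNeg q k₁ k₂ ε (p + 1) (n - 1) m =
      (negData q hq k₁ h₁).c n * ((strangeData q hq (k₂ - 1 / 2) (ε + k₂)).κ (n + p))⁻¹ *
      normBigQJacobi (q ^ (2 * n + 4 * k₁) / q ^ 2) m
        (q ^ (4 * k₁ - 2)) (q ^ (4 * k₂ - 2)) (c / q ^ 2) (q ^ 2) := by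
    rcases n with _ | n
    · simp [negData_c_zero]
    · rw [thetaNeg_succ h0, rpow_succ_index h0, mul_div_cancel_right₀ _ P.q_ne,
        Nat.add_sub_cancel]
  rw [hsh]
  exact combine_relation (Real.rpow_pos_of_pos h0 _).ne' (sqrt_aq_ne h0) hA hB hC
    (P.normBigQJacobi_up hx hx' m)

/-- After rewriting the `d` coefficients through `c`, this is minus `normBigQJacobi_down`. It is
stated at p + 1 so that the levels p and p + 1 are again c and c/q². -/
theorem thetaNeg_F (hq : q ∈ Set.Ioo (0 : ℝ) 1) (h₁ : 0 < k₁) (h₂ : 0 < k₂) (p : ℤ)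
    (n m : ℕ) :
    (negData q hq k₁ h₁).κ n * (strangeData q hq (k₂ - 1 / 2) (ε + k₂)).d (n + (p + 1)) *
        thetaNeg q k₁ k₂ ε p n m +
      (negData q hq k₁ h₁).d n * ((strangeData q hq (k₂ - 1 / 2) (ε + k₂)).κ (n + (p + 1)))⁻¹ *
        thetaNeg q k₁ k₂ ε p (n + 1) m =
      (strangeData q hq (k₁ + k₂ - 1 / 2 + m) (ε - k₁ + k₂)).d (p + 1) *
        thetaNeg q k₁ k₂ ε (p + 1) n m := by
  have h0 := hq.1
  have P := isJacobiParam hq h₁ h₂ ε p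
  have hC := strange_c_eq (k₁ := k₁) (k₂ := k₂) (ε := ε) hq p m
  have hA := negStrange_coeff_up (k₂ := k₂) (ε := ε) hq h₁ n p rfl rfl
  have hB := negStrange_coeff_down (k₂ := k₂) (ε := ε) hq h₁ (n + 1) p rfl
  rw [show ((n + 1 : ℕ) : ℤ) + p = n + (p + 1) by push_cast; ring, rpow_succ_index h0] at hB
  rw [← add_assoc (n : ℤ) p 1, strangeData_d, strangeData_d, negData_d, add_assoc (n : ℤ) p 1,
    thetaNeg_succ h0 p n, thetaNeg_eq q k₁ k₂ ε p n, thetaNeg_eq q k₁ k₂ ε p (n + 1),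
    rpow_succ_index h0]
  set c := -q ^ (4 * k₁ - 2 * p - 2 * ε - 2) with hc
  have hx : q ^ (2 * n + 4 * k₁) ∈ Set.Icc (c * q ^ 2) (q ^ (4 * k₁ - 2) * q ^ 2) := by
    rw [← jPoint_neg h0 c]
    exact jPoint_mem P.hq P.ha P.hc _
  have hx2 := P.mem_Icc_div hx
  rw [div_mul_cancel₀ _ P.q_ne] at hx2
  have key := P.normBigQJacobi_down hx2 (Or.inr hx) m
  have ha := P.ha.ne'
  -- The formula for `hB` is taken at the point xq²; the division by xq² and the factor √(q²) = q
  -- leave (√(q²))⁻¹ over x.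
  have hB' : (negData q hq k₁ h₁).c (n + 1) *
      ((strangeData q hq (k₂ - 1 / 2) (ε + k₂)).κ (n + (p + 1)))⁻¹ =
      -((q⁻¹ - q)⁻¹ * q ^ (-1 / 2 - p - ε + k₁ - k₂) *
        (√(q ^ (4 * k₁ - 2) * q ^ 2) / q ^ (2 * n + 4 * k₁)) *
        ((√(q ^ 2))⁻¹ * √((1 - q ^ (2 * n + 4 * k₁) / q ^ (4 * k₁ - 2)) *
          (1 - q ^ (2 * n + 4 * k₁))))) := by
    rw [hB, mul_div_cancel_right₀ _ P.q_ne, mul_div_mul_right _ _ P.q_ne, Real.sqrt_sq h0.le]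
    have hx0 := (Real.rpow_pos_of_pos h0 (2 * n + 4 * k₁)).ne'
    generalize √((1 - q ^ (2 * n + 4 * k₁) / q ^ (4 * k₁ - 2)) *
          (1 - q ^ (2 * n + 4 * k₁))) = Z
    generalize √(q ^ (4 * k₁ - 2) * q ^ 2) = Y
    generalize q ^ (2 * n + 4 * k₁) = X at *
    have := h0.ne'
    field_simp
  have h := combine_relation (Real.rpow_pos_of_pos h0 _).ne' (sqrt_aq_ne h0) hA hB' hC key
  linear_combination -h

/-- Here level p + 1 carries the point x at index n + 1 and the point x/q² at index n, because the
positions of the negative points themselves scale with c. The relation is again `normBigQJacobi_up`.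
-/
theorem thetaPos_E (hq : q ∈ Set.Ioo (0 : ℝ) 1) (h₁ : 0 < k₁) (h₂ : 0 < k₂) (hε : 2 * ε = N)
    (p : ℤ) (n m : ℕ) :
    (strangeData q hq (k₁ - 1 / 2) (-ε - k₁)).κ (N - n + p) * (posData q hq k₂ h₂).c n *
        thetaPos q k₁ k₂ ε (p + 1) (n + 1) m +
      (strangeData q hq (k₁ - 1 / 2) (-ε - k₁)).c (N - n + p) * ((posData q hq k₂ h₂).κ n)⁻¹ *
        thetaPos q k₁ k₂ ε (p + 1) n m =
      (strangeData q hq (k₁ + k₂ - 1 / 2 + m) (ε - k₁ + k₂)).c p * thetaPos q k₁ k₂ ε p n m := by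
  have h0 := hq.1
  have P := isJacobiParam hq h₁ h₂ ε p
  have hC := strange_c_eq (k₁ := k₁) (k₂ := k₂) (ε := ε) hq p m
  have hA := strangePos_coeff_up (k₁ := k₁) (k₂ := k₂) hq h₂ hε n p rfl rfl
  have hB := strangePos_coeff_down (k₁ := k₁) (k₂ := k₂) hq h₂ hε n p rfl
  rw [thetaPos_succ h0 p n, thetaPos_succ h0 p (n + 1), thetaPos_eq q k₁ k₂ ε p n,
    rpow_succ_index' h0, ← neg_mul, mul_div_cancel_right₀ _ P.q_ne]
  set c := -q ^ (4 * k₁ - 2 * p - 2 * ε - 2) with hc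
  have hx : -q ^ (2 * n + 4 * k₁ - 2 * p - 2 * ε) ∈
      Set.Icc (c * q ^ 2) (q ^ (4 * k₁ - 2) * q ^ 2) := by
    rw [← jPoint_pos h0 (q ^ (4 * k₁ - 2))]
    exact jPoint_mem P.hq P.ha P.hc _
  have hx' : -q ^ (2 * n + 4 * k₁ - 2 * p - 2 * ε) / q ^ 2 ∈
      Set.Icc c (q ^ (4 * k₁ - 2) * q ^ 2) := by
    have := jPoint_mem P.div_q.hq P.div_q.ha P.div_q.hc (Sum.inr n)
    rw [hc, ← jParam_succ h0, jPoint_pos h0, jParam_succ h0, div_mul_cancel₀ _ P.q_ne] at this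
    have e : 2 * (n : ℝ) + 4 * k₁ - 2 * (p + 1) - 2 * ε = 2 * n + 4 * k₁ - 2 * p - 2 * ε - 2 := by
      ring
    rwa [e, ← hc, rpow_sub_two_index h0] at this
  have key := P.normBigQJacobi_up hx (Or.inr hx') m
  have h := combine_relation (neg_ne_zero.2 (Real.rpow_pos_of_pos h0 _).ne') (sqrt_aq_ne h0)
    (neg_eq_iff_eq_neg.2 hA) hB hC key
  -- The additional sign in (-1)^{n+1} matches the minus sign of `strangePos_coeff_up`.
  rw [pow_succ (-1 : ℝ)]
  linear_combination (-1) ^ n * h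

theorem thetaPos_F (hq : q ∈ Set.Ioo (0 : ℝ) 1) (h₁ : 0 < k₁) (h₂ : 0 < k₂)
    (hε : 2 * ε = N) (p : ℤ) (n m : ℕ) :
    (strangeData q hq (k₁ - 1 / 2) (-ε - k₁)).κ (N - n + (p + 1)) * (posData q hq k₂ h₂).d n *
        thetaPos q k₁ k₂ ε p (n - 1) m +
      (strangeData q hq (k₁ - 1 / 2) (-ε - k₁)).d (N - n + (p + 1)) *
        ((posData q hq k₂ h₂).κ n)⁻¹ * thetaPos q k₁ k₂ ε p n m =
      (strangeData q hq (k₁ + k₂ - 1 / 2 + m) (ε - k₁ + k₂)).d (p + 1) *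
        thetaPos q k₁ k₂ ε (p + 1) n m := by
  have h0 := hq.1
  have P := isJacobiParam hq h₁ h₂ ε p
  have hC := strange_c_eq (k₁ := k₁) (k₂ := k₂) (ε := ε) hq p m
  have hB := strangePos_coeff_down (k₁ := k₁) (k₂ := k₂) hq h₂ hε n p rfl
  set c := -q ^ (4 * k₁ - 2 * p - 2 * ε - 2) with hc
  set y := -q ^ (2 * n + 4 * k₁ - 2 * p - 2 * ε) / q ^ 2 with hy
  have hyq : -q ^ (2 * n + 4 * k₁ - 2 * p - 2 * ε) = y * q ^ 2 :=
    (div_mul_cancel₀ _ P.q_ne).symm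
  have hyc : y ∈ Set.Icc c (q ^ (4 * k₁ - 2) * q ^ 2) := by
    have := jPoint_mem P.div_q.hq P.div_q.ha P.div_q.hc (Sum.inr n)
    rw [hc, ← jParam_succ h0, jPoint_pos h0, jParam_succ h0, div_mul_cancel₀ _ P.q_ne] at this
    have e : 2 * (n : ℝ) + 4 * k₁ - 2 * (p + 1) - 2 * ε = 2 * n + 4 * k₁ - 2 * p - 2 * ε - 2 := by
      ring
    rwa [e, ← hc, rpow_sub_two_index h0] at this
  -- The point belonging to n = 0 at level p + 1 is y = c itself, which is not in the support at
  -- level p. In the relation this matches `d 0 = 0` for the positive discrete series.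
  have hy' : y = c ∨ y ∈ Set.Icc (c * q ^ 2) (q ^ (4 * k₁ - 2) * q ^ 2) := by
    rcases n with _ | n
    · left
      rw [hy, hc, neg_div, ← Real.rpow_two q, ← Real.rpow_sub h0]
      push_cast
      ring_nf
    · right
      rw [hy, rpow_succ_index' h0, ← neg_mul, mul_div_cancel_right₀ _ P.q_ne,
        ← jPoint_pos h0 (q ^ (4 * k₁ - 2))]
      exact jPoint_mem P.hq P.ha P.hc _
  have hy0 : y ≠ 0 := div_ne_zero (neg_ne_zero.2 (Real.rpow_pos_of_pos h0 _).ne') P.q_ne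
  have key := P.normBigQJacobi_down hyc hy' m
  have hB' : (strangeData q hq (k₁ - 1 / 2) (-ε - k₁)).c (N - n + p) *
      ((posData q hq k₂ h₂).κ n)⁻¹ =
      -((q⁻¹ - q)⁻¹ * q ^ (-1 / 2 - p - ε + k₁ - k₂) * (√(q ^ (4 * k₁ - 2) * q ^ 2) / y) *
        ((√(q ^ 2))⁻¹ * √((1 - y / q ^ (4 * k₁ - 2)) * (1 - y)))) := by
    rw [hB, hyq, mul_div_mul_right _ _ P.q_ne,
      Real.sqrt_sq h0.le]
    generalize √((1 - y / q ^ (4 * k₁ - 2)) * (1 - y)) = Z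
    generalize √(q ^ (4 * k₁ - 2) * q ^ 2) = Y
    have := h0.ne'
    field_simp
  have hA : (strangeData q hq (k₁ - 1 / 2) (-ε - k₁)).κ (N - n + (p + 1)) *
      (posData q hq k₂ h₂).d n * thetaPos q k₁ k₂ ε p (n - 1) m =
      -((-1) ^ n * ((q⁻¹ - q)⁻¹ * q ^ (-1 / 2 - p - ε + k₁ - k₂) *
        (√(q ^ (4 * k₁ - 2) * q ^ 2) / y) * √((1 - q ^ (4 * k₂ - 2) * y / c) * (1 - y / c)) *
        normBigQJacobi y m (q ^ (4 * k₁ - 2)) (q ^ (4 * k₂ - 2)) c (q ^ 2))) := by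
    rcases n with _ | n
    · have hyc0 : y = c := by
        rw [hy, hc, neg_div, ← Real.rpow_two q, ← Real.rpow_sub h0]
        push_cast
        ring_nf
      have hc0 := P.hc.ne
      rw [posData_d_zero, hyc0, div_self hc0]
      simp
    · have hxy : y = -q ^ (2 * n + 4 * k₁ - 2 * p - 2 * ε) := by
        rw [hy, rpow_succ_index' h0, ← neg_mul, mul_div_cancel_right₀ _ P.q_ne]
      have hA0 := strangePos_coeff_up (k₁ := k₁) (k₂ := k₂) hq h₂ hε n p hxy hc
      rw [posData_d, Nat.add_sub_cancel, thetaPos_eq, ← hc, ← hxy,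
        show N - ((n + 1 : ℕ) : ℤ) + (p + 1) = N - n + p by push_cast; ring]
      rw [pow_succ (-1 : ℝ)]
      linear_combination -(-1) ^ n *
        normBigQJacobi y m (q ^ (4 * k₁ - 2)) (q ^ (4 * k₂ - 2)) c (q ^ 2) * hA0
  rw [hA, ← add_assoc (N - n : ℤ) p 1, strangeData_d, strangeData_d, thetaPos_succ h0 p n,
    thetaPos_eq q k₁ k₂ ε p n, ← hc, ← hy, hyq]
  have h := combine_relation hy0 (sqrt_aq_ne h0) rfl hB' hC key
  linear_combination -(-1) ^ n * h

end Coefficients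

/-! ### Unitary operators from fibrewise orthonormal matrices -/

section Unitary

variable {ι X M : Type*}

/-- A real square-summable function on the fibre over `p`, as a vector of `ℓ²(ι × X)`. -/
def fibreVec [DecidableEq ι] (p : ι) (w : X → ℝ) (hw : Summable fun i => w i * w i) :
    ℓ²(ι × X, ℂ) :=
  ⟨fun s => if s.1 = p then (w s.2 : ℂ) else 0, by
    refine memℓp_gen ?_
    have hinj : Function.Injective fun i : X => (p, i) := Prod.mk_right_injective p
    refine (hinj.summable_iff fun s hs => ?_).1 (hw.congr fun i => ?_)
    · have : s.1 ≠ p := fun h => hs ⟨s.2, by rw [← h]⟩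
      simp [this]
    · simp [Complex.norm_real, ← sq]⟩

theorem fibreVec_apply [DecidableEq ι] (p : ι) (w : X → ℝ) (hw : Summable fun i => w i * w i)
    (s : ι × X) : fibreVec p w hw s = if s.1 = p then (w s.2 : ℂ) else 0 := rfl

theorem inner_fibreVec [DecidableEq ι] (p : ι) (w : X → ℝ) (hw : Summable fun i => w i * w i)
    (v : ℓ²(ι × X, ℂ)) : inner ℂ (fibreVec p w hw) v = ∑' i, (w i : ℂ) * v (p, i) := by
  have hinj : Function.Injective fun i : X => (p, i) := Prod.mk_right_injective p
  rw [lp.inner_eq_tsum, ← hinj.tsum_eq]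
  · refine tsum_congr fun i => ?_
    simp [fibreVec_apply, mul_comm]
  · intro s hs
    by_contra h
    have : s.1 ≠ p := fun h' => h ⟨s.2, by rw [← h']⟩
    exact hs (by simp [fibreVec_apply, this])

/-- The rows θ(p,·,m), extended by zero off the fibre over p, are orthonormal by `h₁` and have
trivial orthogonal complement by `h₂`. They form a Hilbert basis and U is its coordinate map;
orthonormality of the columns needs no separate proof. -/
theorem exists_unitary_of_fibres [DecidableEq ι] [DecidableEq X] [DecidableEq M]
    (θ : ι → X → M → ℝ)
    (h₁ : ∀ p m n, HasSum (fun i => θ p i m * θ p i n) (if m = n then 1 else 0))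
    (h₂ : ∀ p (g : X → ℂ), (Summable fun i => ‖g i‖ ^ 2) →
      (∀ m, ∑' i, (θ p i m : ℂ) * g i = 0) → ∀ i, g i = 0) :
    ∃ U : ℓ²(ι × X, ℂ) ≃ₗᵢ[ℂ] ℓ²(ι × M, ℂ), ∀ p i s,
      U (lp.single 2 (p, i) 1) s = if s.1 = p then (θ p i s.2 : ℂ) else 0 := by
  have hsum : ∀ p m, Summable fun i => θ p i m * θ p i m := fun p m => (h₁ p m m).summable
  set G : ι × M → ℓ²(ι × X, ℂ) := fun s => fibreVec s.1 (fun i => θ s.1 i s.2) (hsum s.1 s.2)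
    with hG
  have hin : ∀ (s : ι × M) (v : ℓ²(ι × X, ℂ)),
      inner ℂ (G s) v = ∑' i, (θ s.1 i s.2 : ℂ) * v (s.1, i) := fun s v => inner_fibreVec _ _ _ v
  have hon : Orthonormal ℂ G := by
    rw [orthonormal_iff_ite]
    rintro ⟨p, m⟩ ⟨p', n⟩
    rw [hin]
    by_cases hp : p = p'
    · subst hp
      have := (Complex.hasSum_ofReal.2 (h₁ p m n)).tsum_eq
      simp only [hG, fibreVec_apply, if_true]
      rw [← Complex.ofReal_one, ← Complex.ofReal_zero] at *
      simp only [Complex.ofReal_mul] at this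
      rw [this]
      by_cases hmn : m = n <;> simp [hmn]
    · simp [hG, fibreVec_apply, hp]
  have hcomp : (Submodule.span ℂ (Set.range G))ᗮ = ⊥ := by
    rw [Submodule.eq_bot_iff]
    intro v hv
    have hv' : ∀ s, inner ℂ (G s) v = 0 := fun s =>
      hv _ (Submodule.subset_span (Set.mem_range_self s))
    have hinj (p : ι) : Function.Injective fun i : X => (p, i) := Prod.mk_right_injective p
    have hvs : Summable fun s => ‖v s‖ ^ 2 := by
      have := (lp.memℓp v).summable (by norm_num)
      simpa using this
    ext ⟨p, i⟩
    refine h₂ p (fun i => v (p, i)) (hvs.comp_injective (hinj p)) (fun m => ?_) i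
    rw [← hin (p, m)]
    exact hv' _
  let B := HilbertBasis.mkOfOrthogonalEqBot hon hcomp
  refine ⟨B.repr, fun p i s => ?_⟩
  -- Only the entry at `i` of the basis vector contributes, and no conjugate appears because θ is
  -- real.
  rw [B.repr_apply_apply, HilbertBasis.coe_mkOfOrthogonalEqBot, hin, tsum_eq_single i]
  · by_cases hs : s.1 = p
    · subst hs
      simp
    · have : (s.1, i) ≠ (p, i) := fun h => hs (congrArg Prod.fst h)
      rw [lp.single_apply_ne _ _ _ this]
      simp [hs]
  · intro j hj
    have : (s.1, j) ≠ (p, i) := fun h => hj (congrArg Prod.snd h)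
    rw [lp.single_apply_ne _ _ _ this, mul_zero]

/-- `ℓ²(ι × M)` is the Hilbert sum over `M` of copies of `ℓ²(ι)`. -/
theorem exists_curry_unitary [DecidableEq ι] [DecidableEq M] :
    ∃ V : lp (fun _ : M => ℓ²(ι, ℂ)) 2 ≃ₗᵢ[ℂ] ℓ²(ι × M, ℂ), ∀ v p m, V v (p, m) = v m p := by
  set e : ι × M → lp (fun _ : M => ℓ²(ι, ℂ)) 2 := fun s => lp.single 2 s.2 (lp.single 2 s.1 1)
    with he
  have hin : ∀ s v, inner ℂ (e s) v = v s.2 s.1 := fun s v => by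
    simp only [he]
    rw [lp.inner_single_left, lp.inner_single_left]
    simp
  have hon : Orthonormal ℂ e := by
    rw [orthonormal_iff_ite]
    rintro ⟨p, m⟩ ⟨p', n⟩
    rw [hin]
    by_cases hm : m = n
    · subst hm
      simp only [he, lp.single_apply_self]
      by_cases hp : p = p'
      · subst hp; simp
      · rw [lp.single_apply_ne _ _ _ hp]; simp [hp]
    · simp only [he]
      rw [lp.single_apply_ne _ _ _ hm]; simp [hm]
  have hcomp : (Submodule.span ℂ (Set.range e))ᗮ = ⊥ := by
    rw [Submodule.eq_bot_iff]
    intro v hv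
    refine lp.ext (funext fun m => ?_)
    ext p
    rw [← hin (p, m)]
    exact hv _ (Submodule.subset_span (Set.mem_range_self _))
  let B := HilbertBasis.mkOfOrthogonalEqBot hon hcomp
  refine ⟨B.repr, fun v p m => ?_⟩
  rw [B.repr_apply_apply, HilbertBasis.coe_mkOfOrthogonalEqBot, hin]

/-- The vectors `f⁻_{p,n}` and `f⁺_{p,n}`, for fixed `p`. -/
def fVec (N p : ℤ) : ℕ ⊕ ℕ → HilbT :=
  Sum.elim (fun n => basisNeg n (n + p)) fun n => basisPos (N - n + p) n

theorem embed_single_one {κ : Type*} [DecidableEq κ] (s : κ) :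
    embed κ (Finsupp.single s 1) = lp.single 2 s 1 := by
  ext t
  simp [embed_apply, Finsupp.single_apply, Pi.single_apply, eq_comm]

theorem inner_basisNeg (i : ℕ) (j : ℤ) (v : HilbT) : inner ℂ (basisNeg i j) v = v.fst (i, j) := by
  have h : basisNeg i j = WithLp.toLp 2 (lp.single 2 (i, j) 1, 0) := by
    classical
    rw [basisNeg, embedT]
    simp only [LinearMap.comp_apply, LinearMap.prodMap_apply, embedTensor_single, map_zero]
    rw [mul_one, embed_single_one]
    rfl
  rw [h, WithLp.prod_inner_apply]
  simp [lp.inner_single_left]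

theorem inner_basisPos (j : ℤ) (i : ℕ) (v : HilbT) : inner ℂ (basisPos j i) v = v.snd (j, i) := by
  have h : basisPos j i = WithLp.toLp 2 (0, lp.single 2 (j, i) 1) := by
    classical
    rw [basisPos, embedT]
    simp only [LinearMap.comp_apply, LinearMap.prodMap_apply, embedTensor_single, map_zero]
    rw [mul_one, embed_single_one]
    rfl
  rw [h, WithLp.prod_inner_apply]
  simp [lp.inner_single_left]

/-- The maps (p,n) ↦ (n, n+p) and (p,n) ↦ (N-n+p, n) are bijections onto the two index sets, so the
f-vectors are the standard basis relabelled by weight. -/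
theorem exists_fVec_unitary (N : ℤ) :
    ∃ V : HilbT ≃ₗᵢ[ℂ] ℓ²(ℤ × (ℕ ⊕ ℕ), ℂ), ∀ p i, V (fVec N p i) = lp.single 2 (p, i) 1 := by
  have hon : Orthonormal ℂ fun s : ℤ × (ℕ ⊕ ℕ) => fVec N s.1 s.2 := by
    rw [orthonormal_iff_ite]
    rintro ⟨p, i | i⟩ ⟨p', j | j⟩
    · simp only [fVec, Sum.elim_inl]
      rw [basisNeg, basisNeg, inner_embedT, embedTensor_single, embedTensor_single,
        inner_embed_single]
      by_cases h : i = j <;> simp [h]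
    · simp only [fVec, Sum.elim_inl, Sum.elim_inr]
      rw [basisNeg, basisPos, inner_embedT]
      simp
    · simp only [fVec, Sum.elim_inl, Sum.elim_inr]
      rw [basisNeg, basisPos, inner_embedT]
      simp
    · simp only [fVec, Sum.elim_inr]
      rw [basisPos, basisPos, inner_embedT, embedTensor_single, embedTensor_single,
        inner_embed_single]
      by_cases h : i = j <;> simp [h]
  have hcomp : (Submodule.span ℂ (Set.range fun s : ℤ × (ℕ ⊕ ℕ) => fVec N s.1 s.2))ᗮ = ⊥ := by
    rw [Submodule.eq_bot_iff]
    intro v hv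
    have hv' : ∀ p i, inner ℂ (fVec N p i) v = 0 := fun p i =>
      hv _ (Submodule.subset_span (Set.mem_range_self (p, i)))
    have e1 : v.fst = 0 := by
      ext ⟨i, j⟩
      have := hv' (j - i) (Sum.inl i)
      rw [fVec, Sum.elim_inl, inner_basisNeg, add_sub_cancel] at this
      exact this
    have e2 : v.snd = 0 := by
      ext ⟨j, i⟩
      have := hv' (j - (N - i)) (Sum.inr i)
      rw [fVec, Sum.elim_inr, inner_basisPos, add_sub_cancel] at this
      exact this
    exact WithLp.ofLp_injective 2 (Prod.ext e1 e2)
  let B := HilbertBasis.mkOfOrthogonalEqBot hon hcomp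
  refine ⟨B.repr, fun p i => ?_⟩
  rw [← B.repr_self, HilbertBasis.coe_mkOfOrthogonalEqBot]

end Unitary

/-! ### The intertwining operator -/

theorem core_ext {V : Type*} [AddCommMonoid V] [Module ℂ V] (N : ℤ) {f g : CoreT →ₗ[ℂ] V}
    (h₁ : ∀ (p : ℤ) (n : ℕ), f (Finsupp.single n 1 ⊗ₜ[ℂ] Finsupp.single ((n : ℤ) + p) 1, 0) =
      g (Finsupp.single n 1 ⊗ₜ[ℂ] Finsupp.single ((n : ℤ) + p) 1, 0))
    (h₂ : ∀ (p : ℤ) (n : ℕ), f (0, Finsupp.single (N - n + p) 1 ⊗ₜ[ℂ] Finsupp.single n 1) =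
      g (0, Finsupp.single (N - n + p) 1 ⊗ₜ[ℂ] Finsupp.single n 1)) : f = g := by
  refine LinearMap.prod_ext (TensorProduct.ext ?_) (TensorProduct.ext ?_)
  · refine Finsupp.lhom_ext' fun i => LinearMap.ext_ring (Finsupp.lhom_ext' fun j =>
      LinearMap.ext_ring ?_)
    have := h₁ (j - i) i
    rw [add_sub_cancel] at this
    exact this
  · refine Finsupp.lhom_ext' fun j => LinearMap.ext_ring (Finsupp.lhom_ext' fun i =>
      LinearMap.ext_ring ?_)
    have := h₂ (j - (N - i)) i
    rw [add_sub_cancel] at this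
    exact this

/-- The `m`-th component of the intertwining operator, on finite linear combinations. -/
def coreMap (q k₁ k₂ ε : ℝ) (N : ℤ) (m : ℕ) : CoreT →ₗ[ℂ] (ℤ →₀ ℂ) :=
  ((Finsupp.linearCombination ℂ fun s : ℕ × ℤ =>
      Finsupp.single (s.2 - s.1) (thetaNeg q k₁ k₂ ε (s.2 - s.1) s.1 m : ℂ)) ∘ₗ
    (finsuppTensorFinsupp' ℂ ℕ ℤ).toLinearMap).coprod
  ((Finsupp.linearCombination ℂ fun s : ℤ × ℕ =>
      Finsupp.single (s.1 - (N - s.2)) (thetaPos q k₁ k₂ ε (s.1 - (N - s.2)) s.2 m : ℂ)) ∘ₗ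
    (finsuppTensorFinsupp' ℂ ℤ ℕ).toLinearMap)

/-! ### Compatibility with the generators on finite linear combinations -/

section Intertwiner

variable {q k₁ k₂ ε : ℝ} {N : ℤ}

theorem coreMap_neg (m n : ℕ) (j p : ℤ) (h : j = n + p) (a b : ℂ) :
    coreMap q k₁ k₂ ε N m (Finsupp.single n a ⊗ₜ[ℂ] Finsupp.single j b, 0) =
      Finsupp.single p (a * b * thetaNeg q k₁ k₂ ε p n m) := by
  subst h
  simp [coreMap, -Finsupp.single_mul]

theorem coreMap_pos (m n : ℕ) (j p : ℤ) (h : j = N - n + p) (a b : ℂ) :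
    coreMap q k₁ k₂ ε N m (0, Finsupp.single j a ⊗ₜ[ℂ] Finsupp.single n b) =
      Finsupp.single p (a * b * thetaPos q k₁ k₂ ε p n m) := by
  subst h
  simp [coreMap, -Finsupp.single_mul]

/-- At n = 0 truncated subtraction gives e_0 again, a vector with the wrong p; the hypothesis `c 0 =
0` removes this case. -/
theorem coreMap_neg_pred {c : ℕ → ℝ} (hc : c 0 = 0) (m n : ℕ) (p : ℤ) (b : ℂ) :
    coreMap q k₁ k₂ ε N m
        (Finsupp.single (n - 1) (1 * (c n : ℂ)) ⊗ₜ[ℂ] Finsupp.single ((n : ℤ) + p) b, 0) =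
      Finsupp.single (p + 1) (c n * b * thetaNeg q k₁ k₂ ε (p + 1) (n - 1) m) := by
  rcases n with _ | n
  · simp only [hc, Complex.ofReal_zero, mul_zero, zero_mul, Finsupp.single_zero,
      TensorProduct.zero_tmul]
    exact map_zero _
  · rw [Nat.add_sub_cancel, coreMap_neg m n _ (p + 1) (by push_cast; ring), one_mul]

theorem coreMap_pos_pred {d : ℕ → ℝ} (hd : d 0 = 0) (m n : ℕ) (p : ℤ) (a : ℂ) :
    coreMap q k₁ k₂ ε N m
        (0, Finsupp.single (N - n + (p + 1)) a ⊗ₜ[ℂ] Finsupp.single (n - 1) (1 * (d n : ℂ))) =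
      Finsupp.single p (a * d n * thetaPos q k₁ k₂ ε p (n - 1) m) := by
  rcases n with _ | n
  · simp only [hd, Complex.ofReal_zero, mul_zero, zero_mul, Finsupp.single_zero,
      TensorProduct.tmul_zero]
    exact map_zero _
  · rw [Nat.add_sub_cancel, coreMap_pos m n _ p (by push_cast; ring), one_mul]

theorem coreMap_neg_add (m : ℕ) (x y : (ℕ →₀ ℂ) ⊗[ℂ] (ℤ →₀ ℂ)) :
    coreMap q k₁ k₂ ε N m (x + y, 0) =
      coreMap q k₁ k₂ ε N m (x, 0) + coreMap q k₁ k₂ ε N m (y, 0) := by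
  rw [← map_add, Prod.mk_add_mk, add_zero]

theorem coreMap_pos_add (m : ℕ) (x y : (ℤ →₀ ℂ) ⊗[ℂ] (ℕ →₀ ℂ)) :
    coreMap q k₁ k₂ ε N m (0, x + y) =
      coreMap q k₁ k₂ ε N m (0, x) + coreMap q k₁ k₂ ε N m (0, y) := by
  rw [← map_add, Prod.mk_add_mk, add_zero]

theorem negData_up (hq : q ∈ Set.Ioo (0 : ℝ) 1) (h₁ : 0 < k₁) (n : ℕ) :
    (negData q hq k₁ h₁).up n = n - 1 := rfl

theorem negData_dn (hq : q ∈ Set.Ioo (0 : ℝ) 1) (h₁ : 0 < k₁) (n : ℕ) :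
    (negData q hq k₁ h₁).dn n = n + 1 := rfl

theorem posData_up (hq : q ∈ Set.Ioo (0 : ℝ) 1) (h₂ : 0 < k₂) (n : ℕ) :
    (posData q hq k₂ h₂).up n = n + 1 := rfl

theorem posData_dn (hq : q ∈ Set.Ioo (0 : ℝ) 1) (h₂ : 0 < k₂) (n : ℕ) :
    (posData q hq k₂ h₂).dn n = n - 1 := rfl

theorem strangeData_up (hq : q ∈ Set.Ioo (0 : ℝ) 1) (σ ε : ℝ) (n : ℤ) :
    (strangeData q hq σ ε).up n = n + 1 := rfl

theorem strangeData_dn (hq : q ∈ Set.Ioo (0 : ℝ) 1) (σ ε : ℝ) (n : ℤ) :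
    (strangeData q hq σ ε).dn n = n - 1 := rfl

/-- The exponents add up to p + ε - k₁ + k₂, independently of n and m. This is why all f-vectors
with one p span a single eigenspace of `K`. -/
theorem κ_neg (hq : q ∈ Set.Ioo (0 : ℝ) 1) (h₁ : 0 < k₁) (p : ℤ) (n m : ℕ) :
    (negData q hq k₁ h₁).κ n * (strangeData q hq (k₂ - 1 / 2) (ε + k₂)).κ (n + p) =
      (strangeData q hq (k₁ + k₂ - 1 / 2 + m) (ε - k₁ + k₂)).κ p := by
  simp only [negData, strangeData]
  rw [← Real.rpow_add hq.1]
  push_cast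
  ring_nf

theorem κ_pos (hq : q ∈ Set.Ioo (0 : ℝ) 1) (h₂ : 0 < k₂) (hε : 2 * ε = N) (p : ℤ) (n m : ℕ) :
    (strangeData q hq (k₁ - 1 / 2) (-ε - k₁)).κ (N - n + p) * (posData q hq k₂ h₂).κ n =
      (strangeData q hq (k₁ + k₂ - 1 / 2 + m) (ε - k₁ + k₂)).κ p := by
  simp only [posData, strangeData]
  rw [← Real.rpow_add hq.1]
  push_cast
  rw [← hε]
  ring_nf

theorem coreMap_comp_gen (hq : q ∈ Set.Ioo (0 : ℝ) 1) (h₁ : 0 < k₁) (h₂ : 0 < k₂)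
    (hε : 2 * ε = N) (m : ℕ) (g : Gen) :
    coreMap q k₁ k₂ ε N m ∘ₗ actionT q hq k₁ k₂ h₁ h₂ ε (gen q g) =
      (strangeData q hq (k₁ + k₂ - 1 / 2 + m) (ε - k₁ + k₂)).rep (gen q g) ∘ₗ
        coreMap q k₁ k₂ ε N m := by
  obtain ⟨eK, eKi, eE, eF⟩ := comul_gen hq.1.ne'
  refine core_ext N (fun p n => ?_) (fun p n => ?_) <;>
    rw [LinearMap.comp_apply, LinearMap.comp_apply, actionT_apply, map_zero]
  · rw [coreMap_neg m n _ p rfl]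
    cases g
    · rw [eK, tensorRep_tmul, TensorProduct.map_tmul]
      simp only [WeightData.rep_K, shift_single, id]
      rw [coreMap_neg m n _ p rfl, ← κ_neg hq h₁ p n m]
      push_cast
      ring_nf
    · rw [eKi, tensorRep_tmul, TensorProduct.map_tmul]
      simp only [WeightData.rep_Kinv, shift_single, id]
      rw [coreMap_neg m n _ p rfl, ← κ_neg hq h₁ p n m, mul_inv]
      push_cast
      ring_nf
    · rw [eE, map_add, tensorRep_tmul, tensorRep_tmul, LinearMap.add_apply,
        TensorProduct.map_tmul, TensorProduct.map_tmul, coreMap_neg_add]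
      simp only [WeightData.rep_K, WeightData.rep_Kinv, WeightData.rep_E, shift_single, id,
        negData_up, strangeData_up]
      rw [coreMap_neg m n _ (p + 1) (by ring), coreMap_neg_pred (negData_c_zero hq h₁) m n p,
        ← Finsupp.single_add]
      refine congrArg _ ?_
      have h := congrArg Complex.ofReal (thetaNeg_E (ε := ε) hq h₁ h₂ p n m)
      push_cast at h ⊢
      linear_combination h
    · obtain ⟨p, rfl⟩ : ∃ p', p = p' + 1 := ⟨p - 1, by ring⟩
      rw [eF, map_add, tensorRep_tmul, tensorRep_tmul, LinearMap.add_apply,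
        TensorProduct.map_tmul, TensorProduct.map_tmul, coreMap_neg_add]
      simp only [WeightData.rep_K, WeightData.rep_Kinv, WeightData.rep_F, shift_single, id,
        negData_dn, strangeData_dn]
      rw [coreMap_neg m n _ p (by ring), coreMap_neg m (n + 1) _ p (by push_cast; ring),
        ← Finsupp.single_add, add_sub_cancel_right]
      refine congrArg _ ?_
      have h := congrArg Complex.ofReal (thetaNeg_F (ε := ε) hq h₁ h₂ p n m)
      push_cast at h ⊢
      linear_combination h
  · rw [coreMap_pos m n _ p rfl]
    cases g
    · rw [eK, tensorRep_tmul, TensorProduct.map_tmul]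
      simp only [WeightData.rep_K, shift_single, id]
      rw [coreMap_pos m n _ p rfl, ← κ_pos hq h₂ hε p n m]
      push_cast
      ring_nf
    · rw [eKi, tensorRep_tmul, TensorProduct.map_tmul]
      simp only [WeightData.rep_Kinv, shift_single, id]
      rw [coreMap_pos m n _ p rfl, ← κ_pos hq h₂ hε p n m, mul_inv]
      push_cast
      ring_nf
    · rw [eE, map_add, tensorRep_tmul, tensorRep_tmul, LinearMap.add_apply,
        TensorProduct.map_tmul, TensorProduct.map_tmul, coreMap_pos_add]
      simp only [WeightData.rep_K, WeightData.rep_Kinv, WeightData.rep_E, shift_single, id,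
        posData_up, strangeData_up]
      rw [coreMap_pos m (n + 1) _ (p + 1) (by push_cast; ring),
        coreMap_pos m n _ (p + 1) (by ring), ← Finsupp.single_add]
      refine congrArg _ ?_
      have h := congrArg Complex.ofReal (thetaPos_E hq h₁ h₂ hε p n m)
      push_cast at h ⊢
      linear_combination h
    · obtain ⟨p, rfl⟩ : ∃ p', p = p' + 1 := ⟨p - 1, by ring⟩
      rw [eF, map_add, tensorRep_tmul, tensorRep_tmul, LinearMap.add_apply,
        TensorProduct.map_tmul, TensorProduct.map_tmul, coreMap_pos_add]
      simp only [WeightData.rep_K, WeightData.rep_Kinv, WeightData.rep_F, shift_single, id,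
        posData_dn, strangeData_dn]
      rw [coreMap_pos_pred (posData_d_zero hq h₂) m n p, coreMap_pos m n _ p (by ring),
        ← Finsupp.single_add, add_sub_cancel_right]
      refine congrArg _ ?_
      have h := congrArg Complex.ofReal (thetaPos_F hq h₁ h₂ hε p n m)
      push_cast at h ⊢
      linear_combination h

theorem coreMap_action (hq : q ∈ Set.Ioo (0 : ℝ) 1) (h₁ : 0 < k₁) (h₂ : 0 < k₂)
    (hε : 2 * ε = N) (m : ℕ) (X : Uq q) (v : CoreT) :
    coreMap q k₁ k₂ ε N m (actionT q hq k₁ k₂ h₁ h₂ ε X v) =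
      (strangeData q hq (k₁ + k₂ - 1 / 2 + m) (ε - k₁ + k₂)).rep X
        (coreMap q k₁ k₂ ε N m v) := by
  obtain ⟨x, rfl⟩ := RingQuot.mkAlgHom_surjective ℂ (Rel q) X
  induction x using FreeAlgebra.induction generalizing v with
  | grade0 r => simp only [AlgHom.commutes, Module.algebraMap_end_apply, map_smul]
  | grade1 g => exact LinearMap.congr_fun (coreMap_comp_gen hq h₁ h₂ hε m g) v
  | mul a b ha hb => simp only [map_mul, Module.End.mul_apply, ha, hb]
  | add a b ha hb => simp only [map_add, LinearMap.add_apply, ha, hb]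

end Intertwiner

/-- The vector is a variable `x` with a proof of `x = j v`, so that the formula applies to
components of U v, which equal `j v` only propositionally. -/
theorem StarRep.ofCore_action {q : ℝ} {V H : Type*} [AddCommMonoid V] [Module ℂ V]
    [NormedAddCommGroup H] [InnerProductSpace ℂ H] (π : Uq q →ₐ[ℂ] Module.End ℂ V)
    (j : V →ₗ[ℂ] H) (hj : Function.Injective j) (hd : DenseRange j) (hK) (hE) (X : Uq q) (v : V)
    (x : H) (hx : x = j v) (h : x ∈ (StarRep.ofCore π j hj hd hK hE).domain) :
    ((StarRep.ofCore π j hj hd hK hE).action X ⟨x, h⟩ : H) = j (π X v) := by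
  subst hx
  have e : (LinearEquiv.ofInjective j hj).symm ⟨j v, h⟩ = v :=
    (LinearEquiv.symm_apply_eq _).2 rfl
  change j (π X ((LinearEquiv.ofInjective j hj).symm ⟨j v, h⟩)) = _
  rw [e]

/-! ### Orthonormality and completeness of Θ, and the unitary operator -/

section Theta

variable {q k₁ k₂ ε : ℝ}

/-- The matrix coefficients of the intertwiner, indexed by the basis of a weight space. -/
def theta (q k₁ k₂ ε : ℝ) (p : ℤ) (i : ℕ ⊕ ℕ) (m : ℕ) : ℝ :=
  Sum.elim (fun n => thetaNeg q k₁ k₂ ε p n m) (fun n => thetaPos q k₁ k₂ ε p n m) i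

/-- The sign of the matrix coefficients relative to the big `q`-Jacobi polynomials. -/
def thetaSign (i : ℕ ⊕ ℕ) : ℝ := Sum.elim (fun _ => 1) (fun n => (-1) ^ n) i

theorem thetaSign_mul_self (i : ℕ ⊕ ℕ) : thetaSign i * thetaSign i = 1 := by
  rcases i with i | i <;> simp [thetaSign, ← mul_pow]

theorem theta_eq (hq : 0 < q) (p : ℤ) (i : ℕ ⊕ ℕ) (m : ℕ) : theta q k₁ k₂ ε p i m =
    thetaSign i * normBigQJacobi
      (jPoint (q ^ (4 * k₁ - 2)) (-q ^ (4 * k₁ - 2 * p - 2 * ε - 2)) (q ^ 2) i) m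
      (q ^ (4 * k₁ - 2)) (q ^ (4 * k₂ - 2)) (-q ^ (4 * k₁ - 2 * p - 2 * ε - 2)) (q ^ 2) := by
  rcases i with i | i
  · rw [jPoint_neg hq]
    simp [theta, thetaSign, thetaNeg_eq]
  · rw [jPoint_pos hq]
    simp [theta, thetaSign, thetaPos_eq]

theorem hasSum_theta_mul (hq : q ∈ Set.Ioo (0 : ℝ) 1) (h₁ : 0 < k₁) (h₂ : 0 < k₂) (p : ℤ)
    (m n : ℕ) : HasSum (fun i => theta q k₁ k₂ ε p i m * theta q k₁ k₂ ε p i n)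
      (if m = n then 1 else 0) := by
  refine ((isJacobiParam hq h₁ h₂ ε p).hasSum_normBigQJacobi_mul m n).congr_fun fun i => ?_
  rw [theta_eq hq.1, theta_eq hq.1]
  rw [mul_mul_mul_comm, thetaSign_mul_self, one_mul]

theorem eq_zero_of_theta_orthogonal (hq : q ∈ Set.Ioo (0 : ℝ) 1) (h₁ : 0 < k₁) (h₂ : 0 < k₂)
    (p : ℤ) (g : ℕ ⊕ ℕ → ℂ) (hg : Summable fun i => ‖g i‖ ^ 2)
    (hm : ∀ m, ∑' i, (theta q k₁ k₂ ε p i m : ℂ) * g i = 0) (i : ℕ ⊕ ℕ) : g i = 0 := by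
  have hs (i : ℕ ⊕ ℕ) : |thetaSign i| = 1 := by
    rcases i with i | i <;> simp [thetaSign]
  have h := (isJacobiParam hq h₁ h₂ ε p).eq_zero_of_orthogonal
    (g := fun i => (thetaSign i : ℂ) * g i) (hg.congr fun i => by simp [hs])
    (fun m => (tsum_congr fun i => by
      rw [theta_eq hq.1]; push_cast; ring).trans (hm m)) i
  refine (mul_eq_zero.1 h).resolve_left fun h0 => ?_
  have := hs i
  rw [Complex.ofReal_eq_zero.1 h0] at this
  simp at this

/-- Composite of three unitaries: relabelling by weight, the matrices Θ acting in each fibre over p,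
and regrouping ℓ²(ℤ × ℕ) as a Hilbert sum over m. -/
theorem exists_unitary (hq : q ∈ Set.Ioo (0 : ℝ) 1) (h₁ : 0 < k₁) (h₂ : 0 < k₂) (N : ℤ) :
    ∃ U : HilbT ≃ₗᵢ[ℂ] lp (fun _ : ℕ => ℓ²(ℤ, ℂ)) 2, ∀ p i m,
      (U (fVec N p i) : ℕ → ℓ²(ℤ, ℂ)) m =
        (theta q k₁ k₂ ε p i m : ℂ) • embed ℤ (Finsupp.single p 1) := by
  obtain ⟨V, hV⟩ := exists_fVec_unitary N
  obtain ⟨W, hW⟩ := exists_curry_unitary (ι := ℤ) (M := ℕ)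
  obtain ⟨U, hU⟩ := exists_unitary_of_fibres (theta q k₁ k₂ ε)
    (hasSum_theta_mul hq h₁ h₂) (eq_zero_of_theta_orthogonal hq h₁ h₂)
  refine ⟨V.trans (U.trans W.symm), fun p i m => ?_⟩
  ext s
  rw [← hW]
  simp only [LinearIsometryEquiv.trans_apply, LinearIsometryEquiv.apply_symm_apply, hV]
  rw [hU, lp.coeFn_smul, Pi.smul_apply, embed_apply, Finsupp.single_apply]
  by_cases h : s = p
  · simp [h]
  · simp [h, Ne.symm h]

end Theta

/-- On finite linear combinations the components of U are `coreMap`, which has finitely supported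
values and commutes with the action. Intertwining on the whole domain then holds component by
component. -/
theorem intertwines_of_apply_fVec {q k₁ k₂ ε : ℝ} (hq : q ∈ Set.Ioo (0 : ℝ) 1) (h₁ : 0 < k₁)
    (h₂ : 0 < k₂) {N : ℤ} (hε : 2 * ε = N) (U : HilbT ≃ₗᵢ[ℂ] lp (fun _ : ℕ => ℓ²(ℤ, ℂ)) 2)
    (hU : ∀ p i m, (U (fVec N p i) : ℕ → ℓ²(ℤ, ℂ)) m =
        (theta q k₁ k₂ ε p i m : ℂ) • embed ℤ (Finsupp.single p 1)) :
    (repT q hq k₁ k₂ h₁ h₂ ε).Intertwines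
        (StarRep.directSum fun m : ℕ =>
          (strangeData q hq (k₁ + k₂ - 1 / 2 + m) (ε - k₁ + k₂)).starRep) U := by
  have hcore (m : ℕ) (v : CoreT) :
      (U (embedT v) : ℕ → ℓ²(ℤ, ℂ)) m = embed ℤ (coreMap q k₁ k₂ ε N m v) := by
    let ev : lp (fun _ : ℕ => ℓ²(ℤ, ℂ)) 2 →ₗ[ℂ] ℓ²(ℤ, ℂ) :=
      { toFun := fun φ => φ m, map_add' := fun _ _ => rfl, map_smul' := fun _ _ => rfl }
    suffices ev ∘ₗ U.toLinearEquiv.toLinearMap ∘ₗ embedT = embed ℤ ∘ₗ coreMap q k₁ k₂ ε N m from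
      LinearMap.congr_fun this v
    refine core_ext N (fun p n => ?_) (fun p n => ?_)
    · rw [LinearMap.comp_apply (embed ℤ), coreMap_neg m n _ p rfl]
      refine (hU p (Sum.inl n) m).trans ?_
      rw [← map_smul, Finsupp.smul_single]
      simp [theta]
    · rw [LinearMap.comp_apply (embed ℤ), coreMap_pos m n _ p rfl]
      refine (hU p (Sum.inr n) m).trans ?_
      rw [← map_smul, Finsupp.smul_single]
      simp [theta]
  rintro ⟨_, v, rfl⟩
  have hmem (m : ℕ) : (U (embedT v) : ℕ → ℓ²(ℤ, ℂ)) m ∈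
      ((strangeData q hq (k₁ + k₂ - 1 / 2 + m) (ε - k₁ + k₂)).starRep).domain :=
    ⟨_, (hcore m v).symm⟩
  have hact (X : Uq q) (m : ℕ) :
      (((strangeData q hq (k₁ + k₂ - 1 / 2 + m) (ε - k₁ + k₂)).starRep).action X
        ⟨_, hmem m⟩ : ℓ²(ℤ, ℂ)) =
      (U (embedT (actionT q hq k₁ k₂ h₁ h₂ ε X v)) : ℕ → ℓ²(ℤ, ℂ)) m := by
    refine (StarRep.ofCore_action _ _ _ _ _ _ X _ _ (hcore m v) _).trans ?_
    rw [hcore, coreMap_action hq h₁ h₂ hε]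
  -- Square summability of the vectors π_m(X)(Uv)_m is automatic: by `hact` they are the components
  -- of the vector U T'(X) v of the Hilbert sum.
  refine ⟨⟨hmem, fun X => ?_⟩, fun X => ?_⟩
  · rw [funext (hact X)]
    exact lp.memℓp _
  · have e : ((repT q hq k₁ k₂ h₁ h₂ ε).action X ⟨embedT v, v, rfl⟩ : HilbT) =
        embedT (actionT q hq k₁ k₂ h₁ h₂ ε X v) :=
      StarRep.ofCore_action _ _ _ _ _ _ X v _ rfl _
    rw [e]
    exact lp.ext (funext (hact X))

end SU11

end

theorem theorem3p5 (q : ℝ) (hq : q ∈ Set.Ioo (0 : ℝ) 1) (k₁ k₂ : ℝ) (h₁ : 0 < k₁) (h₂ : 0 < k₂)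
    (ε : ℝ) (N : ℤ) (hε : 2 * ε = N) :
    ∃ U : SU11.HilbT ≃ₗᵢ[ℂ] lp (fun _ : ℕ => ℓ²(ℤ, ℂ)) 2,
      (SU11.repT q hq k₁ k₂ h₁ h₂ ε).Intertwines
        (SU11.StarRep.directSum fun m : ℕ =>
          (SU11.strangeData q hq (k₁ + k₂ - 1 / 2 + m) (ε - k₁ + k₂)).starRep) U ∧
      (∀ (p : ℤ) (n m : ℕ), (U (SU11.basisNeg n (n + p)) : ℕ → ℓ²(ℤ, ℂ)) m =
        (SU11.thetaNeg q k₁ k₂ ε p n m : ℂ) • SU11.embed ℤ (Finsupp.single p 1)) ∧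
      (∀ (p : ℤ) (n m : ℕ), (U (SU11.basisPos (N - n + p) n) : ℕ → ℓ²(ℤ, ℂ)) m =
        (SU11.thetaPos q k₁ k₂ ε p n m : ℂ) • SU11.embed ℤ (Finsupp.single p 1)) := by
  obtain ⟨U, hU⟩ := SU11.exists_unitary (ε := ε) hq h₁ h₂ N
  exact ⟨U, SU11.intertwines_of_apply_fVec hq h₁ h₂ hε U hU,
    fun p n m => hU p (Sum.inl n) m, fun p n m => hU p (Sum.inr n) m⟩
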